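/- \textbf{Setting.} Nodes $p_i\in\mathcal P$ (finite, totally ordered identifiers) host a server, a client, or both; there are $N$ servers, at most $f$ of which may fail and at most $e$ of which are malicious (they may corrupt only the coded elements in their replies to clients), and $1\le k<N$, $k\le N-2(f+e)$. A quorum is a set of at least $\lceil (N+k+2e)/2\rceil$ servers. Tags are pairs $(z,j)\in\mathcal T=\mathbb Z^+\times\mathcal P$, ordered lexicographically, together with a default tag $t_0$ below all of them; phases are $\mathcal D=\{\text{pre},\text{fin},\text{FIN}\}$. A server stores a finite set $S$ of records $(t,w,d)$, where $t\in\mathcal T$, $d\in\mathcal D$, and $w$ is a coded element or $\bot$. Let $MAXINT>1$ be an integer and $t_{top}=(MAXINT,\max\{k:p_k\in\mathcal P\})$. For $D\subseteq\mathcal D$ let $maxPhase(D)$ be the largest tag in $S$ with phase in $D$ ($t_0$ if there is none), and let $tagTuple()=(maxPhase(\mathcal D),maxPhase(\mathcal D\setminus\{\text{pre}\}),maxPhase(\{\text{FIN}\}))$. \textbf{Records.} $updatePhase(t,w,u)$ does nothing for $t=t_0$; otherwise, if $w=\bot$ and $S$ has a record of tag $t$ with a coded element, it keeps that element and changes the record's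 phase from pre to fin if $u=\text{fin}$, from fin to FIN if $u=\text{FIN}$, and not at all in the other cases; otherwise it replaces all records of tag $t$ by $(t,w,u)$. A record is FINALIZED if its phase is FIN or $S$ has a record with a larger tag of the same client. For a fixed $\delta\ge 0$, $relevant(S)$ keeps the records whose tag is $maxPhase(\mathcal D)$, or $maxPhase(\mathcal D\setminus\{\text{pre}\})$, or the tag of a record that is not FINALIZED, or one of the $\delta+1$ largest tags of FINALIZED records. \textbf{The bounded algorithm.} Clients access the servers by sending a request to every server and waiting for acknowledgments of this request by a quorum. A writer queries, takes the largest reported tag $(z,\cdot)$ ($z=0$ for $t_0$), and then, with the tag $(z+1,i)$ and coded elements $w_j$, accesses the servers with the pre-write $((z+1,i),w_j,\text{pre})$, then with $((z+1,i),\bot,\text{fin})$, and then with $((z+1,i),\bot,\text{FIN})$. A reader queries and then accesses the servers with $(t,\bot,\text{fin})$, where $t$ is the largest reported tag. A server answers a reader's query by $maxPhase(\mathcal D\setminus\{\text{pre}\})$; it answers a writer's query by $maxPhase(\mathcal D)$, but only if $maxPhase(\mathcal D)\le t_{top}$; on a request $(t,w,d)$ it calls $updatePhase(t,w,d)$ and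 acknowledges. Servers repeatedly send each other their last computed $tagTuple()$. When gossip arrives at the server of $p_i$, whose array $gossip[\,]$ holds the last triples $(pre[k],fin[k],FIN[k])$ received from all servers (entry $i$ being its own), it sets, in this order, $pre[i]$ to the maximum of all entries of $gossip[\,]$ and of $maxPhase(\mathcal D)$ and calls $updatePhase(pre[i],\bot,\text{pre})$; sets $fin[i]$ to the maximum of all $fin[k],FIN[k]$ and of $maxPhase(\mathcal D\setminus\{\text{pre}\})$ and calls $updatePhase(fin[i],\bot,\text{fin})$; sets $FIN[i]$ to the maximum of all $FIN[k]$, of $maxPhase(\{\text{FIN}\})$ and of the tags $t$ for which $\{k:fin[k]=t\}$ is a quorum, and calls $updatePhase(FIN[i],\bot,\text{FIN})$. Then, if $maxPhase(\mathcal D)\ge t_{top}$, $gossip[k]=tagTuple()$ for every server $k$, and $tagTuple()=(t,t',t')$ with $t\ge t'$, it calls $globalReset(maxPhase(\mathcal D\setminus\{\text{pre}\}))$; otherwise it sets $S\leftarrow relevant(S)$. \textbf{Executions.} An execution $R$ is an infinite sequence of atomic steps from an arbitrary starting state (arbitrary contents of servers, clients and links, arbitrary reset activity). Communication is by links between servers,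 and between clients and servers, on each of which one token alternates. $R$ is fair if every step of the program or of the links that is applicable infinitely often is taken infinitely often (so no node fails in $R$). An asynchronous cycle of $R$ is the shortest prefix in which every server completes an iteration (it receives gossip from another server, then sends to every other server, and then completes a round trip with each of them), every client node completes a round trip with every server, and every node that runs a client procedure during the prefix completes a client round (it stops waiting for the responses of one access, possibly because it is aborted); the next cycle is the first cycle of the remaining suffix. A state is within $m$ cycles of another if it does not come after the end of the $m$-th cycle counted from there. \textbf{The reset service.} A state is \emph{reset-free} if all servers and clients are enabled and no channel includes reset-related messages. Disabled machines take no part in the algorithm. $localReset(t)$ at a (disabled) node aborts the client's operation, empties the gossip buffers, removes every record with a tag other than $t$ from the server's storage, and replaces the tag $t=(z,k)$ by $(1,k)$; for $t=t_0$ no record is kept. With the bound $\Psi\ge 1$, the service meets the following requirements in $R$. (a) Within $\Psi$ cycles from the starting state there is a state from which on all states are reset-free as long as no node has called $globalReset$. (b) Within $\Psi$ cycles from the first call to $globalReset$ (if there is one), the service has had every node disabled and, while disabled, execute $localReset(t)$ for the argument $t$ of a call; all channels are clean of other than reset-related messages; and then, from this state, it enables all machines, which results in a reset-free state. \textbf{Lemma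 (Eventual recovery of the bounded variation).} There is a universal constant $C$ such that the following holds. Let $R$ be a fair execution of the bounded algorithm with a reset service that meets the above requirements with the bound $\Psi$, and suppose that in the starting state of $R$ some server stores a record with a tag $t\ge t_{top}$. Then, within $C\cdot\Psi$ asynchronous cycles, $R$ reaches a state that is both reset-free and overflow-free, i.e., all machines are enabled, no channel includes reset-related messages, and every tag in the state (in the servers, the clients and the messages in transit) is smaller than $t_{top}$. -/

import Mathlib

namespace BoundedCAS

/-! ### Tags, phases, records -/

/-- The set `𝒯 = ℤ⁺ × 𝒫` of tags, ordered lexicographically. -/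
abbrev Stamp (P : Type*) := ℕ+ ×ₗ P

/-- Tags together with the default tag `t₀ = ⊥`, which is below every element of `𝒯`. -/
abbrev Tag (P : Type*) := WithBot (Stamp P)

/-- The three phases of a record: 'pre', 'fin' (finalized) and 'FIN' (FINALIZED). -/
inductive Phase
  | pre
  | fin
  | FIN
  deriving DecidableEq

/-- The set `𝒟` of all phases. -/
def allPhases : Finset Phase := {Phase.pre, Phase.fin, Phase.FIN}

/-- The set `𝒟 \ {'pre'}`. -/
def finPhases : Finset Phase := {Phase.fin, Phase.FIN}

/-- A stored record `(t, w, d)`; `w = none` stands for the absent coded element `⊥`. -/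
structure Record (P W : Type*) where
  tag : Stamp P
  word : Option W
  phase : Phase
  deriving DecidableEq

/-- The gossiped triple (maximal tag of all records, of the finalized and FINALIZED ones,
of the FINALIZED ones). -/
structure Triple (P : Type*) where
  pre : Tag P
  fin : Tag P
  FIN : Tag P
  deriving DecidableEq

/-- The fixed parameters of the system. -/
structure Setup (P W V : Type*) [Fintype P] [LinearOrder P] where
  /-- nodes that host a server, and nodes that host a client (a node may host both) -/
  servers : Finset P
  clients : Finset P
  hosts : servers ∪ clients = Finset.univ
  /-- bound on failing servers, on malicious servers, and the code parameter -/
  f : ℕ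
  e : ℕ
  k : ℕ
  k_pos : 1 ≤ k
  k_lt : k < servers.card
  k_le : k + 2 * (f + e) ≤ servers.card
  /-- servers that may corrupt the coded elements in their replies to clients -/
  malicious : Finset P
  malicious_sub : malicious ⊆ servers
  malicious_card : malicious.card ≤ e
  /-- the coded elements of a secret, one for every server -/
  code : V → P → W
  /-- the bound on the number of writes concurrent with a read, used by `relevant` -/
  δ : ℕ
  maxInt : ℕ+
  maxInt_gt : 1 < maxInt

section Storage

variable {P W V : Type*} [Fintype P] [LinearOrder P] [Nonempty P] [DecidableEq W]

/-- `t_top = (MAXINT, max {k : p_k ∈ 𝒫})`. -/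
def Setup.tTop (p : Setup P W V) : Stamp P :=
  toLex (p.maxInt, Finset.univ.max' Finset.univ_nonempty)

/-- A quorum is a set of at least `⌈(N + k + 2e)/2⌉` of the `N` servers. -/
def Setup.IsQuorum (p : Setup P W V) (Q : Finset P) : Prop :=
  Q ⊆ p.servers ∧ (p.servers.card + p.k + 2 * p.e + 1) / 2 ≤ Q.card

instance (p : Setup P W V) (Q : Finset P) : Decidable (p.IsQuorum Q) :=
  inferInstanceAs (Decidable (_ ∧ _))

/-- `maxPhase(phs)`: the maximal tag of a record of `S` with a phase in `phs`, and `t₀` if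
there is none. -/
def maxPhase (S : Finset (Record P W)) (phs : Finset Phase) : Tag P :=
  S.sup fun r => if r.phase ∈ phs then (r.tag : Tag P) else ⊥

/-- `tagTuple()`. -/
def tagTuple (S : Finset (Record P W)) : Triple P :=
  ⟨maxPhase S allPhases, maxPhase S finPhases, maxPhase S {Phase.FIN}⟩

/-- `upgradePhase(old, new)`. -/
def upgradePhase : Phase → Phase → Phase
  | Phase.pre, Phase.fin => Phase.fin
  | Phase.fin, Phase.FIN => Phase.FIN
  | old, _ => old

/-- `updatePhase(t, w, u)`.  A record's tag is an element of `𝒯`, so nothing is stored for `t₀`.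
(If, in a corrupted storage, several records with tag `t` have a coded element, then each
of them is upgraded.) -/
def updatePhase (S : Finset (Record P W)) (t : Tag P) (w : Option W) (u : Phase) :
    Finset (Record P W) :=
  match t with
  | none => S
  | some t =>
    if w = none ∧ ∃ r ∈ S, r.tag = t ∧ r.word ≠ none then
      S.image fun r =>
        if r.tag = t ∧ r.word ≠ none then { r with phase := upgradePhase r.phase u } else r
    else insert ⟨t, w, u⟩ (S.filter fun r => r.tag ≠ t)

/-- A record of `S` is FINALIZED explicitly (by its phase) or implicitly (by a record of `S` with
a larger tag of the same client). -/
def IsFinalized (S : Finset (Record P W)) (r : Record P W) : Prop :=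
  r.phase = Phase.FIN ∨
    ∃ r' ∈ S, (ofLex r'.tag).2 = (ofLex r.tag).2 ∧ (ofLex r.tag).1 < (ofLex r'.tag).1

instance (S : Finset (Record P W)) (r : Record P W) : Decidable (IsFinalized S r) :=
  inferInstanceAs (Decidable (_ ∨ _))

/-- The tags of the explicitly or implicitly FINALIZED records of `S`. -/
def finalizedTags (S : Finset (Record P W)) : Finset (Stamp P) :=
  (S.filter fun r => IsFinalized S r).image Record.tag

/-- `relevant(S)`: the records whose tag is the maximal one, the maximal finalized one, the tag
of a record that is not yet FINALIZED, or one of the `δ + 1` largest FINALIZED tags. -/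
def relevant (δ : ℕ) (S : Finset (Record P W)) : Finset (Record P W) :=
  S.filter fun r =>
    (r.tag : Tag P) = maxPhase S allPhases ∨
    (r.tag : Tag P) = maxPhase S finPhases ∨
    (∃ r' ∈ S, r'.tag = r.tag ∧ ¬ IsFinalized S r') ∨
    (r.tag ∈ finalizedTags S ∧ ((finalizedTags S).filter fun t => r.tag < t).card ≤ δ)

end Storage

/-! ### Local states, messages and links -/

/-- The state of a server: the storage, the last gossip received from every server (the entry
of the server itself aggregates), and the gossip to be sent. -/
structure Server (P W : Type*) where
  store : Finset (Record P W)
  rx : P → Triple P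
  tx : Triple P

/-- Requests of a client to a server.  The flag `reader` tells whether the client is a reader;
the flag `last` distinguishes FINALIZE ('FIN') from finalize ('fin'). -/
inductive Req (P W : Type*)
  | query (reader : Bool)
  | prewrite (t : Stamp P) (w : W)
  | finalize (reader : Bool) (t : Tag P) (last : Bool)
  deriving DecidableEq

/-- An acknowledgment: a tag and possibly a coded element. -/
structure Ack (P W : Type*) where
  tag : Tag P
  word : Option W

/-- The quorum access a client is in: the four phases of a writer, the two of a reader. -/
inductive Proc (P V : Type*)
  | wQuery (s : V)
  | wPre (t : Stamp P) (s : V)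
  | wFin (t : Stamp P)
  | wFIN (t : Stamp P)
  | rQuery
  | rFin (t : Tag P)

/-- The state of a client.  During a quorum access, `sent k` tells whether the request of this
access was sent to server `k`, and `acks k` is the acknowledgment of `k`, if it has arrived. -/
inductive Client (P W V : Type*)
  | idle
  | busy (proc : Proc P V) (sent : P → Bool) (acks : P → Option (Ack P W))

/-- The procedure phase that a client runs, if any. -/
def Client.proc {P W V : Type*} : Client P W V → Option (Proc P V)
  | .idle => none
  | .busy pr _ _ => some pr

/-- The token of the gossip link from one server to another: at the sender, or on its way to the
receiver with a payload (`none` if the sender was disabled). -/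
inductive GossipLink (P : Type*)
  | atSender
  | inTransit (m : Option (Triple P))

/-- The token of the ping-pong link between a client and a server: at the client, on its way to the
server with a request, at the server with the request and the reply, on its way back. -/
inductive PingLink (P W : Type*)
  | atClient
  | request (q : Option (Req P W))
  | atServer (q : Option (Req P W)) (a : Option (Ack P W))
  | response (q : Option (Req P W)) (a : Option (Ack P W))

/-- The same link with its payload removed. -/
def GossipLink.clear {P : Type*} : GossipLink P → GossipLink P
  | .atSender => .atSender
  | .inTransit _ => .inTransit none

/-- The same link with its payload removed. -/
def PingLink.clear {P W : Type*} : PingLink P W → PingLink P W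
  | .atClient => .atClient
  | .request _ => .request none
  | .atServer _ _ => .atServer none none
  | .response _ _ => .response none none

/-- A system state. -/
structure State (P W V : Type*) where
  srv : P → Server P W
  cli : P → Client P W V
  gossip : P → P → GossipLink P
  ping : P → P → PingLink P W
  /-- whether the server and the client of a node are enabled -/
  srvOn : P → Bool
  cliOn : P → Bool
  /-- whether the channel from a node to a node contains reset-related messages -/
  resetMsg : P → P → Bool

/-- The steps of the system.  The last six kinds are steps of the global reset service. -/
inductive Event (P V : Type*)
  | gossipSend (i j : P)
  | gossipReceive (i j : P)
  | pingSend (i j : P)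
  | pingReceive (i j : P)
  | pongSend (i j : P)
  | pongReceive (i j : P)
  | startWrite (i : P) (s : V)
  | startRead (i : P)
  | resetSend (i j : P)
  | resetReceive (i j : P)
  | disable (i : P)
  | localReset (i : P) (t : Tag P)
  | clean (i : P)
  | enable (A : Finset P)

/-- The steps that the nodes' program and the links are bound to take.  (Invocations of operations
come from outside; the reset service has its own requirements.) -/
def Event.IsComm {P V : Type*} : Event P V → Prop
  | .gossipSend _ _ => True
  | .gossipReceive _ _ => True
  | .pingSend _ _ => True
  | .pingReceive _ _ => True
  | .pongSend _ _ => True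
  | .pongReceive _ _ => True
  | _ => False

/-! ### The program -/

section Program

variable {P W V : Type*} [Fintype P] [LinearOrder P] [Nonempty P] [DecidableEq W]

/-- Write `x` at position `(i, j)`. -/
def set₂ {α : Type*} (g : P → P → α) (i j : P) (x : α) : P → P → α :=
  Function.update g i (Function.update (g i) j x)

/-- Arrival of the gossip `m` from `j` at the server `s` of `i`.  The second component is the
argument of the call to `globalReset`, if there is such a call. -/
def onGossip (p : Setup P W V) (i : P) (s : Server P W) (j : P) (m : Triple P) :
    Server P W × Option (Tag P) :=
  let rx := Function.update s.rx j m
  let pre := p.servers.sup (fun k => (rx k).pre ⊔ (rx k).fin ⊔ (rx k).FIN) ⊔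
    maxPhase s.store allPhases
  let S₁ := updatePhase s.store pre none Phase.pre
  let fin := p.servers.sup (fun k => (rx k).fin ⊔ (rx k).FIN) ⊔ maxPhase S₁ finPhases
  let S₂ := updatePhase S₁ fin none Phase.fin
  let finOf := fun k => if k = i then fin else (rx k).fin
  let FIN := p.servers.sup (fun k => (rx k).FIN) ⊔ maxPhase S₂ {Phase.FIN} ⊔
    p.servers.sup (fun k =>
      if p.IsQuorum (p.servers.filter fun l => finOf l = finOf k) then finOf k else ⊥)
  let S₃ := updatePhase S₂ FIN none Phase.FIN
  let rx' := Function.update rx i ⟨pre, fin, FIN⟩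
  if (p.tTop : Tag P) ≤ maxPhase S₃ allPhases ∧ (∀ k ∈ p.servers, rx' k = tagTuple S₃) ∧
      (tagTuple S₃).fin = (tagTuple S₃).FIN ∧ (tagTuple S₃).fin ≤ (tagTuple S₃).pre then
    (⟨S₃, rx', tagTuple S₃⟩, some (maxPhase S₃ finPhases))
  else
    (⟨relevant p.δ S₃, rx', tagTuple (relevant p.δ S₃)⟩, none)

/-- The storage of a server after the arrival of a request. -/
def storeAfter (S : Finset (Record P W)) : Req P W → Finset (Record P W)
  | .query _ => S
  | .prewrite t w => updatePhase S (t : Tag P) (some w) Phase.pre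
  | .finalize _ t last => updatePhase S t none (if last then Phase.FIN else Phase.fin)

/-- `Replies p S' r a`: a server with storage `S'` (after the update) answers the request `r` by `a`;
`a = none` says that it does not answer.  A query of a writer is answered only if no
tag above `t_top` is stored.  A reader's finalize request is answered with the coded element of a
stored record with the requested tag and phase, if there is one. -/
def Replies (p : Setup P W V) (S' : Finset (Record P W)) :
    Req P W → Option (Ack P W) → Prop
  | .query reader, a =>
      if reader then a = some ⟨maxPhase S' finPhases, none⟩
      else if maxPhase S' allPhases ≤ (p.tTop : Tag P) then a = some ⟨maxPhase S' allPhases, none⟩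
      else a = none
  | .prewrite t _, a => a = some ⟨t, none⟩
  | .finalize reader t last, a =>
      ∃ w : Option W, a = some ⟨t, w⟩ ∧
        if reader = true ∧ ∃ r ∈ S', (r.tag : Tag P) = t ∧
            r.phase = (if last then Phase.FIN else Phase.fin) then
          ∃ r ∈ S', (r.tag : Tag P) = t ∧
            r.phase = (if last then Phase.FIN else Phase.fin) ∧ r.word = w
        else w = none

/-- The request that a client sends to the server of `j` in a given phase of its procedure. -/
def Proc.req (p : Setup P W V) (j : P) : Proc P V → Req P W
  | .wQuery _ => .query false
  | .wPre t s => .prewrite t (p.code s j)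
  | .wFin t => .finalize false (t : Tag P) false
  | .wFIN t => .finalize false (t : Tag P) true
  | .rQuery => .query true
  | .rFin t => .finalize true t false

/-- The tag `(z + 1, i)` that the writer of `i` uses when the largest reported tag is `(z, j)`, and
`(1, i)` when it is `t₀`. -/
def nextStamp (i : P) : Tag P → Stamp P
  | none => toLex (1, i)
  | some t => toLex ((ofLex t).1 + 1, i)

/-- The largest acknowledged tag. -/
def maxAck (p : Setup P W V) (acks : P → Option (Ack P W)) : Tag P :=
  p.servers.sup fun k => match acks k with
    | none => ⊥
    | some a => a.tag

/-- A new quorum access: nothing is sent yet and nothing is acknowledged. -/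
def Client.enter (pr : Proc P V) : Client P W V := .busy pr (fun _ => false) (fun _ => none)

/-- The client of `i` after its current quorum access returned with `acks`.  (What a reader returns
to its caller is not part of the system state.) -/
def Client.advance (p : Setup P W V) (i : P) (acks : P → Option (Ack P W)) :
    Proc P V → Client P W V
  | .wQuery s => .enter (.wPre (nextStamp i (maxAck p acks)) s)
  | .wPre t _ => .enter (.wFin t)
  | .wFin t => .enter (.wFIN t)
  | .wFIN _ => .idle
  | .rQuery => .enter (.rFin (maxAck p acks))
  | .rFin _ => .idle

/-- The client of `i` when the token returns from the server of `j` with a request and a reply.  Only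
a reply to the request of the current quorum access counts; the access returns once a quorum
has replied. -/
def onReply (p : Setup P W V) (i j : P) (q : Option (Req P W)) (a : Option (Ack P W)) :
    Client P W V → Client P W V
  | .idle => .idle
  | .busy pr sent acks =>
    let acks' := if sent j = true ∧ q = some (pr.req p j) ∧ a.isSome then
      Function.update acks j a else acks
    if p.IsQuorum (p.servers.filter fun k => (acks' k).isSome) then .advance p i acks' pr
    else .busy pr sent acks'

/-- The request that departs from the client to the server of `j`, if any. -/
def Client.outgoing (p : Setup P W V) (j : P) : Client P W V → Option (Req P W)
  | .idle => none
  | .busy pr _ _ => some (pr.req p j)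

/-- The client remembers that its request departed to the server of `j`. -/
def Client.markSent (j : P) : Client P W V → Client P W V
  | .idle => .idle
  | .busy pr sent acks => .busy pr (Function.update sent j true) acks

/-- `localReset(t)` on a storage: only the records with tag `t = (z, k)` are kept, and their tag
becomes `(1, k)`; nothing is kept for `t₀`. -/
def localResetStore (S : Finset (Record P W)) : Tag P → Finset (Record P W)
  | none => ∅
  | some t => (S.filter fun r => r.tag = t).image fun r =>
      { r with tag := toLex (1, (ofLex r.tag).2) }

/-- `localReset(t)` on a server; the buffers of the gossip service are emptied. -/
def localResetServer (s : Server P W) (t : Tag P) : Server P W :=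
  ⟨localResetStore s.store t, fun _ => ⟨⊥, ⊥, ⊥⟩, ⟨⊥, ⊥, ⊥⟩⟩

/-- One step of the system.  The tokens of the links circulate also while machines are disabled;
a disabled machine neither fills nor reads them. -/
def Step (p : Setup P W V) (c : State P W V) : Event P V → State P W V → Prop
  | .gossipSend i j, c' =>
      i ∈ p.servers ∧ j ∈ p.servers ∧ i ≠ j ∧ c.gossip i j = .atSender ∧
      c' = { c with
        gossip := set₂ c.gossip i j (.inTransit (if c.srvOn i then some (c.srv i).tx else none)) }
  | .gossipReceive i j, c' =>
      i ∈ p.servers ∧ j ∈ p.servers ∧ i ≠ j ∧ ∃ m, c.gossip i j = .inTransit m ∧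
      c' = { c with
        gossip := set₂ c.gossip i j .atSender
        srv := match m, c.srvOn j with
          | some m, true => Function.update c.srv j (onGossip p j (c.srv j) i m).1
          | _, _ => c.srv }
  | .pingSend i j, c' =>
      i ∈ p.clients ∧ j ∈ p.servers ∧ c.ping i j = .atClient ∧
      c' = { c with
        ping := set₂ c.ping i j (.request (if c.cliOn i then (c.cli i).outgoing p j else none))
        cli := if c.cliOn i then Function.update c.cli i ((c.cli i).markSent j) else c.cli }
  | .pingReceive i j, c' =>
      i ∈ p.clients ∧ j ∈ p.servers ∧ ∃ q, c.ping i j = .request q ∧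
      match q, c.srvOn j with
      | some r, true => ∃ a a',
          Replies p (storeAfter (c.srv j).store r) r a ∧
          (if j ∈ p.malicious then a'.map Ack.tag = a.map Ack.tag else a' = a) ∧
          c' = { c with
            ping := set₂ c.ping i j (.atServer (some r) a')
            srv := Function.update c.srv j
              { c.srv j with store := storeAfter (c.srv j).store r } }
      | _, _ => c' = { c with ping := set₂ c.ping i j (.atServer none none) }
  | .pongSend i j, c' =>
      i ∈ p.clients ∧ j ∈ p.servers ∧ ∃ q a, c.ping i j = .atServer q a ∧
      c' = { c with
        ping := set₂ c.ping i j
          (if c.srvOn j then .response q a else .response none none) }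
  | .pongReceive i j, c' =>
      i ∈ p.clients ∧ j ∈ p.servers ∧ ∃ q a, c.ping i j = .response q a ∧
      c' = { c with
        ping := set₂ c.ping i j .atClient
        cli := if c.cliOn i then Function.update c.cli i (onReply p i j q a (c.cli i))
          else c.cli }
  | .startWrite i s, c' =>
      i ∈ p.clients ∧ c.cliOn i = true ∧ c.cli i = .idle ∧
      c' = { c with cli := Function.update c.cli i (.enter (.wQuery s)) }
  | .startRead i, c' =>
      i ∈ p.clients ∧ c.cliOn i = true ∧ c.cli i = .idle ∧
      c' = { c with cli := Function.update c.cli i (.enter .rQuery) }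
  | .resetSend i j, c' => c' = { c with resetMsg := set₂ c.resetMsg i j true }
  | .resetReceive i j, c' => c' = { c with resetMsg := set₂ c.resetMsg i j false }
  | .disable i, c' =>
      c' = { c with
        srvOn := Function.update c.srvOn i false
        cliOn := Function.update c.cliOn i false }
  | .localReset i t, c' =>
      c.srvOn i = false ∧ c.cliOn i = false ∧
      c' = { c with
        srv := Function.update c.srv i (localResetServer (c.srv i) t)
        cli := Function.update c.cli i .idle }
  | .clean i, c' =>
      c.srvOn i = false ∧ c.cliOn i = false ∧
      c' = { c with
        gossip := fun j k => if j = i ∨ k = i then (c.gossip j k).clear else c.gossip j k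
        ping := fun j k => if j = i ∨ k = i then (c.ping j k).clear else c.ping j k }
  | .enable A, c' =>
      c' = { c with
        srvOn := fun i => if i ∈ A then true else c.srvOn i
        cliOn := fun i => if i ∈ A then true else c.cliOn i }

/-- An (unbounded) execution; its starting state is arbitrary. -/
structure Execution (p : Setup P W V) where
  state : ℕ → State P W V
  event : ℕ → Event P V
  step : ∀ n, Step p (state n) (event n) (state (n + 1))

variable {p : Setup P W V}

/-- Every step that is applicable infinitely often is taken infinitely often. -/
def Execution.Fair (R : Execution p) : Prop :=
  ∀ ev : Event P V, ev.IsComm →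
    (∀ n, ∃ m, n ≤ m ∧ ∃ c', Step p (R.state m) ev c') → ∀ n, ∃ m, n ≤ m ∧ R.event m = ev

/-- In step `n`, node `i` calls `globalReset(t)`. -/
def Execution.CallsReset (R : Execution p) (n : ℕ) (i : P) (t : Tag P) : Prop :=
  ∃ j m, R.event n = .gossipReceive j i ∧ (R.state n).gossip j i = .inTransit (some m) ∧
    (R.state n).srvOn i = true ∧ (onGossip p i ((R.state n).srv i) j m).2 = some t

/-! ### Asynchronous cycles -/

/-- The steps `x, …, y - 1` include a complete iteration of the server at `i`: it gets a message from
another server, then sends to every other server `j`, `j` receives, then `j` sends, and `i`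
receives. -/
def Execution.ServerIteration (R : Execution p) (x y : ℕ) (i : P) : Prop :=
  ∃ a k, x ≤ a ∧ R.event a = .gossipReceive k i ∧
    ∀ j ∈ p.servers, j ≠ i → ∃ b₁ b₂ b₃ b₄, a < b₁ ∧ b₁ < b₂ ∧ b₂ < b₃ ∧ b₃ < b₄ ∧ b₄ < y ∧
      R.event b₁ = .gossipSend i j ∧ R.event b₂ = .gossipReceive i j ∧
      R.event b₃ = .gossipSend j i ∧ R.event b₄ = .gossipReceive j i

/-- The steps `x, …, y - 1` include a complete round trip of the client of `i` with the server of
`j`. -/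
def Execution.RoundTrip (R : Execution p) (x y : ℕ) (i j : P) : Prop :=
  ∃ b₁ b₂ b₃ b₄, x ≤ b₁ ∧ b₁ < b₂ ∧ b₂ < b₃ ∧ b₃ < b₄ ∧ b₄ < y ∧
    R.event b₁ = .pingSend i j ∧ R.event b₂ = .pingReceive i j ∧
    R.event b₃ = .pongSend i j ∧ R.event b₄ = .pongReceive i j

/-- In step `n` the client of `i` ends a round: it stops waiting for the servers' responses and
moves on to the next phase or to the end of the procedure (also when the operation is aborted). -/
def Execution.EndsRound (R : Execution p) (n : ℕ) (i : P) : Prop :=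
  ((R.state n).cli i).proc ≠ none ∧
    ((R.state (n + 1)).cli i).proc ≠ ((R.state n).cli i).proc

/-- The segment with the steps `x, …, y - 1` includes a complete iteration of every server, a complete
round trip of every client node with every server, and a completed client round of every
node that runs a client procedure during the segment. -/
def Execution.CycleDone (R : Execution p) (x y : ℕ) : Prop :=
  (∀ i ∈ p.servers, R.ServerIteration x y i) ∧
  (∀ i ∈ p.clients, ∀ j ∈ p.servers, R.RoundTrip x y i j) ∧
  ∀ i ∈ p.clients, (∃ n, x ≤ n ∧ n < y ∧ ((R.state n).cli i).proc ≠ none) →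
    ∃ n, x ≤ n ∧ n < y ∧ R.EndsRound n i

/-- The first asynchronous cycle of the suffix starting at state `x` ends at state `y`. -/
def Execution.IsCycle (R : Execution p) (x y : ℕ) : Prop :=
  R.CycleDone x y ∧ ∀ y', y' < y → ¬ R.CycleDone x y'

/-- `R.CyclesEnd x n z`: the `n`-th asynchronous cycle after state `x` ends at state `z`. -/
inductive Execution.CyclesEnd (R : Execution p) (x : ℕ) : ℕ → ℕ → Prop
  | zero : Execution.CyclesEnd R x 0 x
  | succ {n y z : ℕ} : Execution.CyclesEnd R x n y → R.IsCycle y z →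
      Execution.CyclesEnd R x (n + 1) z

/-- State `y` is reached within `n` asynchronous cycles from state `x`: it does not come after
the end of the `n`-th cycle. -/
def Execution.Within (R : Execution p) (x n y : ℕ) : Prop :=
  x ≤ y ∧ ∀ z, R.CyclesEnd x n z → y ≤ z

/-! ### Reset-free and overflow-free states, the reset service -/

/-- All machines are enabled and no channel includes reset-related messages. -/
def State.ResetFree (p : Setup P W V) (c : State P W V) : Prop :=
  (∀ i ∈ p.servers, c.srvOn i = true) ∧ (∀ i ∈ p.clients, c.cliOn i = true) ∧
  ∀ i j, c.resetMsg i j = false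

/-- The machines of node `i` are disabled. -/
def State.Disabled (c : State P W V) (i : P) : Prop :=
  c.srvOn i = false ∧ c.cliOn i = false

/-- Only reset-related messages are in the channels. -/
def State.Cleaned (c : State P W V) : Prop :=
  (∀ i j, c.gossip i j = (c.gossip i j).clear) ∧ ∀ i j, c.ping i j = (c.ping i j).clear

/-- The tags in a gossip triple. -/
def Triple.tags (m : Triple P) : Set (Tag P) := {m.pre, m.fin, m.FIN}

/-- The tags in a request. -/
def Req.tags : Req P W → Set (Tag P)
  | .query _ => ∅
  | .prewrite t _ => {(t : Tag P)}
  | .finalize _ t _ => {t}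

/-- The tags in the phase of a client procedure. -/
def Proc.tags : Proc P V → Set (Tag P)
  | .wQuery _ => ∅
  | .wPre t _ => {(t : Tag P)}
  | .wFin t => {(t : Tag P)}
  | .wFIN t => {(t : Tag P)}
  | .rQuery => ∅
  | .rFin t => {t}

/-- The tags in the state of a client. -/
def Client.tags (p : Setup P W V) : Client P W V → Set (Tag P)
  | .idle => ∅
  | .busy pr _ acks => pr.tags ∪ {t | ∃ k ∈ p.servers, ∃ a, acks k = some a ∧ a.tag = t}

/-- The tags in the state of a server. -/
def Server.tags (p : Setup P W V) (s : Server P W) : Set (Tag P) :=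
  {t | ∃ r ∈ s.store, (r.tag : Tag P) = t} ∪ {t | ∃ k ∈ p.servers, t ∈ (s.rx k).tags} ∪ s.tx.tags

/-- The tags in a request (if any) and a reply (if any). -/
def payloadTags (q : Option (Req P W)) (a : Option (Ack P W)) : Set (Tag P) :=
  {t | ∃ r, q = some r ∧ t ∈ r.tags} ∪ {t | ∃ b, a = some b ∧ b.tag = t}

/-- The tags in transit on a gossip link. -/
def GossipLink.tags : GossipLink P → Set (Tag P)
  | .atSender => ∅
  | .inTransit m => {t | ∃ m', m = some m' ∧ t ∈ m'.tags}

/-- The tags in transit on a ping-pong link. -/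
def PingLink.tags : PingLink P W → Set (Tag P)
  | .atClient => ∅
  | .request q => payloadTags q none
  | .atServer q a => payloadTags q a
  | .response q a => payloadTags q a

/-- All tags in a system state: in servers, clients and messages. -/
def State.tags (p : Setup P W V) (c : State P W V) : Set (Tag P) :=
  {t | (∃ i ∈ p.servers, t ∈ (c.srv i).tags p) ∨ (∃ i ∈ p.clients, t ∈ (c.cli i).tags p) ∨
    (∃ i ∈ p.servers, ∃ j ∈ p.servers, i ≠ j ∧ t ∈ (c.gossip i j).tags) ∨
    ∃ i ∈ p.clients, ∃ j ∈ p.servers, t ∈ (c.ping i j).tags}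

/-- Every tag in the system state is smaller than `t_top`. -/
def State.OverflowFree (p : Setup P W V) (c : State P W V) : Prop :=
  ∀ t ∈ c.tags p, t < (p.tTop : Tag P)

/-- The requirements on the global reset service, with the bound `Ψ` on its duration. -/
structure Execution.ResetLegal (R : Execution p) (Ψ : ℕ) : Prop where
  /-- Whatever reset activity there is in the starting state, it is over within `Ψ` cycles: as long
  as no node has called `globalReset`, all states from then on are reset-free. -/
  spontaneous : ∃ y, R.Within 0 Ψ y ∧ ∀ z, y ≤ z →
    (∀ n < z, ∀ i t, ¬ R.CallsReset n i t) → (R.state z).ResetFree p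
  /-- Within `Ψ` cycles from the first call to `globalReset`, every node was disabled and has executed
  `localReset(t)` for the argument `t` of a call, the channels are clean, and then all
  machines are enabled and the reset is over. -/
  explicit : ∀ x, (∃ i t, R.CallsReset x i t) → (∀ n < x, ∀ i t, ¬ R.CallsReset n i t) →
    ∃ u, x < u ∧ R.Within x Ψ (u + 1) ∧
      (∀ i, ∃ v t, x < v ∧ v < u ∧ R.event v = .localReset i t ∧
        (∃ n j, n < v ∧ R.CallsReset n j t) ∧
        ∀ w, v < w → w ≤ u → (R.state w).Disabled i) ∧
      (R.state u).Cleaned ∧ (R.state (u + 1)).ResetFree p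

end Program

end BoundedCAS

namespace BoundedCAS

/-! Once the spontaneous reset activity is over, either some node calls `globalReset` within a
constant number of cycles, or none does. A call is harmless: the service resets every node while it
is disabled, so stored tags become `(1, k)` with `1 < MAXINT`, every other tag is `t₀` or absent,
and the links are clean. It remains to treat a long segment without a call (`Calm`), in which all
machines stay enabled, and to show that large tags disappear from it (`Calm.exists_overflowFree`).

In a calm segment the largest tag stored by a server never decreases. If all servers are below
`t_top` for several cycles, every other tag is flushed: gossip is dominated by the stores, replies
by the store of the replying server, and a tag in a client procedure would soon reach some store
(`Calm.overflowFree`). Otherwise some server reaches `t_top`, and gossip spreads this to all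
servers. Writers then cannot leave their queries (`Quiet`), for one of two reasons. If all maxima
stay equal to `t_top`, a writer that moved on would choose a tag above `t_top` and deliver it to a
server, which is absurd (`Calm.quiet_of_eq`). If some maximum exceeds `t_top`, this spreads too, and
the servers stop answering writers (`Calm.quiet_of_lt`).

Without new writes, old writers finish, no source of new tags remains, and all servers come to share
one maximal tag `M` (`Calm.stable`). The largest finalized tag is more delicate: the 'pre' update at
`M` may replace a finalized record of `M` that has no coded element. The quantity `maxFins`
therefore counts the gossip entries and the stored finalized tags other than `M`. It is monotone,
bounded by `M`, and in a single step can only stay or jump to `M` (`Stable.maxFins_step`). It thus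
changes at most once, and one of two consecutive windows sees it constant. In that window all
servers agree on the finalized tag, the quorum rule turns it into the FINALIZED tag, the gossip
arrays become constant, and the condition for calling `globalReset` holds, a contradiction
(`Stable.call_of_const`).

Time is measured by link cycles, which ignore client rounds. Fairness provides infinitely many of
them, even if a writer waits forever for an answer, and every asynchronous cycle contains one. -/

set_option linter.unusedSectionVars false

/-! ### Storage -/

section StorageLemmas

variable {P W V : Type*} [Fintype P] [LinearOrder P] [Nonempty P] [DecidableEq W]

/-- `S` has a record with the tag `t` and a phase in `D`. -/
def HasTag (S : Finset (Record P W)) (D : Finset Phase) (t : Tag P) : Prop :=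
  ∃ r ∈ S, r.phase ∈ D ∧ (r.tag : Tag P) = t

@[simp] theorem mem_allPhases (d : Phase) : d ∈ allPhases := by
  cases d <;> decide

theorem maxPhase_le_iff {S : Finset (Record P W)} {D : Finset Phase} {b : Tag P} :
    maxPhase S D ≤ b ↔ ∀ t, HasTag S D t → t ≤ b := by
  unfold maxPhase HasTag
  rw [Finset.sup_le_iff]
  constructor
  · rintro h t ⟨r, hr, hd, rfl⟩
    simpa [hd] using h r hr
  · intro h r hr
    split_ifs with hd
    · exact h _ ⟨r, hr, hd, rfl⟩
    · exact bot_le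

theorem HasTag.le_maxPhase {S : Finset (Record P W)} {D : Finset Phase} {t : Tag P}
    (h : HasTag S D t) : t ≤ maxPhase S D :=
  maxPhase_le_iff.1 le_rfl t h

theorem maxPhase_attained (S : Finset (Record P W)) (D : Finset Phase) :
    maxPhase S D = ⊥ ∨ HasTag S D (maxPhase S D) := by
  by_contra! h
  obtain ⟨h1, h2⟩ := h
  obtain ⟨r, hr, he⟩ : ∃ r ∈ S, (if r.phase ∈ D then (r.tag : Tag P) else ⊥) = maxPhase S D := by
    have hS : S.Nonempty := by
      rw [Finset.nonempty_iff_ne_empty]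
      rintro rfl
      exact h1 (by simp [maxPhase])
    obtain ⟨r, hr, he⟩ := Finset.exists_mem_eq_sup S hS
      (fun r => if r.phase ∈ D then (r.tag : Tag P) else ⊥)
    exact ⟨r, hr, he.symm⟩
  split_ifs at he with hd
  · exact h2 ⟨r, hr, hd, he⟩
  · exact h1 he.symm

theorem HasTag.mono {S : Finset (Record P W)} {D D' : Finset Phase} {t : Tag P}
    (h : HasTag S D t) (hD : D ⊆ D') : HasTag S D' t := by
  obtain ⟨r, hr, hd, e⟩ := h
  exact ⟨r, hr, hD hd, e⟩

theorem maxPhase_mono {S : Finset (Record P W)} {D D' : Finset Phase} (hD : D ⊆ D') :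
    maxPhase S D ≤ maxPhase S D' :=
  maxPhase_le_iff.2 fun _ h => (h.mono hD).le_maxPhase

theorem finPhases_subset : finPhases ⊆ allPhases := by decide

theorem FIN_subset : ({Phase.FIN} : Finset Phase) ⊆ finPhases := by decide

theorem upgradePhase_mem_finPhases {d u : Phase} (h : d ∈ finPhases) :
    upgradePhase d u ∈ finPhases := by
  cases d <;> cases u <;> revert h <;> decide

theorem upgradePhase_pre (d : Phase) : upgradePhase d Phase.pre = d := by
  cases d <;> rfl

theorem upgradePhase_fin (d : Phase) : upgradePhase d Phase.fin ∈ finPhases := by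
  cases d <;> decide

theorem hasTag_all_updatePhase (S : Finset (Record P W)) (t : Stamp P) (w : Option W) (u : Phase)
    (s : Tag P) :
    HasTag (updatePhase S (t : Tag P) w u) allPhases s ↔ HasTag S allPhases s ∨ s = t := by
  -- For a tag of `𝒯` the match on `t₀` reduces definitionally, which leaves the two storing
  -- branches.
  have key : updatePhase S (t : Tag P) w u =
    if w = none ∧ ∃ r ∈ S, r.tag = t ∧ r.word ≠ none then
      S.image fun r =>
        if r.tag = t ∧ r.word ≠ none then { r with phase := upgradePhase r.phase u } else r
    else insert ⟨t, w, u⟩ (S.filter fun r => r.tag ≠ t) := rfl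
  rw [key]
  unfold HasTag
  split_ifs with h
  · obtain ⟨-, r₀, h₀, h₁, -⟩ := h
    constructor
    · rintro ⟨r, hr, -, rfl⟩
      obtain ⟨r', hr', rfl⟩ := Finset.mem_image.1 hr
      exact Or.inl ⟨r', hr', by simp, by split_ifs <;> rfl⟩
    · rintro (⟨r, hr, -, rfl⟩ | rfl)
      · exact ⟨_, Finset.mem_image_of_mem _ hr, by simp, by split_ifs <;> rfl⟩
      · exact ⟨_, Finset.mem_image_of_mem _ h₀, by simp, by split_ifs <;> simp [h₁]⟩
  · constructor
    · rintro ⟨r, hr, -, rfl⟩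
      rcases Finset.mem_insert.1 hr with rfl | hr
      · exact Or.inr rfl
      · exact Or.inl ⟨r, (Finset.mem_filter.1 hr).1, by simp, rfl⟩
    · rintro (⟨r, hr, -, rfl⟩ | rfl)
      · by_cases ht : r.tag = t
        · exact ⟨_, Finset.mem_insert_self _ _, by simp, by simp [ht]⟩
        · exact ⟨r, Finset.mem_insert_of_mem (Finset.mem_filter.2 ⟨hr, ht⟩), by simp, rfl⟩
      · exact ⟨_, Finset.mem_insert_self _ _, by simp, rfl⟩

/-- Both branches of an update keep some record of every old tag, whatever happens to its phase or
coded element. Nothing as simple is true of `finPhases`, because a replacement may lower the phase.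
-/
theorem maxPhase_all_updatePhase (S : Finset (Record P W)) (t : Tag P) (w : Option W)
    (u : Phase) : maxPhase (updatePhase S t w u) allPhases = maxPhase S allPhases ⊔ t := by
  induction t using WithBot.recBotCoe with
  | bot => simp [updatePhase]
  | coe t =>
    apply eq_of_forall_ge_iff
    intro b
    rw [sup_le_iff, maxPhase_le_iff, maxPhase_le_iff]
    simp only [hasTag_all_updatePhase]
    constructor
    · exact fun h => ⟨fun s hs => h s (Or.inl hs), h _ (Or.inr rfl)⟩
    · rintro ⟨h1, h2⟩ s (hs | rfl)
      exacts [h1 s hs, h2]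

/-- An update without a coded element changes the finalized tags only at its own tag. -/
theorem HasTag.of_updatePhase {S : Finset (Record P W)} {t : Tag P} {u : Phase} {s : Tag P}
    (h : HasTag (updatePhase S t none u) finPhases s) :
    HasTag S finPhases s ∨ (s = t ∧ u ≠ Phase.pre) := by
  induction t using WithBot.recBotCoe with
  | bot => exact Or.inl h
  | coe t =>
    have key : updatePhase S (t : Tag P) none u =
      if (none : Option W) = none ∧ ∃ r ∈ S, r.tag = t ∧ r.word ≠ none then
        S.image fun r =>
          if r.tag = t ∧ r.word ≠ none then { r with phase := upgradePhase r.phase u } else r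
      else insert ⟨t, none, u⟩ (S.filter fun r => r.tag ≠ t) := rfl
    rw [key] at h
    obtain ⟨r, hr, hd, rfl⟩ := h
    split_ifs at hr with hc
    · obtain ⟨r', hr', rfl⟩ := Finset.mem_image.1 hr
      split_ifs at hd ⊢ with hc'
      · by_cases hu : u = Phase.pre
        · subst hu
          exact Or.inl ⟨r', hr', by simpa [upgradePhase_pre] using hd, rfl⟩
        · exact Or.inr ⟨by simp [hc'.1], hu⟩
      · exact Or.inl ⟨r', hr', hd, rfl⟩
    · rcases Finset.mem_insert.1 hr with rfl | hr
      · refine Or.inr ⟨rfl, ?_⟩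
        rintro rfl
        exact absurd hd (by simp [finPhases])
      · exact Or.inl ⟨r, (Finset.mem_filter.1 hr).1, hd, rfl⟩

/-- The excluded case is a real loss: if no coded element is stored for `t`, a 'pre' update replaces
the finalized records of `t` by a 'pre' record. This is why `maxFinNe` leaves out one tag. -/
theorem HasTag.updatePhase {S : Finset (Record P W)} {t : Tag P} {u : Phase} {s : Tag P}
    (h : HasTag S finPhases s) (hs : s ≠ t ∨ u ≠ Phase.pre) :
    HasTag (updatePhase S t none u) finPhases s := by
  induction t using WithBot.recBotCoe with
  | bot => exact h
  | coe t =>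
    have key : BoundedCAS.updatePhase S (t : Tag P) none u =
      if (none : Option W) = none ∧ ∃ r ∈ S, r.tag = t ∧ r.word ≠ none then
        S.image fun r =>
          if r.tag = t ∧ r.word ≠ none then { r with phase := upgradePhase r.phase u } else r
      else insert ⟨t, none, u⟩ (S.filter fun r => r.tag ≠ t) := rfl
    rw [key]
    obtain ⟨r, hr, hd, rfl⟩ := h
    split_ifs with hc
    · refine ⟨_, Finset.mem_image_of_mem _ hr, ?_, ?_⟩
      · split_ifs
        · exact upgradePhase_mem_finPhases hd
        · exact hd
      · split_ifs <;> rfl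
    · by_cases ht : r.tag = t
      · refine ⟨_, Finset.mem_insert_self _ _, ?_, by simp [ht]⟩
        have hu : u ≠ Phase.pre := by
          rcases hs with hs | hs
          · exact absurd (by simp [ht]) hs
          · exact hs
        revert hu; cases u <;> simp [finPhases]
      · exact ⟨r, Finset.mem_insert_of_mem (Finset.mem_filter.2 ⟨hr, ht⟩), hd, rfl⟩

/-- `upgradePhase` climbs one level at a time, so a FIN update would leave a 'pre' record with a
coded element unchanged. After the 'fin' update at the same tag it does succeed. -/
theorem hasTag_updatePhase_fin (S : Finset (Record P W)) (t : Stamp P) :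
    HasTag (updatePhase S (t : Tag P) none Phase.fin) finPhases t ∧
    HasTag (updatePhase (updatePhase S (t : Tag P) none Phase.fin) (t : Tag P) none Phase.FIN)
      {Phase.FIN} t := by
  have key : ∀ (S : Finset (Record P W)) u, updatePhase S (t : Tag P) none u =
    if (none : Option W) = none ∧ ∃ r ∈ S, r.tag = t ∧ r.word ≠ none then
      S.image fun r =>
        if r.tag = t ∧ r.word ≠ none then { r with phase := upgradePhase r.phase u } else r
    else insert ⟨t, none, u⟩ (S.filter fun r => r.tag ≠ t) := fun _ _ => rfl
  by_cases hc : ∃ r ∈ S, r.tag = t ∧ r.word ≠ none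
  · obtain ⟨r, hr, ht, hw⟩ := hc
    have h1 : ({ r with phase := upgradePhase r.phase Phase.fin } : Record P W) ∈
        updatePhase S (t : Tag P) none Phase.fin := by
      rw [key, if_pos ⟨rfl, r, hr, ht, hw⟩]
      exact Finset.mem_image.2 ⟨r, hr, by rw [if_pos ⟨ht, hw⟩]⟩
    refine ⟨⟨_, h1, upgradePhase_fin _, by simp [ht]⟩, ?_⟩
    rw [key _ Phase.FIN, if_pos ⟨rfl, _, h1, ht, hw⟩]
    refine ⟨_, Finset.mem_image_of_mem _ h1, ?_, ?_⟩
    · rw [if_pos ⟨ht, hw⟩]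
      rcases r with ⟨a, b, d⟩
      cases d <;> simp [upgradePhase]
    · rw [if_pos ⟨ht, hw⟩]
      simp [ht]
  · have e : updatePhase S (t : Tag P) none Phase.fin =
        insert ⟨t, none, Phase.fin⟩ (S.filter fun r => r.tag ≠ t) := by
      rw [key, if_neg (fun h => hc h.2)]
    refine ⟨⟨⟨t, none, Phase.fin⟩, by rw [e]; exact Finset.mem_insert_self _ _, by simp [finPhases], rfl⟩, ?_⟩
    rw [key _ Phase.FIN, if_neg]
    · exact ⟨_, Finset.mem_insert_self _ _, by simp, rfl⟩
    · rintro ⟨-, r, hr, ht, hw⟩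
      rw [e] at hr
      rcases Finset.mem_insert.1 hr with rfl | hr
      · exact hw rfl
      · exact (Finset.mem_filter.1 hr).2 ht

theorem HasTag.of_relevant {δ : ℕ} {S : Finset (Record P W)} {D : Finset Phase} {t : Tag P}
    (h : HasTag (relevant δ S) D t) : HasTag S D t := by
  obtain ⟨r, hr, hd, e⟩ := h
  exact ⟨r, (Finset.mem_filter.1 hr).1, hd, e⟩

theorem HasTag.relevant {δ : ℕ} {S : Finset (Record P W)} {D : Finset Phase} {t : Tag P}
    (h : HasTag S D t) (ht : t = maxPhase S allPhases ∨ t = maxPhase S finPhases) :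
    HasTag (relevant δ S) D t := by
  obtain ⟨r, hr, hd, rfl⟩ := h
  exact ⟨r, Finset.mem_filter.2 ⟨hr, ht.elim Or.inl (fun h => Or.inr (Or.inl h))⟩, hd, rfl⟩

/-- Garbage collection keeps all records of the two distinguished maximal tags. Other tags may be
dropped, so the FIN maximum is only controlled when it coincides with one of these two. -/
theorem maxPhase_relevant {δ : ℕ} {S : Finset (Record P W)} {D : Finset Phase}
    (hD : maxPhase S D = maxPhase S allPhases ∨ maxPhase S D = maxPhase S finPhases) :
    maxPhase (relevant δ S) D = maxPhase S D := by
  apply le_antisymm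
  · exact maxPhase_le_iff.2 fun t ht => ht.of_relevant.le_maxPhase
  · rcases maxPhase_attained S D with h | h
    · rw [h]; exact bot_le
    · exact (h.relevant hD).le_maxPhase

/-- The largest finalized tag other than `M`. -/
def maxFinNe (S : Finset (Record P W)) (M : Tag P) : Tag P :=
  S.sup fun r => if r.phase ∈ finPhases ∧ (r.tag : Tag P) ≠ M then (r.tag : Tag P) else ⊥

theorem maxFinNe_le_iff {S : Finset (Record P W)} {M b : Tag P} :
    maxFinNe S M ≤ b ↔ ∀ t, HasTag S finPhases t → t ≠ M → t ≤ b := by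
  unfold maxFinNe HasTag
  rw [Finset.sup_le_iff]
  constructor
  · rintro h t ⟨r, hr, hd, rfl⟩ hne
    simpa [hd, hne] using h r hr
  · intro h r hr
    split_ifs with hd
    · exact h _ ⟨r, hr, hd.1, rfl⟩ hd.2
    · exact bot_le

theorem maxPhase_finPhases_le_or (S : Finset (Record P W)) (M : Tag P) :
    maxPhase S finPhases ≤ maxFinNe S M ∨ maxPhase S finPhases = M := by
  rcases maxPhase_attained S finPhases with h | h
  · rw [h]; exact Or.inl bot_le
  · by_cases e : maxPhase S finPhases = M
    · exact Or.inr e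
    · exact Or.inl (maxFinNe_le_iff.1 le_rfl _ h e)

/-! ### Arrival of gossip -/

/-- All servers form a quorum. -/
theorem Setup.isQuorum_servers (p : Setup P W V) : p.IsQuorum p.servers := by
  refine ⟨subset_rfl, ?_⟩
  have := p.k_le
  omega

theorem Setup.IsQuorum.nonempty {p : Setup P W V} {Q : Finset P} (h : p.IsQuorum Q) :
    Q.Nonempty := by
  rw [← Finset.card_pos]
  have := h.2
  have := p.k_lt
  omega

theorem Setup.exists_ne (p : Setup P W V) (i : P) : ∃ j ∈ p.servers, j ≠ i := by
  have h : 1 < p.servers.card := lt_of_le_of_lt p.k_pos p.k_lt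
  obtain ⟨j, hj, hne⟩ := Finset.exists_mem_ne h i
  exact ⟨j, hj, hne⟩

theorem Setup.servers_nonempty (p : Setup P W V) : p.servers.Nonempty :=
  p.isQuorum_servers.nonempty

/-- What a server does on arrival of gossip. -/
structure GossipEffect (p : Setup P W V) (i : P) (s : Server P W) (j : P) (m : Triple P)
    (s' : Server P W) (c : Option (Tag P)) : Prop where
  rx_ne : ∀ k, k ≠ i → s'.rx k = Function.update s.rx j m k
  le_pre : ∀ k ∈ p.servers, (Function.update s.rx j m k).pre ≤ (s'.rx i).pre ∧
    (Function.update s.rx j m k).fin ≤ (s'.rx i).pre ∧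
    (Function.update s.rx j m k).FIN ≤ (s'.rx i).pre
  top_le_pre : maxPhase s.store allPhases ≤ (s'.rx i).pre
  pre_le : ∀ b, (∀ k ∈ p.servers, (Function.update s.rx j m k).pre ≤ b ∧
    (Function.update s.rx j m k).fin ≤ b ∧ (Function.update s.rx j m k).FIN ≤ b) →
    maxPhase s.store allPhases ≤ b → (s'.rx i).pre ≤ b
  le_fin : ∀ k ∈ p.servers, (Function.update s.rx j m k).fin ≤ (s'.rx i).fin ∧
    (Function.update s.rx j m k).FIN ≤ (s'.rx i).fin
  tag_le_fin : ∀ t, HasTag s.store finPhases t → t ≠ (s'.rx i).pre → t ≤ (s'.rx i).fin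
  fin_le : ∀ b M, (∀ k ∈ p.servers, (Function.update s.rx j m k).fin ≤ b ∧
    (Function.update s.rx j m k).FIN ≤ b) → maxFinNe s.store M ≤ b →
    (s'.rx i).fin ≤ b ∨ (s'.rx i).fin = M
  fin_le_pre : (s'.rx i).fin ≤ (s'.rx i).pre
  FIN_le_fin : (s'.rx i).FIN ≤ (s'.rx i).fin
  top_eq : maxPhase s'.store allPhases = (s'.rx i).pre
  fin_eq : maxPhase s'.store finPhases = (s'.rx i).fin
  tx_eq : s'.tx = tagTuple s'.store
  FIN_eq : (∀ k ∈ p.servers, k ≠ i → (Function.update s.rx j m k).fin = (s'.rx i).fin) →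
    (s'.rx i).FIN = (s'.rx i).fin
  tx_FIN : (s'.rx i).FIN = (s'.rx i).fin → s'.tx.FIN = (s'.rx i).fin
  call : (p.tTop : Tag P) ≤ (s'.rx i).pre → (∀ k ∈ p.servers, s'.rx k = s'.rx i) →
    (s'.rx i).FIN = (s'.rx i).fin → c ≠ none

/-- The intermediate values become variables with defining equations. The two branches are merged:
the final store is `S₃` or its relevant part, and a call is certain when the test succeeds. -/
theorem onGossip_spec (p : Setup P W V) (i : P) (s : Server P W) (j : P) (m : Triple P) :
    ∃ (rx : P → Triple P) (pre fin FIN : Tag P) (S₁ S₂ S₃ : Finset (Record P W)),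
      rx = Function.update s.rx j m ∧
      pre = p.servers.sup (fun k => (rx k).pre ⊔ (rx k).fin ⊔ (rx k).FIN) ⊔
        maxPhase s.store allPhases ∧
      S₁ = updatePhase s.store pre none Phase.pre ∧
      fin = p.servers.sup (fun k => (rx k).fin ⊔ (rx k).FIN) ⊔ maxPhase S₁ finPhases ∧
      S₂ = updatePhase S₁ fin none Phase.fin ∧
      FIN = p.servers.sup (fun k => (rx k).FIN) ⊔ maxPhase S₂ {Phase.FIN} ⊔
        p.servers.sup (fun k =>
          if p.IsQuorum (p.servers.filter fun l =>
            (if l = i then fin else (rx l).fin) = (if k = i then fin else (rx k).fin)) then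
          (if k = i then fin else (rx k).fin) else ⊥) ∧
      S₃ = updatePhase S₂ FIN none Phase.FIN ∧
      (onGossip p i s j m).1.rx = Function.update rx i ⟨pre, fin, FIN⟩ ∧
      (onGossip p i s j m).1.tx = tagTuple (onGossip p i s j m).1.store ∧
      ((onGossip p i s j m).1.store = S₃ ∨ (onGossip p i s j m).1.store = relevant p.δ S₃) ∧
      ((p.tTop : Tag P) ≤ maxPhase S₃ allPhases →
        (∀ k ∈ p.servers, Function.update rx i ⟨pre, fin, FIN⟩ k = tagTuple S₃) →
        (tagTuple S₃).fin = (tagTuple S₃).FIN → (tagTuple S₃).fin ≤ (tagTuple S₃).pre →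
        (onGossip p i s j m).2 ≠ none) := by
  refine ⟨_, _, _, _, _, _, _, rfl, rfl, rfl, rfl, rfl, rfl, rfl, ?_⟩
  unfold onGossip
  dsimp only
  split_ifs with h
  · exact ⟨rfl, rfl, Or.inl rfl, fun _ _ _ _ => by simp⟩
  · exact ⟨rfl, rfl, Or.inr rfl, fun h1 h2 h3 h4 => absurd ⟨h1, h2, h3, h4⟩ h⟩

/-- Each of `pre` and `fin` is at least the corresponding stored maximum when its update is
executed, and the later updates use tags that are no larger. Both entries thus end as the exact
stored maxima. For FIN this is shown only if `FIN = fin`, which is the case that matters for a call.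
-/
theorem gossipEffect_onGossip (p : Setup P W V) {i : P} (s : Server P W) (j : P) (m : Triple P) :
    GossipEffect p i s j m (onGossip p i s j m).1 (onGossip p i s j m).2 := by
  obtain ⟨rx, pre, fin, FIN, S₁, S₂, S₃, hrx, hpre, h₁, hfin, h₂, hFIN, h₃, hrx', htx, hst, hc⟩ :=
    onGossip_spec p i s j m
  generalize (onGossip p i s j m).1 = s' at *
  generalize (onGossip p i s j m).2 = c at *
  have hi : s'.rx i = ⟨pre, fin, FIN⟩ := by rw [hrx']; simp
  have hle : ∀ k ∈ p.servers, (rx k).pre ⊔ (rx k).fin ⊔ (rx k).FIN ≤ pre := fun k hk => by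
    rw [hpre]
    exact le_sup_of_le_left
      (Finset.le_sup (f := fun k => (rx k).pre ⊔ (rx k).fin ⊔ (rx k).FIN) hk)
  have hlef : ∀ k ∈ p.servers, (rx k).fin ⊔ (rx k).FIN ≤ fin := fun k hk => by
    rw [hfin]
    exact le_sup_of_le_left (Finset.le_sup (f := fun k => (rx k).fin ⊔ (rx k).FIN) hk)
  have htop : maxPhase s.store allPhases ≤ pre := by rw [hpre]; exact le_sup_right
  have t₁ : maxPhase S₁ allPhases = pre := by
    rw [h₁, maxPhase_all_updatePhase, sup_eq_right.2 htop]
  have f₁ : maxPhase S₁ finPhases ≤ fin := by rw [hfin]; exact le_sup_right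
  have hfp : fin ≤ pre := by
    rw [hfin]
    refine sup_le (Finset.sup_le fun k hk => ?_) ((maxPhase_mono finPhases_subset).trans t₁.le)
    have := hle k hk
    simp only [sup_le_iff] at this ⊢
    exact ⟨this.1.2, this.2⟩
  have t₂ : maxPhase S₂ allPhases = pre := by
    rw [h₂, maxPhase_all_updatePhase, t₁, sup_eq_left.2 hfp]
  have f₂ : maxPhase S₂ finPhases = fin := by
    apply le_antisymm
    · refine maxPhase_le_iff.2 fun t ht => ?_
      rw [h₂] at ht
      rcases ht.of_updatePhase with h | h
      · exact h.le_maxPhase.trans f₁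
      · exact h.1.le
    · induction fin using WithBot.recBotCoe with
      | bot => exact bot_le
      | coe t => rw [h₂]; exact (hasTag_updatePhase_fin S₁ t).1.le_maxPhase
  have hFf : FIN ≤ fin := by
    rw [hFIN]
    refine sup_le (sup_le (Finset.sup_le fun k hk => ?_)
      ((maxPhase_mono FIN_subset).trans f₂.le)) (Finset.sup_le fun k hk => ?_)
    · exact le_sup_right.trans (hlef k hk)
    · split_ifs
      exacts [le_rfl, bot_le, (le_sup_left : (rx k).fin ≤ _).trans (hlef k hk), bot_le]
  have t₃ : maxPhase S₃ allPhases = pre := by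
    rw [h₃, maxPhase_all_updatePhase, t₂, sup_eq_left.2 (hFf.trans hfp)]
  have f₃ : maxPhase S₃ finPhases = fin := by
    apply le_antisymm
    · refine maxPhase_le_iff.2 fun t ht => ?_
      rw [h₃] at ht
      rcases ht.of_updatePhase with h | h
      · exact h.le_maxPhase.trans f₂.le
      · exact h.1.trans_le hFf
    · rcases maxPhase_attained S₂ finPhases with h | h
      · rw [← f₂, h]; exact bot_le
      · rw [← f₂, h₃]; exact (h.updatePhase (Or.inr (by simp))).le_maxPhase
  have hall : maxPhase s'.store allPhases = pre := by
    rcases hst with h | h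
    · rw [h, t₃]
    · rw [h, maxPhase_relevant (Or.inl rfl), t₃]
  have hfn : maxPhase s'.store finPhases = fin := by
    rcases hst with h | h
    · rw [h, f₃]
    · rw [h, maxPhase_relevant (Or.inr rfl), f₃]
  -- The last two updates then have the same tag, so the record is raised to 'fin' and next to
  -- 'FIN'.
  have hFF : FIN = fin → maxPhase S₃ {Phase.FIN} = fin := by
    intro h
    apply le_antisymm ((maxPhase_mono FIN_subset).trans f₃.le)
    rw [h₃, h₂, h]
    induction fin using WithBot.recBotCoe with
    | bot => exact bot_le
    | coe t => exact (hasTag_updatePhase_fin S₁ t).2.le_maxPhase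
  have hFF' : FIN = fin → maxPhase s'.store {Phase.FIN} = fin := by
    intro h
    rcases hst with h' | h'
    · rw [h', hFF h]
    · rw [h', maxPhase_relevant (Or.inr (by rw [hFF h, f₃])), hFF h]
  subst hrx
  refine ⟨?_, ?_, ?_, ?_, ?_, ?_, ?_, ?_, ?_, ?_, ?_, htx, ?_, ?_, ?_⟩ <;> (try simp only [hi])
  · intro k hk
    rw [hrx', Function.update_of_ne hk]
  · intro k hk
    have := hle k hk
    simp only [sup_le_iff] at this
    exact ⟨this.1.1, this.1.2, this.2⟩
  · exact htop
  · intro b hb hb'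
    rw [hpre]
    exact sup_le (Finset.sup_le fun k hk => sup_le (sup_le (hb k hk).1 (hb k hk).2.1) (hb k hk).2.2)
      hb'
  · intro k hk
    simpa only [sup_le_iff] using hlef k hk
  · intro t ht hne
    refine le_trans ?_ f₁
    rw [h₁]
    exact (ht.updatePhase (Or.inl hne)).le_maxPhase
  · intro b M hb hb'
    have ha : p.servers.sup (fun k => (Function.update s.rx j m k).fin ⊔
        (Function.update s.rx j m k).FIN) ≤ b :=
      Finset.sup_le fun k hk => sup_le (hb k hk).1 (hb k hk).2
    -- A 'pre' update without a coded element creates no finalized tag, so the maximum over `S₁` was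
    -- already finalized in the old store.
    have hcc : maxPhase S₁ finPhases ≤ b ∨ maxPhase S₁ finPhases = M := by
      rcases maxPhase_attained S₁ finPhases with h | h
      · rw [h]; exact Or.inl bot_le
      · by_cases e : maxPhase S₁ finPhases = M
        · exact Or.inr e
        · left
          rcases HasTag.of_updatePhase (h₁ ▸ h : HasTag (updatePhase s.store pre none Phase.pre)
            finPhases (maxPhase S₁ finPhases)) with h | h
          · exact maxFinNe_le_iff.1 hb' _ h e
          · exact absurd rfl h.2
    rw [hfin]
    rcases hcc with h | h
    · exact Or.inl (sup_le ha h)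
    · rcases le_total (maxPhase S₁ finPhases) (p.servers.sup (fun k =>
        (Function.update s.rx j m k).fin ⊔ (Function.update s.rx j m k).FIN)) with h' | h'
      · rw [sup_eq_left.2 h']; exact Or.inl ha
      · rw [sup_eq_right.2 h']; exact Or.inr h
  · exact hfp
  · exact hFf
  · exact hall
  · exact hfn
  · intro h
    apply le_antisymm hFf
    rw [hFIN]
    obtain ⟨k, hk⟩ := p.servers_nonempty
    -- All servers report the same finalized tag, and the set of all servers is a quorum; hence
    -- `fin` is among the tags over which `FIN` is the maximum.
    have h' : ∀ l ∈ p.servers, (if l = i then fin else (Function.update s.rx j m l).fin) = fin := by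
      intro l hl
      split_ifs with e
      · rfl
      · exact h l hl e
    refine le_sup_of_le_right (le_trans ?_ (Finset.le_sup hk))
    rw [h' k hk, if_pos]
    convert p.isQuorum_servers
    exact Finset.filter_true_of_mem h'
  · intro h
    rw [htx]
    exact hFF' h
  · intro h1 h2 h3
    have e : tagTuple S₃ = ⟨pre, fin, FIN⟩ := by
      rw [tagTuple, t₃, f₃, hFF h3, h3]
    rw [e] at hc
    refine hc (t₃ ▸ h1) (fun k hk => ?_) h3.symm hfp
    rw [← hrx']
    exact h2 k hk

end StorageLemmas

section StepLemmas

variable {P W V : Type*} [Fintype P] [LinearOrder P] [Nonempty P] [DecidableEq W]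

/-! ### Requests and replies -/

theorem maxPhase_le_storeAfter (S : Finset (Record P W)) (r : Req P W) :
    maxPhase S allPhases ≤ maxPhase (storeAfter S r) allPhases := by
  cases r with
  | query b => exact le_rfl
  | prewrite t w => exact le_sup_left.trans (maxPhase_all_updatePhase S _ _ _).ge
  | finalize b t l => exact le_sup_left.trans (maxPhase_all_updatePhase S _ _ _).ge

theorem Req.tags_le_storeAfter (S : Finset (Record P W)) {r : Req P W} {t : Tag P}
    (ht : t ∈ r.tags) : t ≤ maxPhase (storeAfter S r) allPhases := by
  cases r with
  | query b => exact ht.elim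
  | prewrite s w =>
    obtain rfl : t = s := ht
    exact le_sup_right.trans (maxPhase_all_updatePhase S _ _ _).ge
  | finalize b s l =>
    obtain rfl : t = s := ht
    exact le_sup_right.trans (maxPhase_all_updatePhase S _ _ _).ge

theorem storeAfter_le {S : Finset (Record P W)} {r : Req P W} {b : Tag P}
    (h : maxPhase S allPhases ≤ b) (hr : ∀ t ∈ r.tags, t ≤ b) :
    maxPhase (storeAfter S r) allPhases ≤ b := by
  cases r with
  | query b => exact h
  | prewrite s w => exact (maxPhase_all_updatePhase S _ _ _).trans_le (sup_le h (hr _ rfl))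
  | finalize b s l => exact (maxPhase_all_updatePhase S _ _ _).trans_le (sup_le h (hr _ rfl))

theorem Replies.tag_le {p : Setup P W V} {S : Finset (Record P W)} {r : Req P W} {a : Ack P W}
    (h : Replies p (storeAfter S r) r (some a)) :
    a.tag ≤ maxPhase (storeAfter S r) allPhases := by
  cases r with
  | query b =>
    simp only [Replies] at h
    split_ifs at h with h1 h2
    · rw [Option.some.inj h]; exact maxPhase_mono finPhases_subset
    · rw [Option.some.inj h]
  | prewrite s w =>
    simp only [Replies] at h
    rw [Option.some.inj h]
    exact Req.tags_le_storeAfter S rfl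
  | finalize b s l =>
    obtain ⟨w, hw, -⟩ := h
    rw [Option.some.inj hw]
    exact Req.tags_le_storeAfter S rfl

theorem Replies.reader_tag {p : Setup P W V} {S : Finset (Record P W)} {a : Ack P W}
    (h : Replies p S (.query true) (some a)) : a.tag = maxPhase S finPhases := by
  simp only [Replies, if_true] at h
  rw [Option.some.inj h]

theorem Replies.writer_tag {p : Setup P W V} {S : Finset (Record P W)} {a : Ack P W}
    (h : Replies p S (.query false) (some a)) :
    a.tag = maxPhase S allPhases ∧ maxPhase S allPhases ≤ (p.tTop : Tag P) := by
  simp only [Replies, Bool.false_eq_true, if_false] at h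
  split_ifs at h with h2
  exact ⟨by rw [Option.some.inj h], h2⟩

theorem Replies.ne_none {p : Setup P W V} {S : Finset (Record P W)} {r : Req P W}
    {a : Option (Ack P W)} (h : Replies p S r a)
    (hr : r = .query false → maxPhase S allPhases ≤ (p.tTop : Tag P)) : a ≠ none := by
  cases r with
  | query b =>
    simp only [Replies] at h
    split_ifs at h with h1 h2
    · simp [h]
    · simp [h]
    · exact absurd (hr (by simpa using h1)) h2
  | prewrite s w =>
    simp only [Replies] at h
    simp [h]
  | finalize b s l =>
    obtain ⟨w, hw, -⟩ := h
    simp [hw]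

theorem exists_replies (p : Setup P W V) (S : Finset (Record P W)) (r : Req P W) :
    ∃ a, Replies p S r a := by
  cases r with
  | query b =>
    simp only [Replies]
    split_ifs
    exacts [⟨_, rfl⟩, ⟨_, rfl⟩, ⟨_, rfl⟩]
  | prewrite s w => exact ⟨_, rfl⟩
  | finalize b s l =>
    by_cases h : b = true ∧ ∃ r ∈ S, (r.tag : Tag P) = s ∧
        r.phase = (if l then Phase.FIN else Phase.fin)
    · obtain ⟨-, r, hr, h1, h2⟩ := id h
      refine ⟨_, r.word, rfl, ?_⟩
      rw [if_pos h]
      exact ⟨r, hr, h1, h2, rfl⟩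
    · refine ⟨_, none, rfl, ?_⟩
      rw [if_neg h]

theorem Proc.tags_req (p : Setup P W V) (j : P) (pr : Proc P V) : (pr.req p j).tags = pr.tags := by
  cases pr <;> rfl

/-! ### The effect of a step on the components of a reset-free state -/

theorem set₂_apply {α : Type*} (g : P → P → α) (i j : P) (x : α) (a b : P) :
    set₂ g i j x a b = if a = i ∧ b = j then x else g a b := by
  unfold set₂
  by_cases h : a = i
  · subst h
    by_cases h' : b = j <;> simp [h', Function.update]
  · simp [h, Function.update]

variable {p : Setup P W V} {c c' : State P W V} {ev : Event P V}

/-- Every node hosts a server or a client. This excludes the steps that leave a node wholly disabled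
or require it to be so. -/
theorem State.ResetFree.on (h : c.ResetFree p) (i : P) : c.srvOn i = true ∨ c.cliOn i = true := by
  have := p.hosts ▸ Finset.mem_univ i
  rcases Finset.mem_union.1 this with h' | h'
  · exact Or.inl (h.1 i h')
  · exact Or.inr (h.2.1 i h')

theorem Step.not_reset (hs : Step p c ev c') (hc : c.ResetFree p) (hc' : c'.ResetFree p) :
    (∀ i, ev ≠ .disable i) ∧ (∀ i t, ev ≠ .localReset i t) ∧ ∀ i, ev ≠ .clean i := by
  refine ⟨?_, ?_, ?_⟩
  · rintro i rfl
    simp only [Step] at hs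
    have := hc'.on i
    rw [hs] at this
    simp at this
  · rintro i t rfl
    have := hc.on i
    simp [hs.1, hs.2.1] at this
  · rintro i rfl
    have := hc.on i
    simp [hs.1, hs.2.1] at this

/-- The steps of a server, when the machines are enabled. -/
theorem Step.srv (hs : Step p c ev c') (hc : c.ResetFree p) (hc' : c'.ResetFree p) {j : P}
    (hj : j ∈ p.servers) :
    c'.srv j = c.srv j ∨
    (∃ i m, ev = .gossipReceive i j ∧ i ∈ p.servers ∧ i ≠ j ∧ c.gossip i j = .inTransit (some m) ∧
      c'.srv j = (onGossip p j (c.srv j) i m).1) ∨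
    ∃ i r, i ∈ p.clients ∧ c.ping i j = .request (some r) ∧
      c'.srv j = { c.srv j with store := storeAfter (c.srv j).store r } := by
  obtain ⟨n1, n2, n3⟩ := hs.not_reset hc hc'
  cases ev with
  | gossipSend a b => obtain ⟨-, -, -, -, rfl⟩ := hs; exact Or.inl rfl
  | gossipReceive a b =>
    obtain ⟨ha, hb, hab, m, hm, rfl⟩ := hs
    by_cases e : j = b
    · subst e
      rcases m with _ | m
      · exact Or.inl rfl
      · exact Or.inr (Or.inl ⟨a, m, rfl, ha, hab, hm, by simp [hc.1 j hj]⟩)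
    · left
      rcases m with _ | m
      · rfl
      · simp [hc.1 b hb, Function.update_of_ne e]
  | pingSend a b => obtain ⟨-, -, -, rfl⟩ := hs; exact Or.inl rfl
  | pingReceive a b =>
    obtain ⟨ha, hb, q, hq, hs⟩ := hs
    split at hs
    · obtain ⟨x, x', -, -, rfl⟩ := hs
      by_cases e : j = b
      · subst e
        exact Or.inr (Or.inr ⟨a, _, ha, hq, by simp⟩)
      · left
        dsimp only
        rw [Function.update_of_ne e]
    · subst hs; exact Or.inl rfl
  | pongSend a b => obtain ⟨-, -, q, x, -, rfl⟩ := hs; exact Or.inl rfl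
  | pongReceive a b => obtain ⟨-, -, q, x, -, rfl⟩ := hs; exact Or.inl rfl
  | startWrite a s => obtain ⟨-, -, -, rfl⟩ := hs; exact Or.inl rfl
  | startRead a => obtain ⟨-, -, -, rfl⟩ := hs; exact Or.inl rfl
  | resetSend a b => simp only [Step] at hs; subst hs; exact Or.inl rfl
  | resetReceive a b => simp only [Step] at hs; subst hs; exact Or.inl rfl
  | disable a => exact absurd rfl (n1 a)
  | localReset a t => exact absurd rfl (n2 a t)
  | clean a => exact absurd rfl (n3 a)
  | enable A => simp only [Step] at hs; subst hs; exact Or.inl rfl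

/-- The steps of a gossip link, when the machines are enabled. -/
theorem Step.gossip (hs : Step p c ev c') (hc : c.ResetFree p) (hc' : c'.ResetFree p) {i j : P} :
    (c'.gossip i j = c.gossip i j ∧ ev ≠ .gossipSend i j ∧ ev ≠ .gossipReceive i j) ∨
    (ev = .gossipSend i j ∧ c.gossip i j = .atSender ∧
      c'.gossip i j = .inTransit (some (c.srv i).tx)) ∨
    (ev = .gossipReceive i j ∧ (∃ m, c.gossip i j = .inTransit m) ∧ c'.gossip i j = .atSender) := by
  obtain ⟨n1, n2, n3⟩ := hs.not_reset hc hc'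
  cases ev with
  | gossipSend a b =>
    obtain ⟨ha, hb, -, h, rfl⟩ := hs
    by_cases e : i = a ∧ j = b
    · obtain ⟨rfl, rfl⟩ := e
      refine Or.inr (Or.inl ⟨rfl, h, ?_⟩)
      dsimp only
      rw [set₂_apply, if_pos ⟨rfl, rfl⟩, if_pos (hc.1 i ha)]
    · refine Or.inl ⟨?_, fun h => e ?_, by simp⟩
      · dsimp only
        rw [set₂_apply, if_neg e]
      · cases h; exact ⟨rfl, rfl⟩
  | gossipReceive a b =>
    obtain ⟨ha, hb, -, m, h, rfl⟩ := hs
    dsimp only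
    rw [set₂_apply]
    split_ifs with e
    · obtain ⟨rfl, rfl⟩ := e
      exact Or.inr (Or.inr ⟨rfl, ⟨m, h⟩, rfl⟩)
    · refine Or.inl ⟨rfl, by simp, fun h => e ?_⟩
      cases h; exact ⟨rfl, rfl⟩
  | pingSend a b => obtain ⟨-, -, -, rfl⟩ := hs; exact Or.inl ⟨rfl, by simp, by simp⟩
  | pingReceive a b =>
    obtain ⟨ha, hb, q, hq, hs⟩ := hs
    split at hs
    · obtain ⟨x, x', -, -, rfl⟩ := hs
      exact Or.inl ⟨rfl, by simp, by simp⟩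
    · subst hs; exact Or.inl ⟨rfl, by simp, by simp⟩
  | pongSend a b => obtain ⟨-, -, q, x, -, rfl⟩ := hs; exact Or.inl ⟨rfl, by simp, by simp⟩
  | pongReceive a b => obtain ⟨-, -, q, x, -, rfl⟩ := hs; exact Or.inl ⟨rfl, by simp, by simp⟩
  | startWrite a s => obtain ⟨-, -, -, rfl⟩ := hs; exact Or.inl ⟨rfl, by simp, by simp⟩
  | startRead a => obtain ⟨-, -, -, rfl⟩ := hs; exact Or.inl ⟨rfl, by simp, by simp⟩
  | resetSend a b => simp only [Step] at hs; subst hs; exact Or.inl ⟨rfl, by simp, by simp⟩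
  | resetReceive a b => simp only [Step] at hs; subst hs; exact Or.inl ⟨rfl, by simp, by simp⟩
  | disable a => exact absurd rfl (n1 a)
  | localReset a t => exact absurd rfl (n2 a t)
  | clean a => exact absurd rfl (n3 a)
  | enable A => simp only [Step] at hs; subst hs; exact Or.inl ⟨rfl, by simp, by simp⟩

/-- The steps of a ping-pong link, when the machines are enabled. -/
theorem Step.ping (hs : Step p c ev c') (hc : c.ResetFree p) (hc' : c'.ResetFree p) {i j : P} :
    (c'.ping i j = c.ping i j ∧ ev ≠ .pingSend i j ∧ ev ≠ .pingReceive i j ∧ ev ≠ .pongSend i j ∧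
      ev ≠ .pongReceive i j) ∨
    (ev = .pingSend i j ∧ c.ping i j = .atClient ∧
      c'.ping i j = .request ((c.cli i).outgoing p j)) ∨
    (ev = .pingReceive i j ∧ c.ping i j = .request none ∧ c'.ping i j = .atServer none none) ∨
    (∃ r a a', ev = .pingReceive i j ∧ c.ping i j = .request (some r) ∧
      Replies p (storeAfter (c.srv j).store r) r a ∧ a'.map Ack.tag = a.map Ack.tag ∧
      (c'.srv j).store = storeAfter (c.srv j).store r ∧
      c'.ping i j = .atServer (some r) a') ∨
    (∃ q a, ev = .pongSend i j ∧ c.ping i j = .atServer q a ∧ c'.ping i j = .response q a) ∨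
    (∃ q a, ev = .pongReceive i j ∧ c.ping i j = .response q a ∧ c'.ping i j = .atClient) := by
  obtain ⟨n1, n2, n3⟩ := hs.not_reset hc hc'
  cases ev with
  | gossipSend a b => obtain ⟨-, -, -, -, rfl⟩ := hs; exact Or.inl (by simp)
  | gossipReceive a b => obtain ⟨ha, hb, hab, m, hm, rfl⟩ := hs; exact Or.inl (by simp)
  | pingSend a b =>
    obtain ⟨ha, hb, h, rfl⟩ := hs
    by_cases e : i = a ∧ j = b
    · obtain ⟨rfl, rfl⟩ := e
      refine Or.inr (Or.inl ⟨rfl, h, ?_⟩)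
      dsimp only
      rw [set₂_apply, if_pos ⟨rfl, rfl⟩, if_pos (hc.2.1 i ha)]
    · refine Or.inl ⟨?_, fun h => e ?_, by simp, by simp, by simp⟩
      · dsimp only
        rw [set₂_apply, if_neg e]
      · cases h; exact ⟨rfl, rfl⟩
  | pingReceive a b =>
    obtain ⟨ha, hb, q, hq, hs⟩ := hs
    by_cases e : i = a ∧ j = b
    · obtain ⟨rfl, rfl⟩ := e
      rcases q with _ | r
      · simp only at hs
        refine Or.inr (Or.inr (Or.inl ⟨rfl, hq, ?_⟩))
        rw [hs]
        dsimp only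
        rw [set₂_apply, if_pos ⟨rfl, rfl⟩]
      · rw [hc.1 j hb] at hs
        simp only at hs
        obtain ⟨x, x', h1, h2, rfl⟩ := hs
        refine Or.inr (Or.inr (Or.inr (Or.inl ⟨r, x, x', rfl, hq, h1, ?_, ?_, ?_⟩)))
        · split_ifs at h2
          · exact h2
          · rw [h2]
        · simp
        · dsimp only
          rw [set₂_apply, if_pos ⟨rfl, rfl⟩]
    · refine Or.inl ⟨?_, by simp, fun h => e ?_, by simp, by simp⟩
      · split at hs
        · obtain ⟨x, x', -, -, rfl⟩ := hs
          dsimp only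
          rw [set₂_apply, if_neg e]
        · subst hs
          dsimp only
          rw [set₂_apply, if_neg e]
      · cases h; exact ⟨rfl, rfl⟩
  | pongSend a b =>
    obtain ⟨ha, hb, q, x, h, rfl⟩ := hs
    by_cases e : i = a ∧ j = b
    · obtain ⟨rfl, rfl⟩ := e
      refine Or.inr (Or.inr (Or.inr (Or.inr (Or.inl ⟨q, x, rfl, h, ?_⟩))))
      dsimp only
      rw [set₂_apply, if_pos ⟨rfl, rfl⟩, if_pos (hc.1 j hb)]
    · refine Or.inl ⟨?_, by simp, by simp, fun h => e ?_, by simp⟩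
      · dsimp only
        rw [set₂_apply, if_neg e]
      · cases h; exact ⟨rfl, rfl⟩
  | pongReceive a b =>
    obtain ⟨ha, hb, q, x, h, rfl⟩ := hs
    by_cases e : i = a ∧ j = b
    · obtain ⟨rfl, rfl⟩ := e
      refine Or.inr (Or.inr (Or.inr (Or.inr (Or.inr ⟨q, x, rfl, h, ?_⟩))))
      dsimp only
      rw [set₂_apply, if_pos ⟨rfl, rfl⟩]
    · refine Or.inl ⟨?_, by simp, by simp, by simp, fun h => e ?_⟩
      · dsimp only
        rw [set₂_apply, if_neg e]
      · cases h; exact ⟨rfl, rfl⟩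
  | startWrite a s => obtain ⟨-, -, -, rfl⟩ := hs; exact Or.inl (by simp)
  | startRead a => obtain ⟨-, -, -, rfl⟩ := hs; exact Or.inl (by simp)
  | resetSend a b => simp only [Step] at hs; subst hs; exact Or.inl (by simp)
  | resetReceive a b => simp only [Step] at hs; subst hs; exact Or.inl (by simp)
  | disable a => exact absurd rfl (n1 a)
  | localReset a t => exact absurd rfl (n2 a t)
  | clean a => exact absurd rfl (n3 a)
  | enable A => simp only [Step] at hs; subst hs; exact Or.inl (by simp)

/-- The steps of a client, when the machines are enabled. -/
theorem Step.cli (hs : Step p c ev c') (hc : c.ResetFree p) (hc' : c'.ResetFree p) {i : P} :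
    (c'.cli i = c.cli i ∧ (∀ j, ev ≠ .pingSend i j) ∧ ∀ j, ev ≠ .pongReceive i j) ∨
    (∃ j ∈ p.servers, ev = .pingSend i j ∧ c'.cli i = (c.cli i).markSent j) ∨
    (∃ j ∈ p.servers, ∃ q a, ev = .pongReceive i j ∧ c.ping i j = .response q a ∧
      c'.cli i = onReply p i j q a (c.cli i)) ∨
    (c.cli i = .idle ∧ (∀ j, ev ≠ .pingSend i j) ∧ (∀ j, ev ≠ .pongReceive i j) ∧
      ((∃ s, c'.cli i = .enter (.wQuery s)) ∨ c'.cli i = .enter .rQuery)) := by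
  obtain ⟨n1, n2, n3⟩ := hs.not_reset hc hc'
  cases ev with
  | gossipSend a b => obtain ⟨-, -, -, -, rfl⟩ := hs; exact Or.inl (by simp)
  | gossipReceive a b => obtain ⟨ha, hb, hab, m, hm, rfl⟩ := hs; exact Or.inl (by simp)
  | pingSend a b =>
    obtain ⟨ha, hb, h, rfl⟩ := hs
    by_cases e : i = a
    · subst e
      refine Or.inr (Or.inl ⟨b, hb, rfl, ?_⟩)
      simp [hc.2.1 i ha]
    · refine Or.inl ⟨?_, fun j h => e ?_, by simp⟩
      · dsimp only
        split_ifs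
        · rw [Function.update_of_ne e]
        · rfl
      · cases h; rfl
  | pingReceive a b =>
    obtain ⟨ha, hb, q, hq, hs⟩ := hs
    split at hs
    · obtain ⟨x, x', -, -, rfl⟩ := hs
      exact Or.inl (by simp)
    · subst hs; exact Or.inl (by simp)
  | pongSend a b => obtain ⟨-, -, q, x, -, rfl⟩ := hs; exact Or.inl (by simp)
  | pongReceive a b =>
    obtain ⟨ha, hb, q, x, h, rfl⟩ := hs
    by_cases e : i = a
    · subst e
      refine Or.inr (Or.inr (Or.inl ⟨b, hb, q, x, rfl, h, ?_⟩))
      simp [hc.2.1 i ha]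
    · refine Or.inl ⟨?_, by simp, fun j h => e ?_⟩
      · dsimp only
        split_ifs
        · rw [Function.update_of_ne e]
        · rfl
      · cases h; rfl
  | startWrite a s =>
    obtain ⟨ha, -, h, rfl⟩ := hs
    by_cases e : i = a
    · subst e
      exact Or.inr (Or.inr (Or.inr ⟨h, by simp, by simp, Or.inl ⟨s, by simp⟩⟩))
    · exact Or.inl (by simp [Function.update_of_ne e])
  | startRead a =>
    obtain ⟨ha, -, h, rfl⟩ := hs
    by_cases e : i = a
    · subst e
      exact Or.inr (Or.inr (Or.inr ⟨h, by simp, by simp, Or.inr (by simp)⟩))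
    · exact Or.inl (by simp [Function.update_of_ne e])
  | resetSend a b => simp only [Step] at hs; subst hs; exact Or.inl (by simp)
  | resetReceive a b => simp only [Step] at hs; subst hs; exact Or.inl (by simp)
  | disable a => exact absurd rfl (n1 a)
  | localReset a t => exact absurd rfl (n2 a t)
  | clean a => exact absurd rfl (n3 a)
  | enable A => simp only [Step] at hs; subst hs; exact Or.inl (by simp)

end StepLemmas

section CalmLemmas

variable {P W V : Type*} [Fintype P] [LinearOrder P] [Nonempty P] [DecidableEq W]
variable {p : Setup P W V}

/-! ### Link cycles and calm segments -/

/-- The segment with the steps `x, …, y - 1` includes a complete iteration of every server and a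
complete round trip of every client node with every server. -/
def Execution.LinkCycle (R : Execution p) (x y : ℕ) : Prop :=
  (∀ i ∈ p.servers, R.ServerIteration x y i) ∧
  ∀ i ∈ p.clients, ∀ j ∈ p.servers, R.RoundTrip x y i j

theorem Execution.LinkCycle.gossip {R : Execution p} {x y : ℕ} (h : R.LinkCycle x y) {i j : P}
    (hi : i ∈ p.servers) (hj : j ∈ p.servers) (hij : i ≠ j) :
    ∃ b₁ b₂, x ≤ b₁ ∧ b₁ < b₂ ∧ b₂ < y ∧ R.event b₁ = .gossipSend i j ∧
      R.event b₂ = .gossipReceive i j := by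
  obtain ⟨a, k, ha, -, h⟩ := h.1 i hi
  obtain ⟨b₁, b₂, b₃, b₄, h1, h2, h3, h4, h5, e1, e2, -, -⟩ := h j hj hij.symm
  exact ⟨b₁, b₂, by omega, h2, by omega, e1, e2⟩

theorem Execution.LinkCycle.lt {R : Execution p} {x y : ℕ} (h : R.LinkCycle x y) : x < y := by
  obtain ⟨i, hi⟩ := p.servers_nonempty
  obtain ⟨j, hj, hij⟩ := p.exists_ne i
  obtain ⟨b₁, b₂, h1, h2, h3, -⟩ := h.gossip hi hj hij.symm
  omega

/-- The states `w 0, …, B` are reset-free, there is no call to `globalReset` meanwhile, no gossip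
without payload is in transit, and the steps from `w k` to `w (k + 1)` include a link cycle. -/
structure Calm (R : Execution p) (w : ℕ → ℕ) (B : ℕ) : Prop where
  cycle : ∀ k, R.LinkCycle (w k) (w (k + 1))
  resetFree : ∀ n, w 0 ≤ n → n ≤ B → (R.state n).ResetFree p
  noCall : ∀ n, w 0 ≤ n → n < B → ∀ i t, ¬ R.CallsReset n i t
  gossip_ne : ∀ n, w 0 ≤ n → n ≤ B → ∀ i ∈ p.servers, ∀ j ∈ p.servers, i ≠ j →
    (R.state n).gossip i j ≠ .inTransit none

/-- `Q` holds in all states from `w k` to `B`. -/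
def After (w : ℕ → ℕ) (B k : ℕ) (Q : ℕ → Prop) : Prop :=
  ∀ n, w k ≤ n → n ≤ B → Q n

variable {R : Execution p} {w : ℕ → ℕ} {B : ℕ}

theorem Calm.mono (h : Calm R w B) : Monotone w :=
  monotone_nat_of_le_succ fun k => (h.cycle k).lt.le

theorem Calm.le (h : Calm R w B) (k : ℕ) : w 0 ≤ w k := h.mono (Nat.zero_le k)

theorem After.weaken {k l : ℕ} {Q Q' : ℕ → Prop} (h : Calm R w B) (hQ : After w B k Q)
    (hkl : k ≤ l) (hQ' : ∀ n, w 0 ≤ n → n ≤ B → Q n → Q' n) : After w B l Q' :=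
  fun n hn hB => hQ' n ((h.le l).trans hn) hB (hQ n ((h.mono hkl).trans hn) hB)

theorem After.shift {k l : ℕ} {Q : ℕ → Prop} (hQ : After w B k Q) (h : Calm R w B)
    (hkl : k ≤ l) : After w B l Q :=
  hQ.weaken h hkl fun _ _ _ => id

theorem Calm.drop (h : Calm R w B) (c : ℕ) : Calm R (fun k => w (k + c)) B where
  cycle k := by
    have := h.cycle (k + c)
    rwa [show k + c + 1 = k + 1 + c by omega] at this
  resetFree n hn hB := h.resetFree n ((h.le _).trans hn) hB
  noCall n hn hB := h.noCall n ((h.le _).trans hn) hB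
  gossip_ne n hn hB := h.gossip_ne n ((h.le _).trans hn) hB

theorem Calm.restrict (h : Calm R w B) {B' : ℕ} (hB : B' ≤ B) : Calm R w B' where
  cycle := h.cycle
  resetFree n hn hn' := h.resetFree n hn (hn'.trans hB)
  noCall n hn hn' := h.noCall n hn (hn'.trans_le hB)
  gossip_ne n hn hn' := h.gossip_ne n hn (hn'.trans hB)

/-- A property that persists and holds at some point of a cycle holds after this cycle. -/
theorem After.of_cycle {k : ℕ} {Q : ℕ → Prop}
    (hp : ∀ n, w k ≤ n → n < B → Q n → Q (n + 1))
    (he : w (k + 1) ≤ B → ∃ n, w k ≤ n ∧ n ≤ w (k + 1) ∧ Q n) : After w B (k + 1) Q := by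
  intro n hn hB
  obtain ⟨m, hm, hm', hQ⟩ := he (hn.trans hB)
  have hmn : m ≤ n := hm'.trans hn
  clear hn hm'
  induction n, hmn using Nat.le_induction with
  | base => exact hQ
  | succ n hmn ih => exact hp n (hm.trans hmn) (by omega) (ih (by omega))

theorem After.persist {k : ℕ} {Q : ℕ → Prop}
    (hp : ∀ n, w k ≤ n → n < B → Q n → Q (n + 1)) (he : Q (w k)) : After w B k Q := by
  intro n hn
  induction n, hn using Nat.le_induction with
  | base => exact fun _ => he
  | succ n hmn ih => exact fun hB => hp n hmn (by omega) (ih (by omega))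

/-! ### Servers and gossip in a calm segment -/

/-- The largest tag that the server of `i` stores. -/
def Execution.top (R : Execution p) (n : ℕ) (i : P) : Tag P :=
  maxPhase ((R.state n).srv i).store allPhases

/-- The last gossip that the server of `j` received from `i`. -/
abbrev Execution.rx (R : Execution p) (n : ℕ) (j i : P) : Triple P := ((R.state n).srv j).rx i

/-- The gossip that the server of `i` sends. -/
abbrev Execution.tx (R : Execution p) (n : ℕ) (i : P) : Triple P := ((R.state n).srv i).tx

/-- Since nobody calls `globalReset`, the second component of `onGossip` is `none`. The field `call`
of `GossipEffect` then states that the conditions for a call fail, which is how contradictions arise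
later. -/
theorem Calm.srv (h : Calm R w B) {n : ℕ} (hn : w 0 ≤ n) (hB : n < B) {j : P}
    (hj : j ∈ p.servers) :
    (R.state (n + 1)).srv j = (R.state n).srv j ∨
    (∃ i m, i ∈ p.servers ∧ i ≠ j ∧ (R.state n).gossip i j = .inTransit (some m) ∧
      GossipEffect p j ((R.state n).srv j) i m ((R.state (n + 1)).srv j) none) ∨
    ∃ i r, i ∈ p.clients ∧ (R.state n).ping i j = .request (some r) ∧
      (R.state (n + 1)).srv j =
        { (R.state n).srv j with store := storeAfter ((R.state n).srv j).store r } := by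
  have hc := h.resetFree n hn hB.le
  rcases (R.step n).srv hc (h.resetFree (n + 1) (by omega) hB) hj with e | e | e
  · exact Or.inl e
  · obtain ⟨i, m, hev, hi, hij, hm, e⟩ := e
    refine Or.inr (Or.inl ⟨i, m, hi, hij, hm, ?_⟩)
    have key := gossipEffect_onGossip p (i := j) ((R.state n).srv j) i m
    rw [← e] at key
    have : (onGossip p j ((R.state n).srv j) i m).2 = none := by
      by_contra hne
      obtain ⟨t, ht⟩ := Option.ne_none_iff_exists'.1 hne
      exact h.noCall n hn hB j t ⟨i, m, hev, hm, hc.1 j hj, ht⟩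
    rwa [this] at key
  · exact Or.inr (Or.inr e)

theorem Calm.gossip (h : Calm R w B) {n : ℕ} (hn : w 0 ≤ n) (hB : n < B) (i j : P) :
    ((R.state (n + 1)).gossip i j = (R.state n).gossip i j ∧ R.event n ≠ .gossipSend i j ∧
      R.event n ≠ .gossipReceive i j) ∨
    (R.event n = .gossipSend i j ∧ (R.state n).gossip i j = .atSender ∧
      (R.state (n + 1)).gossip i j = .inTransit (some (R.tx n i))) ∨
    (R.event n = .gossipReceive i j ∧ (∃ m, (R.state n).gossip i j = .inTransit m) ∧
      (R.state (n + 1)).gossip i j = .atSender) :=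
  (R.step n).gossip (h.resetFree n hn hB.le) (h.resetFree (n + 1) (by omega) hB)

theorem Calm.ping (h : Calm R w B) {n : ℕ} (hn : w 0 ≤ n) (hB : n < B) (i j : P) :
    ((R.state (n + 1)).ping i j = (R.state n).ping i j ∧ R.event n ≠ .pingSend i j ∧
      R.event n ≠ .pingReceive i j ∧ R.event n ≠ .pongSend i j ∧ R.event n ≠ .pongReceive i j) ∨
    (R.event n = .pingSend i j ∧ (R.state n).ping i j = .atClient ∧
      (R.state (n + 1)).ping i j = .request (((R.state n).cli i).outgoing p j)) ∨
    (R.event n = .pingReceive i j ∧ (R.state n).ping i j = .request none ∧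
      (R.state (n + 1)).ping i j = .atServer none none) ∨
    (∃ r a a', R.event n = .pingReceive i j ∧ (R.state n).ping i j = .request (some r) ∧
      Replies p (storeAfter ((R.state n).srv j).store r) r a ∧ a'.map Ack.tag = a.map Ack.tag ∧
      ((R.state (n + 1)).srv j).store = storeAfter ((R.state n).srv j).store r ∧
      (R.state (n + 1)).ping i j = .atServer (some r) a') ∨
    (∃ q a, R.event n = .pongSend i j ∧ (R.state n).ping i j = .atServer q a ∧
      (R.state (n + 1)).ping i j = .response q a) ∨
    (∃ q a, R.event n = .pongReceive i j ∧ (R.state n).ping i j = .response q a ∧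
      (R.state (n + 1)).ping i j = .atClient) :=
  (R.step n).ping (h.resetFree n hn hB.le) (h.resetFree (n + 1) (by omega) hB) (i := i) (j := j)

theorem Calm.cli (h : Calm R w B) {n : ℕ} (hn : w 0 ≤ n) (hB : n < B) (i : P) :
    ((R.state (n + 1)).cli i = (R.state n).cli i ∧ (∀ j, R.event n ≠ .pingSend i j) ∧
      ∀ j, R.event n ≠ .pongReceive i j) ∨
    (∃ j ∈ p.servers, R.event n = .pingSend i j ∧
      (R.state (n + 1)).cli i = ((R.state n).cli i).markSent j) ∨
    (∃ j ∈ p.servers, ∃ q a, R.event n = .pongReceive i j ∧ (R.state n).ping i j = .response q a ∧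
      (R.state (n + 1)).cli i = onReply p i j q a ((R.state n).cli i)) ∨
    ((R.state n).cli i = .idle ∧ (∀ j, R.event n ≠ .pingSend i j) ∧
      (∀ j, R.event n ≠ .pongReceive i j) ∧
      ((∃ s, (R.state (n + 1)).cli i = .enter (.wQuery s)) ∨
        (R.state (n + 1)).cli i = .enter .rQuery)) :=
  (R.step n).cli (h.resetFree n hn hB.le) (h.resetFree (n + 1) (by omega) hB)

/-- Arrival of gossip in a calm segment. -/
theorem Calm.receive (h : Calm R w B) {n : ℕ} (hn : w 0 ≤ n) (hB : n < B) {i j : P}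
    (hev : R.event n = .gossipReceive i j) :
    ∃ m, i ∈ p.servers ∧ j ∈ p.servers ∧ i ≠ j ∧ (R.state n).gossip i j = .inTransit (some m) ∧
      GossipEffect p j ((R.state n).srv j) i m ((R.state (n + 1)).srv j) none := by
  have hs := R.step n
  rw [hev] at hs
  obtain ⟨hi, hj, hij, m, hm, hc'⟩ := hs
  rcases m with _ | m
  · exact absurd hm (h.gossip_ne n hn hB.le i hi j hj hij)
  · refine ⟨m, hi, hj, hij, hm, ?_⟩
    have hc := h.resetFree n hn hB.le
    have key := gossipEffect_onGossip p (i := j) ((R.state n).srv j) i m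
    have e : (R.state (n + 1)).srv j = (onGossip p j ((R.state n).srv j) i m).1 := by
      rw [hc']; simp [hc.1 j hj]
    rw [← e] at key
    have : (onGossip p j ((R.state n).srv j) i m).2 = none := by
      by_contra hne
      obtain ⟨t, ht⟩ := Option.ne_none_iff_exists'.1 hne
      exact h.noCall n hn hB j t ⟨i, m, hev, hm, hc.1 j hj, ht⟩
    rwa [this] at key

/-- A property of a server that is established by the arrival of gossip holds after one cycle. -/
theorem Calm.after_receive {k : ℕ} (h : Calm R w B) {j : P} (hj : j ∈ p.servers) {Q : ℕ → Prop}
    (hp : ∀ n, w k ≤ n → n < B → Q n →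
      ((R.state (n + 1)).srv j = (R.state n).srv j ∨ ∃ i r, i ∈ p.clients ∧
        (R.state n).ping i j = .request (some r) ∧ (R.state (n + 1)).srv j =
        { (R.state n).srv j with store := storeAfter ((R.state n).srv j).store r }) → Q (n + 1))
    (he : ∀ n, w k ≤ n → n < B → ∀ i ∈ p.servers, i ≠ j → ∀ m,
      (R.state n).gossip i j = .inTransit (some m) →
      GossipEffect p j ((R.state n).srv j) i m ((R.state (n + 1)).srv j) none → Q (n + 1)) :
    After w B (k + 1) Q := by
  refine After.of_cycle (fun n hn hB hQ => ?_) (fun hB => ?_)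
  · rcases h.srv ((h.le k).trans hn) hB hj with e | ⟨i, m, hi, hij, hm, e⟩ | e
    · exact hp n hn hB hQ (Or.inl e)
    · exact he n hn hB i hi hij m hm e
    · exact hp n hn hB hQ (Or.inr e)
  · obtain ⟨i, hi, hij⟩ := p.exists_ne j
    obtain ⟨b₁, b₂, h1, h2, h3, e1, e2⟩ := (h.cycle k).gossip hi hj hij
    obtain ⟨m, -, -, -, hm, e⟩ := h.receive (n := b₂) ((h.le k).trans (by omega)) (by omega) e2
    exact ⟨b₂ + 1, by omega, by omega, he b₂ (by omega) (by omega) i hi hij m hm e⟩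

/-- A property of gossip that holds in the sender's buffer holds in transit one cycle later. -/
theorem Calm.after_gossip {k : ℕ} (h : Calm R w B) {Φ : ℕ → Triple P → Prop} {i j : P}
    (hi : i ∈ p.servers) (hj : j ∈ p.servers) (hij : i ≠ j)
    (hΦ : ∀ n, w k ≤ n → n < B → ∀ m, Φ n m → Φ (n + 1) m)
    (htx : After w B k fun n => Φ n (R.tx n i)) :
    After w B (k + 1) fun n => ∀ m, (R.state n).gossip i j = .inTransit (some m) → Φ n m := by
  refine After.of_cycle (fun n hn hB hQ => ?_) (fun hB => ?_)
  · rcases h.gossip ((h.le k).trans hn) hB i j with e | e | e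
    · rw [e.1]
      exact fun m hm => hΦ n hn hB m (hQ m hm)
    · rw [e.2.2]
      intro m hm
      cases hm
      exact hΦ n hn hB _ (htx n hn hB.le)
    · rw [e.2.2]
      simp
  · obtain ⟨b₁, b₂, h1, h2, h3, e1, e2⟩ := (h.cycle k).gossip hi hj hij
    -- At the moment of a send the link is empty and the property holds vacuously; old gossip in
    -- transit at the start of the cycle does no harm.
    refine ⟨b₁, h1, by omega, ?_⟩
    rcases h.gossip ((h.le k).trans h1) (show b₁ < B by omega) i j with e | e | e
    · exact absurd e1 e.2.1
    · rw [e.2.1]; simp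
    · rw [e1] at e; simp at e

/-- … and in the receiver's buffer another cycle later. -/
theorem Calm.after_rx {k : ℕ} (h : Calm R w B) {Φ : ℕ → Triple P → Prop} {i j : P}
    (hi : i ∈ p.servers) (hj : j ∈ p.servers) (hij : i ≠ j)
    (hΦ : ∀ n, w k ≤ n → n < B → ∀ m, Φ n m → Φ (n + 1) m)
    (htx : After w B k fun n => Φ n (R.tx n i)) :
    After w B (k + 2) fun n => Φ n (R.rx n j i) := by
  have hg := h.after_gossip hi hj hij hΦ htx
  refine After.of_cycle (k := k + 1) (fun n hn hB hQ => ?_) (fun hB => ?_)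
  · have hn0 : w k ≤ n := (h.mono (by omega)).trans hn
    have hQ' := hΦ n hn0 hB _ hQ
    rcases h.srv ((h.le k).trans hn0) hB hj with e | ⟨l, m, hl, hlj, hm, e⟩ | ⟨l, r, -, -, e⟩
    · rw [Execution.rx, e]; exact hQ'
    · rw [Execution.rx, e.rx_ne i hij]
      by_cases hli : i = l
      · subst hli
        rw [Function.update_self]
        exact hΦ n hn0 hB _ (hg n hn hB.le m hm)
      · rw [Function.update_of_ne hli]; exact hQ'
    · rw [Execution.rx, e]; exact hQ'
  · obtain ⟨b₁, b₂, h1, h2, h3, e1, e2⟩ := (h.cycle (k + 1)).gossip hi hj hij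
    have hb : w (k + 1) ≤ b₂ := by omega
    have hb0 : w k ≤ b₂ := (h.mono (by omega)).trans hb
    obtain ⟨m, -, -, -, hm, e⟩ := h.receive ((h.le k).trans hb0) (by omega) e2
    refine ⟨b₂ + 1, by omega, by omega, ?_⟩
    rw [Execution.rx, e.rx_ne i hij, Function.update_self]
    exact hΦ b₂ hb0 (by omega) m (hg b₂ hb (by omega) m hm)

/-- Gossip ends with a stored maximum at least as large as the old one, which garbage collection
keeps, and requests only add tags. Only a local reset could lower the maximum. -/
theorem Calm.top_mono (h : Calm R w B) {n m : ℕ} (hn : w 0 ≤ n) (hnm : n ≤ m) (hB : m ≤ B) {j : P}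
    (hj : j ∈ p.servers) : R.top n j ≤ R.top m j := by
  induction m, hnm using Nat.le_induction with
  | base => exact le_rfl
  | succ m hnm ih =>
    refine (ih (by omega)).trans ?_
    unfold Execution.top
    rcases h.srv (hn.trans hnm) (by omega) hj with e | ⟨l, m, hl, hlj, hm, e⟩ | ⟨l, r, -, -, e⟩
    · rw [e]
    · rw [e.top_eq]; exact e.top_le_pre
    · rw [e]; exact maxPhase_le_storeAfter _ _

/-- After the first arrival of gossip in a calm segment, the gossip buffers of a server are
consistent with each other and with its storage. -/
structure Settled (p : Setup P W V) (j : P) (s : Server P W) : Prop where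
  le_pre : ∀ k ∈ p.servers, (s.rx k).pre ≤ (s.rx j).pre ∧ (s.rx k).fin ≤ (s.rx j).pre ∧
    (s.rx k).FIN ≤ (s.rx j).pre
  le_fin : ∀ k ∈ p.servers, (s.rx k).fin ≤ (s.rx j).fin ∧ (s.rx k).FIN ≤ (s.rx j).fin
  pre_le : (s.rx j).pre ≤ maxPhase s.store allPhases
  tx_pre : s.tx.pre = (s.rx j).pre
  tx_fin : s.tx.fin = (s.rx j).fin
  tx_FIN : s.tx.FIN ≤ (s.rx j).fin
  fin_le_pre : (s.rx j).fin ≤ (s.rx j).pre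

theorem GossipEffect.settled {i j : P} {s s' : Server P W} {m : Triple P} {c : Option (Tag P)}
    (h : GossipEffect p j s i m s' c) : Settled p j s' where
  le_pre k hk := by
    by_cases e : k = j
    · subst e; exact ⟨le_rfl, h.fin_le_pre, h.FIN_le_fin.trans h.fin_le_pre⟩
    · rw [h.rx_ne k e]; exact h.le_pre k hk
  le_fin k hk := by
    by_cases e : k = j
    · subst e; exact ⟨le_rfl, h.FIN_le_fin⟩
    · rw [h.rx_ne k e]; exact h.le_fin k hk
  pre_le := h.top_eq.ge
  tx_pre := by rw [h.tx_eq, ← h.top_eq]; rfl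
  tx_fin := by rw [h.tx_eq, ← h.fin_eq]; rfl
  tx_FIN := by rw [h.tx_eq, ← h.fin_eq]; exact maxPhase_mono FIN_subset
  fin_le_pre := h.fin_le_pre

/-- One arrival of gossip suffices. A later request leaves the buffers alone and may raise the
stored maximum, which is why `pre_le` is only an inequality. -/
theorem Calm.settled (h : Calm R w B) :
    After w B 1 fun n => ∀ j ∈ p.servers, Settled p j ((R.state n).srv j) := by
  intro n hn hB j hj
  refine h.after_receive (k := 0) hj (Q := fun n => Settled p j ((R.state n).srv j)) ?_ ?_ n hn hB
  · rintro n hn hB hQ (e | ⟨i, r, -, -, e⟩)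
    · rwa [e]
    · rw [e]
      exact { hQ with pre_le := hQ.pre_le.trans (maxPhase_le_storeAfter _ _) }
  · exact fun n hn hB i hi hij m hm e => e.settled

/-- A lower bound on the largest stored tag of one server spreads to all. -/
theorem Calm.spread_top (h : Calm R w B) {k : ℕ} {v : Tag P} {i : P} (hi : i ∈ p.servers)
    (hv : v ≤ R.top (w k) i) : After w B (k + 4) fun n => ∀ j ∈ p.servers, v ≤ R.top n j := by
  have hk0 := h.le k
  -- The outgoing buffer may be stale at first; the next arrival of gossip refreshes it.
  have h1 : After w B (k + 1) fun n => v ≤ (R.tx n i).pre := by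
    refine h.after_receive hi ?_ ?_
    · rintro n hn hB hQ (e | ⟨i, r, -, -, e⟩)
      · rwa [Execution.tx, e]
      · rwa [Execution.tx, e]
    · intro n hn hB j hj hji m hm e
      rw [Execution.tx, e.settled.tx_pre]
      exact (hv.trans (h.top_mono hk0 hn hB.le hi)).trans e.top_le_pre
  intro n hn hB j hj
  by_cases hij : i = j
  · subst hij
    exact hv.trans (h.top_mono hk0 ((h.mono (by omega)).trans hn) hB hi)
  have h3 := h.after_rx hi hj hij (Φ := fun _ m => v ≤ m.pre) (fun _ _ _ _ => id) h1
  have hs := h.settled.shift h (show 1 ≤ k + 4 by omega) n hn hB j hj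
  exact ((h3.shift h (show k + 1 + 2 ≤ k + 4 by omega) n hn hB).trans (hs.le_pre i hi).1).trans
    hs.pre_le

end CalmLemmas

section ClientLemmas

variable {P W V : Type*} [Fintype P] [LinearOrder P] [Nonempty P] [DecidableEq W]
variable {p : Setup P W V} {R : Execution p} {w : ℕ → ℕ} {B : ℕ}

/-! ### Clients and their links in a calm segment -/

/-- Every round trip begins with the token at the client, where the link carries no payload.
Assertions about the payload hold vacuously there, so only their persistence has to be proved. -/
theorem After.of_atClient {k : ℕ} (h : Calm R w B) {i j : P} (hi : i ∈ p.clients)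
    (hj : j ∈ p.servers) {Q : ℕ → Prop} (hp : ∀ n, w k ≤ n → n < B → Q n → Q (n + 1))
    (he : ∀ n, w k ≤ n → n < B → (R.state n).ping i j = .atClient → Q n) :
    After w B (k + 1) Q := by
  refine After.of_cycle hp fun hB => ?_
  obtain ⟨b₁, b₂, b₃, b₄, h1, h2, h3, h4, h5, e1, -⟩ := (h.cycle k).2 i hi j hj
  refine ⟨b₁, h1, by omega, he b₁ h1 (by omega) ?_⟩
  have hs := R.step b₁
  rw [e1] at hs
  exact hs.2.2.1

/-- The acknowledgments after the arrival of a reply. -/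
def newAcks (p : Setup P W V) (j : P) (q : Option (Req P W)) (a : Option (Ack P W))
    (pr : Proc P V) (sent : P → Bool) (acks : P → Option (Ack P W)) : P → Option (Ack P W) :=
  if sent j = true ∧ q = some (pr.req p j) ∧ a.isSome then Function.update acks j a else acks

/-- A quorum has acknowledged. -/
def Enough (p : Setup P W V) (acks : P → Option (Ack P W)) : Prop :=
  p.IsQuorum (p.servers.filter fun k => (acks k).isSome)

theorem Enough.exists {acks : P → Option (Ack P W)} (h : Enough p acks) :
    ∃ k ∈ p.servers, ∃ a, acks k = some a := by
  obtain ⟨k, hk⟩ := Setup.IsQuorum.nonempty h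
  obtain ⟨hk, hs⟩ := Finset.mem_filter.1 hk
  exact ⟨k, hk, Option.isSome_iff_exists.1 hs⟩

theorem enough_of_forall {acks : P → Option (Ack P W)}
    (h : ∀ k ∈ p.servers, (acks k).isSome) : Enough p acks := by
  unfold Enough
  rw [Finset.filter_true_of_mem h]
  exact p.isQuorum_servers

theorem onReply_busy (i j : P) (q : Option (Req P W)) (a : Option (Ack P W)) (pr : Proc P V)
    (sent : P → Bool) (acks : P → Option (Ack P W)) :
    (Enough p (newAcks p j q a pr sent acks) ∧ onReply p i j q a (.busy pr sent acks) =
      .advance p i (newAcks p j q a pr sent acks) pr) ∨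
    (¬ Enough p (newAcks p j q a pr sent acks) ∧ onReply p i j q a (.busy pr sent acks) =
      .busy pr sent (newAcks p j q a pr sent acks)) := by
  unfold onReply Enough newAcks
  dsimp only
  split_ifs with h1 h2 h2 <;> simp [h2]

/-- The acknowledgments of the client of `i` change from `acks` to `acks'` by a reply in transit. -/
def AckStep (p : Setup P W V) (c : State P W V) (i : P) (pr : Proc P V) (sent : P → Bool)
    (acks acks' : P → Option (Ack P W)) : Prop :=
  ∀ k, acks' k = acks k ∨ (sent k = true ∧ ∃ a,
    c.ping i k = .response (some (pr.req p k)) (some a) ∧ acks' k = some a)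

theorem ackStep_newAcks {c : State P W V} {i j : P} {q : Option (Req P W)}
    {a : Option (Ack P W)} (h : c.ping i j = .response q a) (pr : Proc P V) (sent : P → Bool)
    (acks : P → Option (Ack P W)) : AckStep p c i pr sent acks (newAcks p j q a pr sent acks) := by
  intro k
  unfold newAcks
  split_ifs with hc
  · by_cases e : k = j
    · subst e
      obtain ⟨h1, rfl, h3⟩ := hc
      obtain ⟨b, rfl⟩ := Option.isSome_iff_exists.1 h3
      exact Or.inr ⟨h1, b, h, by simp⟩
    · left; rw [Function.update_of_ne e]
  · exact Or.inl rfl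

theorem Calm.busy (h : Calm R w B) {n : ℕ} (hn : w 0 ≤ n) (hB : n < B) {i : P} {pr : Proc P V}
    {sent : P → Bool} {acks : P → Option (Ack P W)}
    (hc : (R.state n).cli i = .busy pr sent acks) :
    ∃ acks', AckStep p (R.state n) i pr sent acks acks' ∧
      ((∃ sent', (R.state (n + 1)).cli i = .busy pr sent' acks') ∨
        (Enough p acks' ∧ (R.state (n + 1)).cli i = .advance p i acks' pr)) := by
  rcases h.cli hn hB i with e | ⟨j, hj, ev, e⟩ | ⟨j, hj, q, a, ev, hl, e⟩ | e
  · exact ⟨acks, fun k => Or.inl rfl, Or.inl ⟨sent, by rw [e.1, hc]⟩⟩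
  · exact ⟨acks, fun k => Or.inl rfl, Or.inl ⟨Function.update sent j true, by rw [e, hc]; rfl⟩⟩
  · refine ⟨_, ackStep_newAcks hl pr sent acks, ?_⟩
    rw [e, hc]
    rcases onReply_busy (p := p) i j q a pr sent acks with e' | e'
    · exact Or.inr e'
    · exact Or.inl ⟨sent, e'.2⟩
  · rw [hc] at e; simp at e

theorem Calm.idle (h : Calm R w B) {n : ℕ} (hn : w 0 ≤ n) (hB : n < B) {i : P}
    (hc : (R.state n).cli i = .idle) :
    (R.state (n + 1)).cli i = .idle ∨ (∃ s, (R.state (n + 1)).cli i = .enter (.wQuery s)) ∨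
      (R.state (n + 1)).cli i = .enter .rQuery := by
  rcases h.cli hn hB i with e | ⟨j, hj, ev, e⟩ | ⟨j, hj, q, a, ev, hl, e⟩ | e
  · left; rw [e.1, hc]
  · left; rw [e, hc]; rfl
  · left; rw [e, hc]; rfl
  · exact Or.inr e.2.2.2

/-- A client whose requests are answered ends its current quorum access within one cycle. -/
theorem Calm.progress (h : Calm R w B) {k : ℕ} (hB : w (k + 1) ≤ B) {i : P} (hi : i ∈ p.clients)
    {pr : Proc P V} {sent₀ : P → Bool} {acks₀ : P → Option (Ack P W)}
    (hc : (R.state (w k)).cli i = .busy pr sent₀ acks₀)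
    (ha : ∀ s, pr = .wQuery s → ∀ n, w k ≤ n → n < w (k + 1) → ∀ j ∈ p.servers,
      R.top n j ≤ (p.tTop : Tag P)) :
    ∃ n, w k ≤ n ∧ n < w (k + 1) ∧ ∃ sent acks acks', (R.state n).cli i = .busy pr sent acks ∧
      AckStep p (R.state n) i pr sent acks acks' ∧ Enough p acks' ∧
      (R.state (n + 1)).cli i = .advance p i acks' pr := by
  by_contra hno
  have hno' : ∀ n, w k ≤ n → n < w (k + 1) → ∀ sent acks acks',
      (R.state n).cli i = .busy pr sent acks → AckStep p (R.state n) i pr sent acks acks' →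
      Enough p acks' → (R.state (n + 1)).cli i ≠ .advance p i acks' pr :=
    fun n h1 h2 s a a' h3 h4 h5 h6 => hno ⟨n, h1, h2, s, a, a', h3, h4, h5, h6⟩
  clear hno
  have hk0 := h.le k
  -- the client stays in its access
  have hbusy : ∀ n, w k ≤ n → n ≤ w (k + 1) → ∃ sent acks, (R.state n).cli i = .busy pr sent acks := by
    intro n hn
    induction n, hn using Nat.le_induction with
    | base => exact fun _ => ⟨_, _, hc⟩
    | succ n hn ih =>
      intro hn'
      obtain ⟨sent, acks, e⟩ := ih (by omega)
      obtain ⟨acks', h1, h2 | h2⟩ := h.busy (hk0.trans hn) (by omega) e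
      · exact ⟨_, _, h2.choose_spec⟩
      · exact absurd h2.2 (hno' n hn (by omega) _ _ _ e h1 h2.1)
  -- no quorum has replied after the arrival of a reply
  have hJ : ∀ n, w k ≤ n → n < w (k + 1) → (∀ sent acks, (R.state n).cli i = .busy pr sent acks →
      ¬ Enough p acks) → ∀ sent acks, (R.state (n + 1)).cli i = .busy pr sent acks →
      ¬ Enough p acks := by
    intro n hn hn' hQ sent' acks' e'
    obtain ⟨sent, acks, e⟩ := hbusy n hn hn'.le
    rcases h.cli (hk0.trans hn) (by omega) i with f | ⟨j, hj, ev, f⟩ | ⟨j, hj, q, a, ev, hl, f⟩ | f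
    · rw [f.1] at e'; exact hQ _ _ e'
    · rw [f, e] at e'
      cases e'
      exact hQ _ _ e
    · rw [e] at f
      rcases onReply_busy (p := p) i j q a pr sent acks with g | g
      · exact absurd (f.trans g.2) (hno' n hn hn' _ _ _ e (ackStep_newAcks hl _ _ _) g.1)
      · rw [f, g.2] at e'
        cases e'
        exact g.1
    · rw [e] at f; simp at f
  have hJ0 : ∀ n, w k ≤ n → n < w (k + 1) → ∀ j, R.event n = .pongReceive i j →
      ∀ sent acks, (R.state (n + 1)).cli i = .busy pr sent acks → ¬ Enough p acks := by
    intro n hn hn' j hev sent' acks' e'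
    obtain ⟨sent, acks, e⟩ := hbusy n hn hn'.le
    rcases h.cli (hk0.trans hn) (by omega) i with f | ⟨j', hj, ev, f⟩ | ⟨j', hj, q, a, ev, hl, f⟩ | f
    · exact absurd hev (f.2.2 j)
    · rw [hev] at ev; simp at ev
    · rw [e] at f
      rcases onReply_busy (p := p) i j' q a pr sent acks with g | g
      · exact absurd (f.trans g.2) (hno' n hn hn' _ _ _ e (ackStep_newAcks hl _ _ _) g.1)
      · rw [f, g.2] at e'
        cases e'
        exact g.1
    · rw [e] at f; simp at f
  -- every server replies
  let I : P → ℕ → Prop := fun j n => ∃ sent acks, (R.state n).cli i = .busy pr sent acks ∧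
    sent j = true ∧ ((acks j).isSome ∨ (R.state n).ping i j = .request (some (pr.req p j)) ∨
      (∃ a, (R.state n).ping i j = .atServer (some (pr.req p j)) (some a)) ∨
      ∃ a, (R.state n).ping i j = .response (some (pr.req p j)) (some a))
  have hI : ∀ j ∈ p.servers, ∀ n, w k ≤ n → n < w (k + 1) → I j n → I j (n + 1) ∧
      (R.event n = .pongReceive i j → ∃ sent acks, (R.state (n + 1)).cli i = .busy pr sent acks ∧
        sent j = true ∧ (acks j).isSome) := by
    rintro j hj n hn hn' ⟨sent, acks, e, hs, hd⟩
    have hl : ∀ x, (R.state (n + 1)).ping i j = x → (R.event n ≠ .pongReceive i j) →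
        ((acks j).isSome ∨ x = .request (some (pr.req p j)) ∨
          (∃ a, x = .atServer (some (pr.req p j)) (some a)) ∨
          ∃ a, x = .response (some (pr.req p j)) (some a)) := by
      rintro x rfl hne
      rcases hd with hd | hd
      · exact Or.inl hd
      right
      rcases h.ping (hk0.trans hn) (by omega) i j with
        f | f | f | ⟨r, a, a', f⟩ | ⟨q, a, f⟩ | ⟨q, a, f⟩
      · rw [f.1]; exact hd
      · rw [f.2.1] at hd; simp at hd
      · rw [f.2.1] at hd; simp at hd
      · obtain ⟨-, f1, f2, f3, -, f4⟩ := f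
        rw [f1] at hd
        obtain rfl : r = pr.req p j := by simpa using hd
        have hne' : a ≠ none := by
          refine f2.ne_none fun hq => ?_
          obtain ⟨s, rfl⟩ : ∃ s, pr = .wQuery s := by
            cases pr <;> simp [Proc.req] at hq ⊢
          exact ha s rfl n hn hn' j hj
        obtain ⟨b, rfl⟩ := Option.ne_none_iff_exists'.1 hne'
        rcases a' with _ | b'
        · simp at f3
        · exact Or.inr (Or.inl ⟨b', f4⟩)
      · rw [f.2.1] at hd
        rw [f.2.2]
        simp only [reduceCtorEq, PingLink.atServer.injEq, false_or, exists_false, or_false] at hd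
        obtain ⟨b, rfl, rfl⟩ := hd
        exact Or.inr (Or.inr ⟨b, rfl⟩)
      · exact absurd f.1 hne
    rcases h.cli (hk0.trans hn) (by omega) i with f | ⟨j', hj', ev, f⟩ | ⟨j', hj', q, a, ev, hl', f⟩ | f
    · exact ⟨⟨sent, acks, by rw [f.1, e], hs, hl _ rfl (f.2.2 j)⟩, fun hev => absurd hev (f.2.2 j)⟩
    · refine ⟨⟨_, acks, by rw [f, e]; rfl, ?_, hl _ rfl (by simp [ev])⟩, fun hev => ?_⟩
      · by_cases e' : j = j'
        · subst e'; simp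
        · rw [Function.update_of_ne e']; exact hs
      · rw [ev] at hev; simp at hev
    · rw [e] at f
      rcases onReply_busy (p := p) i j' q a pr sent acks with g | g
      · exact absurd (f.trans g.2) (hno' n hn hn' _ _ _ e (ackStep_newAcks hl' _ _ _) g.1)
      · rw [g.2] at f
        by_cases e' : j = j'
        · subst e'
          have hsome : (newAcks p j q a pr sent acks j).isSome := by
            unfold newAcks
            split_ifs with hc
            · simpa using hc.2.2
            · rcases hd with hd | hd
              · exact hd
              · rw [hl'] at hd
                simp only [reduceCtorEq, PingLink.response.injEq, false_or, exists_false] at hd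
                obtain ⟨b, rfl, rfl⟩ := hd
                exact absurd ⟨hs, rfl, rfl⟩ hc
          exact ⟨⟨sent, _, f, hs, Or.inl hsome⟩, fun _ => ⟨sent, _, f, hs, hsome⟩⟩
        · refine ⟨⟨sent, _, f, hs, ?_⟩, fun hev => ?_⟩
          · have : newAcks p j' q a pr sent acks j = acks j := by
              unfold newAcks
              split_ifs
              · rw [Function.update_of_ne e']
              · rfl
            rw [this]
            refine hl _ rfl fun hev => e' ?_
            rw [hev] at ev
            simpa using ev
          · rw [hev] at ev
            exact absurd (by simpa using ev) e'
    · rw [e] at f; simp at f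
  have hI2 : ∀ j ∈ p.servers, ∀ n m, w k ≤ n → n ≤ m → m ≤ w (k + 1) → I j n → I j m := by
    intro j hj n m hn hnm
    induction m, hnm using Nat.le_induction with
    | base => exact fun _ => id
    | succ m hnm ih => exact fun hm hI0 => (hI j hj m (by omega) (by omega) (ih (by omega) hI0)).1
  have hacks : ∀ j ∈ p.servers, ∀ n, w k ≤ n → n ≤ w (k + 1) → ∀ m, n ≤ m → m ≤ w (k + 1) →
      (∀ sent acks, (R.state n).cli i = .busy pr sent acks → (acks j).isSome) →
      ∀ sent acks, (R.state m).cli i = .busy pr sent acks → (acks j).isSome := by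
    intro j hj n hn hn' m hnm
    induction m, hnm using Nat.le_induction with
    | base => exact fun _ => id
    | succ m hnm ih =>
      intro hm hQ sent' acks' e'
      obtain ⟨sent, acks, e⟩ := hbusy m (by omega) (by omega)
      have := ih (by omega) hQ sent acks e
      obtain ⟨acks'', h1, h2 | h2⟩ := h.busy (hk0.trans (hn.trans hnm)) (by omega) e
      · obtain ⟨s, h2⟩ := h2
        rw [h2] at e'
        cases e'
        rcases h1 j with h1 | ⟨-, b, -, h1⟩
        · rwa [h1]
        · simp [h1]
      · exact absurd h2.2 (hno' m (by omega) (by omega) _ _ _ e h1 h2.1)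
  -- The round trip with `j` in this cycle sends the current request at `b₁`, and at `b₄` the
  -- acknowledgment of `j` is certainly recorded; it is kept as long as the access lasts.
  have hend : ∀ j ∈ p.servers, ∀ sent acks, (R.state (w (k + 1))).cli i = .busy pr sent acks →
      (acks j).isSome := by
    intro j hj
    obtain ⟨b₁, b₂, b₃, b₄, h1, h2, h3, h4, h5, e1, e2, e3, e4⟩ := (h.cycle k).2 i hi j hj
    have hI1 : I j (b₁ + 1) := by
      obtain ⟨sent, acks, e⟩ := hbusy b₁ (by omega) (by omega)
      rcases h.cli (hk0.trans h1) (by omega) i with f | ⟨j', hj', ev, f⟩ | ⟨j', hj', q, a, ev, hl', f⟩ | f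
      · exact absurd e1 (f.2.1 j)
      · rw [e1] at ev
        obtain rfl : j = j' := by simpa using ev
        refine ⟨_, _, by rw [f, e]; rfl, by simp, ?_⟩
        rcases h.ping (hk0.trans h1) (by omega) i j with
          g | g | g | ⟨r, a, a', g⟩ | ⟨q, a, g⟩ | ⟨q, a, g⟩
        · exact absurd e1 g.2.1
        · right; left
          rw [g.2.2, e]; rfl
        all_goals rw [e1] at g; simp at g
      · rw [e1] at ev; simp at ev
      · rw [e] at f; simp at f
    obtain ⟨sent, acks, f1, -, f2⟩ := (hI j hj b₄ (by omega) h5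
      (hI2 j hj (b₁ + 1) b₄ (by omega) (by omega) (by omega) hI1)).2 e4
    refine hacks j hj (b₄ + 1) (by omega) (by omega) _ (by omega) le_rfl ?_
    intro s' a' g
    rw [f1] at g
    cases g
    exact f2
  -- Acknowledgments are counted only when a reply arrives, and an arbitrary initial state may
  -- already hold a quorum of them. The claim therefore starts after the arrival `b₄`.
  have hnot : ∀ sent acks, (R.state (w (k + 1))).cli i = .busy pr sent acks → ¬ Enough p acks := by
    obtain ⟨j, hj⟩ := p.servers_nonempty
    obtain ⟨b₁, b₂, b₃, b₄, h1, h2, h3, h4, h5, e1, e2, e3, e4⟩ := (h.cycle k).2 i hi j hj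
    have h0 := hJ0 b₄ (by omega) h5 j e4
    have : ∀ m, b₄ + 1 ≤ m → m ≤ w (k + 1) → ∀ sent acks,
        (R.state m).cli i = .busy pr sent acks → ¬ Enough p acks := by
      intro m hm
      induction m, hm using Nat.le_induction with
      | base => exact fun _ => h0
      | succ m hm ih => exact fun hm' => hJ m (by omega) (by omega) (ih (by omega))
    exact this _ (by omega) le_rfl
  obtain ⟨sent, acks, e⟩ := hbusy (w (k + 1)) (h.mono (by omega)) le_rfl
  exact hnot _ _ e (enough_of_forall fun j hj => hend j hj _ _ e)

/-- A request of a quorum access that begins in a calm segment arrives at some server by the end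
of the next cycle. -/
theorem Calm.delivery (h : Calm R w B) {k e : ℕ} (he : w 0 ≤ e) (hek : e ≤ w k)
    (hB : w (k + 1) ≤ B) {i : P} (hi : i ∈ p.clients) {pr : Proc P V}
    (hc : (R.state e).cli i = .enter pr) {t : Tag P} (ht : t ∈ pr.tags) :
    ∃ j ∈ p.servers, t ≤ R.top (w (k + 1)) j := by
  by_contra hno
  push Not at hno
  have hno' : ∀ n, e ≤ n → n < w (k + 1) → ∀ j ∈ p.servers, R.event n = .pingReceive i j →
      (R.state n).ping i j ≠ .request (some (pr.req p j)) := by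
    intro n hn hn' j hj hev hl
    refine absurd ?_ (not_le_of_gt (hno j hj))
    refine le_trans ?_ (h.top_mono (n := n + 1) (by omega) (by omega) hB hj)
    rcases h.ping (he.trans hn) (by omega) i j with
      g | g | g | ⟨r, a, a', g⟩ | ⟨q, a, g⟩ | ⟨q, a, g⟩
    · exact absurd hev g.2.2.1
    · rw [hev] at g; simp at g
    · rw [hl] at g; simp at g
    · obtain ⟨-, g1, -, -, g2, -⟩ := g
      rw [hl] at g1
      obtain rfl : pr.req p j = r := by simpa using g1
      rw [Execution.top, g2]
      exact Req.tags_le_storeAfter _ (by rwa [Proc.tags_req])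
    · rw [hev] at g; simp at g
    · rw [hev] at g; simp at g
  -- If no request of the access is ever received, each sent one stays in transit, nothing is
  -- acknowledged, and the client cannot leave the access.
  have hD : ∀ n, e ≤ n → n ≤ w (k + 1) → ∃ sent acks, (R.state n).cli i = .busy pr sent acks ∧
      ∀ j ∈ p.servers, acks j = none ∧ (sent j = true →
        (R.state n).ping i j = .request (some (pr.req p j))) := by
    intro n hn
    induction n, hn using Nat.le_induction with
    | base => exact fun _ => ⟨_, _, hc, fun j hj => ⟨rfl, by simp⟩⟩
    | succ n hn ih =>
      intro hn'
      obtain ⟨sent, acks, e0, hd⟩ := ih (by omega)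
      have hl : ∀ j ∈ p.servers, R.event n ≠ .pingSend i j → sent j = true →
          (R.state (n + 1)).ping i j = .request (some (pr.req p j)) := by
        intro j hj hev hs
        have hr := (hd j hj).2 hs
        rcases h.ping (he.trans hn) (by omega) i j with
          g | g | g | ⟨r, a, a', g⟩ | ⟨q, a, g⟩ | ⟨q, a, g⟩
        · rw [g.1, hr]
        · exact absurd g.1 hev
        · rw [hr] at g; simp at g
        · exact absurd hr (hno' n hn (by omega) j hj g.1)
        · rw [hr] at g; simp at g
        · rw [hr] at g; simp at g
      rcases h.cli (he.trans hn) (by omega) i with f | ⟨j', hj', ev, f⟩ | ⟨j', hj', q, a, ev, hl', f⟩ | f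
      · exact ⟨sent, acks, by rw [f.1, e0], fun j hj => ⟨(hd j hj).1, hl j hj (f.2.1 j)⟩⟩
      · refine ⟨_, acks, by rw [f, e0]; rfl, fun j hj => ⟨(hd j hj).1, fun hs => ?_⟩⟩
        by_cases e' : j = j'
        · subst e'
          rcases h.ping (he.trans hn) (by omega) i j with
            g | g | g | ⟨r, a, a', g⟩ | ⟨q, a, g⟩ | ⟨q, a, g⟩
          · exact absurd ev g.2.1
          · rw [g.2.2, e0]; rfl
          all_goals rw [ev] at g; simp at g
        · rw [Function.update_of_ne e'] at hs
          refine hl j hj (fun hev => e' ?_) hs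
          rw [hev] at ev
          simpa using ev
      · have hs : sent j' ≠ true := fun hs => by
          have := (hd j' hj').2 hs
          rw [hl'] at this
          simp at this
        have hna : newAcks p j' q a pr sent acks = acks := by
          unfold newAcks
          rw [if_neg fun hc => hs hc.1]
        refine ⟨sent, acks, ?_, fun j hj => ⟨(hd j hj).1, hl j hj (by simp [ev])⟩⟩
        rw [e0] at f
        rcases onReply_busy (p := p) i j' q a pr sent acks with g | g
        · rw [hna] at g
          obtain ⟨l, hl, b, hb⟩ := g.1.exists
          rw [(hd l hl).1] at hb
          simp at hb
        · rw [f, g.2, hna]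
      · rw [e0] at f; simp at f
  obtain ⟨j, hj⟩ := p.servers_nonempty
  obtain ⟨b₁, b₂, b₃, b₄, h1, h2, h3, h4, h5, e1, e2, e3, e4⟩ := (h.cycle k).2 i hi j hj
  -- The token that leaves at `b₁` carries the request and would still carry it at the reception
  -- `b₂`, contrary to the assumption.
  have hS : ∀ n, b₁ + 1 ≤ n → n ≤ w (k + 1) → (R.state n).ping i j = .request (some (pr.req p j)) := by
    intro n hn
    induction n, hn using Nat.le_induction with
    | base =>
      intro hn
      obtain ⟨sent, acks, e0, hd⟩ := hD b₁ (by omega) (by omega)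
      rcases h.ping (n := b₁) (by omega) (by omega) i j with
        g | g | g | ⟨r, a, a', g⟩ | ⟨q, a, g⟩ | ⟨q, a, g⟩
      · exact absurd e1 g.2.1
      · rw [g.2.2, e0]; rfl
      all_goals rw [e1] at g; simp at g
    | succ n hn ih =>
      intro hn'
      have hr := ih (by omega)
      rcases h.ping (n := n) (by omega) (by omega) i j with
        g | g | g | ⟨r, a, a', g⟩ | ⟨q, a, g⟩ | ⟨q, a, g⟩
      · rw [g.1, hr]
      · rw [hr] at g; simp at g
      · rw [hr] at g; simp at g
      · exact absurd hr (hno' n (by omega) (by omega) j hj g.1)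
      · rw [hr] at g; simp at g
      · rw [hr] at g; simp at g
  exact hno' b₂ (by omega) (by omega) j hj e2 (hS b₂ (by omega) (by omega))

end ClientLemmas

/-! ### Progress of clients through their accesses, and the disappearance of large tags -/

section OverflowLemmas

variable {P W V : Type*} [Fintype P] [LinearOrder P] [Nonempty P] [DecidableEq W]
variable {p : Setup P W V} {R : Execution p} {w : ℕ → ℕ} {B : ℕ}

theorem Client.advance_cases (p : Setup P W V) (i : P) (acks : P → Option (Ack P W))
    (pr : Proc P V) : Client.advance p i acks pr = .idle ∨
      ∃ pr', Client.advance p i acks pr = .enter pr' := by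
  cases pr <;> simp [Client.advance]

/-- A client that is not idle ends its access within the cycle by `Calm.progress`. Only a writer's
query can block, and `hq` covers it: either the property is already known, or the servers do answer.
-/
theorem After.of_advance {k : ℕ} (h : Calm R w B) {i : P} (hi : i ∈ p.clients) {Q : ℕ → Prop}
    (hp : ∀ n, w k ≤ n → n < B → Q n → Q (n + 1))
    (hidle : (R.state (w k)).cli i = .idle → Q (w k))
    (hq : w (k + 1) ≤ B → ∀ s sent acks, (R.state (w k)).cli i = .busy (.wQuery s) sent acks →
      Q (w k) ∨ ∀ n, w k ≤ n → n < w (k + 1) → ∀ j ∈ p.servers, R.top n j ≤ (p.tTop : Tag P))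
    (he : ∀ pr sent₀ acks₀, (R.state (w k)).cli i = .busy pr sent₀ acks₀ →
      ∀ n, w k ≤ n → n < B → ∀ sent acks acks',
      (R.state n).cli i = .busy pr sent acks → AckStep p (R.state n) i pr sent acks acks' →
      Enough p acks' → (R.state (n + 1)).cli i = .advance p i acks' pr → Q (n + 1)) :
    After w B (k + 1) Q := by
  refine After.of_cycle hp fun hB => ?_
  have hlt := (h.cycle k).lt
  rcases hc : (R.state (w k)).cli i with _ | ⟨pr, sent, acks⟩
  · exact ⟨w k, le_rfl, hlt.le, hidle hc⟩
  · by_cases hQ : Q (w k)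
    · exact ⟨w k, le_rfl, hlt.le, hQ⟩
    · obtain ⟨n, h1, h2, s, a, a', h3, h4, h5, h6⟩ := h.progress hB hi hc fun s hs => by
        subst hs
        exact (hq hB s sent acks hc).resolve_left hQ
      exact ⟨n + 1, by omega, by omega, he pr _ _ hc n h1 (by omega) s a a' h3 h4 h5 h6⟩

/-- How a client changes in a step of a calm segment. -/
theorem Calm.cli_cases (h : Calm R w B) {n : ℕ} (hn : w 0 ≤ n) (hB : n < B) {i : P}
    {pr : Proc P V} {sent : P → Bool} {acks : P → Option (Ack P W)}
    (hc : (R.state (n + 1)).cli i = .busy pr sent acks) :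
    (∃ sent₀ acks₀, (R.state n).cli i = .busy pr sent₀ acks₀ ∧
      AckStep p (R.state n) i pr sent₀ acks₀ acks) ∨
    (R.state (n + 1)).cli i = .enter pr ∧
      (((R.state n).cli i = .idle ∧ ((∃ s, pr = .wQuery s) ∨ pr = .rQuery)) ∨
      ∃ pr₀ sent₀ acks₀ acks', (R.state n).cli i = .busy pr₀ sent₀ acks₀ ∧
        AckStep p (R.state n) i pr₀ sent₀ acks₀ acks' ∧ Enough p acks' ∧
        Client.advance p i acks' pr₀ = .enter pr) := by
  rcases hc0 : (R.state n).cli i with _ | ⟨pr₀, sent₀, acks₀⟩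
  · rcases h.idle hn hB hc0 with e | ⟨s, e⟩ | e
    · rw [e] at hc; simp at hc
    · rw [e] at hc
      cases hc
      exact Or.inr ⟨e, Or.inl ⟨rfl, Or.inl ⟨s, rfl⟩⟩⟩
    · rw [e] at hc
      cases hc
      exact Or.inr ⟨e, Or.inl ⟨rfl, Or.inr rfl⟩⟩
  · obtain ⟨acks', h1, ⟨s, e⟩ | ⟨h2, e⟩⟩ := h.busy hn hB hc0
    · rw [e] at hc
      cases hc
      exact Or.inl ⟨_, _, rfl, h1⟩
    · right
      rcases Client.advance_cases p i acks' pr₀ with e' | ⟨pr', e'⟩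
      · rw [e, e'] at hc; simp at hc
      · have e2 := e.trans e'
        rw [e2] at hc
        cases hc
        exact ⟨e2, Or.inr ⟨_, _, _, _, rfl, h1, h2, e'⟩⟩

theorem Client.enter_acks {pr pr' : Proc P V} {sent : P → Bool} {acks : P → Option (Ack P W)}
    (h : (Client.enter pr : Client P W V) = .busy pr' sent acks) (k : P) : acks k = none := by
  cases h; rfl

/-- If no server stores a large tag for several cycles, then all large tags vanish. -/
theorem Calm.overflowFree (h : Calm R w B) (hB : w 5 ≤ B)
    (htop : ∀ n, w 0 ≤ n → n ≤ B → ∀ j ∈ p.servers, R.top n j < (p.tTop : Tag P)) :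
    (R.state (w 4)).OverflowFree p := by
  have h45 : w 4 ≤ w 5 := h.mono (by omega)
  -- After one cycle a server's own `pre` entry dominates its buffers and is itself at most the
  -- stored maximum.
  have hS : ∀ n, w 1 ≤ n → n ≤ B → ∀ j ∈ p.servers,
      (∀ k ∈ p.servers, ∀ t ∈ (R.rx n j k).tags, t < (p.tTop : Tag P)) ∧
      ∀ t ∈ (R.tx n j).tags, t < (p.tTop : Tag P) := by
    intro n hn hn' j hj
    have hs := h.settled n hn hn' j hj
    have ht := hs.pre_le.trans_lt (htop n ((h.le 1).trans hn) hn' j hj)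
    constructor
    · rintro k hk t (rfl | rfl | rfl)
      exacts [(hs.le_pre k hk).1.trans_lt ht, (hs.le_pre k hk).2.1.trans_lt ht,
        (hs.le_pre k hk).2.2.trans_lt ht]
    · rintro t (rfl | rfl | rfl)
      exacts [hs.tx_pre.trans_lt ht, (hs.tx_fin.trans_le hs.fin_le_pre).trans_lt ht,
        (hs.tx_FIN.trans hs.fin_le_pre).trans_lt ht]
  -- replies
  have hL : ∀ i ∈ p.clients, ∀ j ∈ p.servers, After w B 1 fun n => ∀ q a,
      ((R.state n).ping i j = .atServer q a ∨ (R.state n).ping i j = .response q a) →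
      ∀ t ∈ payloadTags q a, t < (p.tTop : Tag P) := by
    intro i hi j hj
    have key : ∀ n, w 0 ≤ n → n < B → ∀ q a, (R.state (n + 1)).ping i j = .atServer q a →
        (R.state n).ping i j ≠ .atServer q a → ∀ t ∈ payloadTags q a, t < (p.tTop : Tag P) := by
      intro n hn hn' q a hl hl'
      rcases h.ping hn hn' i j with
        g | g | g | ⟨r, b, b', g⟩ | ⟨q, b, g⟩ | ⟨q, b, g⟩
      · exact absurd (g.1.symm.trans hl) hl'
      · rw [hl] at g; simp at g
      · rw [hl] at g
        obtain ⟨-, -, g⟩ := g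
        cases g
        rintro t (⟨r, hr, -⟩ | ⟨r, hr, -⟩) <;> simp at hr
      · obtain ⟨-, -, g1, g2, g3, g4⟩ := g
        rw [hl] at g4
        cases g4
        have ht := htop (n + 1) (by omega) hn' j hj
        rw [Execution.top, g3] at ht
        rintro t (⟨r', hr, hr'⟩ | ⟨c, rfl, rfl⟩)
        · cases hr
          exact (Req.tags_le_storeAfter _ hr').trans_lt ht
        · rcases b with _ | b
          · simp at g2
          · have g2' : c.tag = b.tag := by simpa using g2
            rw [g2']
            exact g1.tag_le.trans_lt ht
      · rw [hl] at g; simp at g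
      · rw [hl] at g; simp at g
    refine After.of_atClient h hi hj (k := 0) (fun n hn hn' hQ q a hl => ?_) ?_
    · rcases hl with hl | hl
      · by_cases e : (R.state n).ping i j = .atServer q a
        · exact hQ q a (Or.inl e)
        · exact key n hn hn' q a hl e
      · rcases h.ping hn hn' i j with
          g | g | g | ⟨r, b, b', g⟩ | ⟨q, b, g⟩ | ⟨q, b, g⟩
        · exact hQ q a (Or.inr (g.1.symm.trans hl))
        · rw [hl] at g; simp at g
        · rw [hl] at g; simp at g
        · rw [hl] at g; simp at g
        · rw [hl] at g
          obtain ⟨-, g1, g2⟩ := g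
          cases g2
          exact hQ q a (Or.inl g1)
        · rw [hl] at g; simp at g
    · intro n hn hn' e q a hl
      rw [e] at hl; simp at hl
  -- collected acknowledgments
  have hA : ∀ i ∈ p.clients, After w B 2 fun n => ∀ pr sent acks,
      (R.state n).cli i = .busy pr sent acks → ∀ k ∈ p.servers, ∀ a, acks k = some a →
      a.tag < (p.tTop : Tag P) := by
    intro i hi
    refine After.of_advance h hi (k := 1) (fun n hn hn' hQ pr sent acks hc k hk a ha => ?_) ?_ ?_ ?_
    · rcases h.cli_cases ((h.le 1).trans hn) hn' hc with ⟨s₀, a₀, h1, h2⟩ | ⟨h1, -⟩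
      · rcases h2 k with h3 | ⟨-, b, h3, h4⟩
        · exact hQ _ _ _ h1 k hk a (by rw [← h3, ha])
        · rw [ha] at h4
          cases h4
          exact hL i hi k hk n hn hn'.le _ _ (Or.inr h3) _ (Or.inr ⟨_, rfl, rfl⟩)
      · rw [h1] at hc
        rw [Client.enter_acks hc k] at ha
        simp at ha
    · intro e pr sent acks hc
      rw [e] at hc; simp at hc
    · intro hB' s sent acks hc
      exact Or.inr fun n hn hn' j hj => (htop n ((h.le 1).trans hn) (by omega) j hj).le
    · intro _ _ _ _ n hn hn' s a a' h3 h4 h5 h6 pr' sent' acks' hc k hk b hb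
      rcases Client.advance_cases p i a' _ with e | ⟨pr'', e⟩
      · rw [h6, e] at hc; simp at hc
      · rw [h6, e] at hc
        rw [Client.enter_acks hc k] at hb
        simp at hb
  -- Tags of client procedures are bounded by looking ahead to their delivery in the next cycle.
  -- Hence the segment is cut at `w 4`, while the stores are known to be small up to `w 5`.
  have h' := h.restrict (h45.trans hB)
  -- client procedures
  have hE : ∀ i ∈ p.clients, ∀ n, w 0 ≤ n → n ≤ w 4 → ∀ pr, (R.state n).cli i = .enter pr →
      ∀ t ∈ pr.tags, t < (p.tTop : Tag P) := by
    intro i hi n hn hn' pr hc t ht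
    obtain ⟨j, hj, hle⟩ := h.delivery hn hn' hB hi hc ht
    exact hle.trans_lt (htop _ (h.le 5) hB j hj)
  have hC : ∀ i ∈ p.clients, After w (w 4) 3 fun n => ∀ pr sent acks,
      (R.state n).cli i = .busy pr sent acks → ∀ t ∈ pr.tags, t < (p.tTop : Tag P) := by
    intro i hi
    refine After.of_advance h' hi (k := 2) (fun n hn hn' hQ pr sent acks hc => ?_) ?_ ?_ ?_
    · have hn0 := (h.le 2).trans hn
      rcases h'.cli_cases hn0 hn' hc with ⟨s₀, a₀, h1, h2⟩ | ⟨h1, -⟩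
      · exact hQ _ _ _ h1
      · exact hE i hi (n + 1) (by omega) hn' pr h1
    · intro e pr sent acks hc
      rw [e] at hc; simp at hc
    · intro hB' s sent acks hc
      exact Or.inr fun n hn hn' j hj => (htop n ((h.le 2).trans hn) (by omega) j hj).le
    · intro _ _ _ _ n hn hn' s a a' h3 h4 h5 h6 pr' sent' acks' hc
      have hn0 := (h.le 2).trans hn
      rcases Client.advance_cases p i a' _ with e | ⟨pr'', e⟩
      · rw [h6, e] at hc; simp at hc
      · rw [h6, e] at hc
        cases hc
        exact hE i hi (n + 1) (by omega) hn' _ (h6.trans e)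
  -- requests
  have hQ : ∀ i ∈ p.clients, ∀ j ∈ p.servers, After w (w 4) 4 fun n => ∀ r,
      (R.state n).ping i j = .request (some r) → ∀ t ∈ r.tags, t < (p.tTop : Tag P) := by
    intro i hi j hj
    refine After.of_atClient h' hi hj (k := 3) (fun n hn hn' hQ r hl => ?_) ?_
    · rcases h'.ping ((h.le 3).trans hn) hn' i j with
        g | g | g | ⟨r, b, b', g⟩ | ⟨q, b, g⟩ | ⟨q, b, g⟩
      · exact hQ r (g.1.symm.trans hl)
      · rw [g.2.2] at hl
        rcases hc : (R.state n).cli i with _ | ⟨pr, sent, acks⟩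
        · rw [hc] at hl; simp [Client.outgoing] at hl
        · rw [hc] at hl
          obtain rfl : pr.req p j = r := by simpa [Client.outgoing] using hl
          rw [Proc.tags_req]
          exact hC i hi n hn hn'.le _ _ _ hc
      all_goals rw [hl] at g; simp at g
    · intro n hn hn' e r hl
      rw [e] at hl; simp at hl
  have hle : ∀ k ≤ 4, w k ≤ w 4 := fun k hk => h.mono hk
  rintro t (⟨i, hi, (⟨r, hr, rfl⟩ | ⟨k, hk, ht⟩) | ht⟩ | ⟨i, hi, ht⟩ | ⟨i, hi, j, hj, hij, ht⟩ |
    ⟨i, hi, j, hj, ht⟩)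
  · refine lt_of_le_of_lt ?_ (htop (w 4) (h.le 4) (by omega) i hi)
    exact HasTag.le_maxPhase ⟨r, hr, by simp, rfl⟩
  · exact (hS (w 4) (hle 1 (by omega)) (by omega) i hi).1 k hk t ht
  · exact (hS (w 4) (hle 1 (by omega)) (by omega) i hi).2 t ht
  · rcases hc : (R.state (w 4)).cli i with _ | ⟨pr, sent, acks⟩
    · rw [hc] at ht; exact ht.elim
    · rw [hc] at ht
      rcases ht with ht | ⟨k, hk, a, ha, rfl⟩
      · exact hC i hi (w 4) (hle 3 (by omega)) le_rfl _ _ _ hc t ht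
      · exact hA i hi (w 4) (hle 2 (by omega)) (by omega) _ _ _ hc k hk a ha
  · have hg := h.after_gossip (k := 1) hi hj hij
      (Φ := fun _ m => ∀ t ∈ m.tags, t < (p.tTop : Tag P)) (fun _ _ _ _ => id)
      (fun n hn hn' => (hS n hn hn' i hi).2) (w 4) (hle 2 (by omega)) (by omega)
    rcases hl : (R.state (w 4)).gossip i j with _ | m
    · rw [hl] at ht; exact ht.elim
    · rw [hl] at ht
      obtain ⟨m', rfl, ht⟩ := ht
      exact hg m' hl t ht
  · rcases hl : (R.state (w 4)).ping i j with _ | q | ⟨q, a⟩ | ⟨q, a⟩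
    · rw [hl] at ht; exact ht.elim
    · rw [hl] at ht
      rcases ht with ⟨r, rfl, ht⟩ | ⟨b, hb, -⟩
      · exact hQ i hi j hj (w 4) le_rfl le_rfl r hl t ht
      · simp at hb
    · rw [hl] at ht
      exact hL i hi j hj (w 4) (hle 1 (by omega)) (by omega) q a (Or.inl hl) t ht
    · rw [hl] at ht
      exact hL i hi j hj (w 4) (hle 1 (by omega)) (by omega) q a (Or.inr hl) t ht

/-! ### No new tags -/

/-- No writer moves on from its query in the steps `w 0, …, B - 1`. -/
def Quiet (R : Execution p) (w : ℕ → ℕ) (B : ℕ) : Prop :=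
  ∀ n, w 0 ≤ n → n < B → ∀ i ∈ p.clients, ∀ s sent acks,
    (R.state n).cli i = .busy (.wQuery s) sent acks →
    ∀ acks', AckStep p (R.state n) i (.wQuery s) sent acks acks' → Enough p acks' →
    (R.state (n + 1)).cli i ≠ .advance p i acks' (.wQuery s)

/-- A property of the replies to queries of writers holds on a link after one cycle. -/
theorem Calm.after_reply (h : Calm R w B) {q : Req P W} {Φ : ℕ → Option (Ack P W) → Prop} {k : ℕ}
    {i j : P} (hi : i ∈ p.clients) (hj : j ∈ p.servers)
    (hΦ : ∀ n, w k ≤ n → n < B → ∀ a, Φ n a → Φ (n + 1) a)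
    (hr : ∀ n, w k ≤ n → n < B → ∀ a a', Replies p (storeAfter ((R.state n).srv j).store q) q a →
      a'.map Ack.tag = a.map Ack.tag →
      ((R.state (n + 1)).srv j).store = storeAfter ((R.state n).srv j).store q → Φ (n + 1) a') :
    After w B (k + 1) fun n => ∀ a, ((R.state n).ping i j = .atServer (some q) a ∨
      (R.state n).ping i j = .response (some q) a) → Φ n a := by
  refine After.of_atClient h hi hj (fun n hn hn' hQ a hl => ?_) ?_
  · rcases h.ping ((h.le k).trans hn) hn' i j with
      g | g | g | ⟨r, b, b', g⟩ | ⟨q, b, g⟩ | ⟨q, b, g⟩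
    · rw [g.1] at hl
      exact hΦ n hn hn' a (hQ a hl)
    · rw [g.2.2] at hl; simp at hl
    · rw [g.2.2] at hl; simp at hl
    · obtain ⟨-, -, g1, g2, g3, g4⟩ := g
      rw [g4] at hl
      simp only [PingLink.atServer.injEq, Option.some.injEq, reduceCtorEq, or_false] at hl
      obtain ⟨rfl, rfl⟩ := hl
      exact hr n hn hn' b b' g1 g2 g3
    · rw [g.2.2] at hl
      simp only [PingLink.response.injEq, reduceCtorEq, false_or] at hl
      obtain ⟨rfl, rfl⟩ := hl
      exact hΦ n hn hn' _ (hQ _ (Or.inl g.2.1))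
    · rw [g.2.2] at hl; simp at hl
  · intro n hn hn' e a hl
    rw [e] at hl; simp at hl

/-- The integer component becomes larger than `MAXINT`, so the identifier of the writer does not
matter. -/
theorem Setup.tTop_lt_nextStamp (p : Setup P W V) (i : P) {t : Tag P} (ht : (p.tTop : Tag P) ≤ t) :
    p.tTop < nextStamp i t := by
  induction t using WithBot.recBotCoe with
  | bot => exact absurd ht (by simp)
  | coe t =>
    rw [WithBot.coe_le_coe] at ht
    have h1 : p.maxInt ≤ (ofLex t).1 := Prod.Lex.monotone_fst_ofLex ht
    refine Prod.Lex.toLex_lt_toLex.2 (Or.inl ?_)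
    exact lt_of_le_of_lt h1 (PNat.lt_add_right _ _)

/-- A writer that moves on has an acknowledgment of at least `t_top`, hence a new tag above `t_top`,
and its pre-write reaches a store whose maximum is `t_top`. The shift by 2 flushes old replies on
the links and old acknowledgments at the clients; stopping at `w c` leaves one cycle for the
delivery. -/
theorem Calm.quiet_of_eq (h : Calm R w B) {c : ℕ} (hB : w (c + 1) ≤ B)
    (htop : ∀ n, w 0 ≤ n → n ≤ B → ∀ j ∈ p.servers, R.top n j = (p.tTop : Tag P)) :
    Quiet R (fun k => w (k + 2)) (w c) := by
  have hL : ∀ i ∈ p.clients, ∀ j ∈ p.servers, _ := fun i hi j hj =>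
    h.after_reply (k := 0) (q := .query false) hi hj
      (Φ := fun _ a => ∀ b, a = some b → (p.tTop : Tag P) ≤ b.tag) (fun _ _ _ _ => id)
      (by
        rintro n hn hn' a a' hr hm - b rfl
        rcases a with _ | a
        · simp at hm
        · have hm' : b.tag = a.tag := by simpa using hm
          rw [hm', hr.writer_tag.1]
          exact (htop n hn hn'.le j hj).ge)
  have hA : ∀ i ∈ p.clients, After w B 2 fun n => ∀ s sent acks,
      (R.state n).cli i = .busy (.wQuery s) sent acks → ∀ k ∈ p.servers, ∀ a, acks k = some a →
      (p.tTop : Tag P) ≤ a.tag := by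
    intro i hi
    refine After.of_advance h hi (k := 1) (fun n hn hn' hQ s sent acks hc k hk a ha => ?_) ?_ ?_ ?_
    · rcases h.cli_cases ((h.le 1).trans hn) hn' hc with ⟨s₀, a₀, h1, h2⟩ | ⟨h1, -⟩
      · rcases h2 k with h3 | ⟨-, b, h3, h4⟩
        · exact hQ _ _ _ h1 k hk a (by rw [← h3, ha])
        · rw [ha] at h4
          cases h4
          exact hL i hi k hk n hn hn'.le _ (Or.inr h3) _ rfl
      · rw [h1] at hc
        rw [Client.enter_acks hc k] at ha
        simp at ha
    · intro e pr sent acks hc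
      rw [e] at hc; simp at hc
    · intro hB' s sent acks hc
      exact Or.inr fun n hn hn' j hj => (htop n ((h.le 1).trans hn) (by omega) j hj).le
    · intro _ _ _ _ n hn hn' s a a' h3 h4 h5 h6 pr' sent' acks' hc k hk b hb
      rcases Client.advance_cases p i a' _ with e | ⟨pr'', e⟩
      · rw [h6, e] at hc; simp at hc
      · rw [h6, e] at hc
        rw [Client.enter_acks hc k] at hb
        simp at hb
  intro n hn hn' i hi s sent acks hc acks' hs hen he
  have hcB : w c ≤ w (c + 1) := h.mono (by omega)
  have hn2 : w 2 ≤ n := by simpa using hn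
  have hn1 : w 1 ≤ n := (h.mono (by omega)).trans hn2
  have hn0 : w 0 ≤ n := (h.le 2).trans hn2
  obtain ⟨k, hk, a, ha⟩ := hen.exists
  have hle : (p.tTop : Tag P) ≤ a.tag := by
    rcases hs k with h3 | ⟨-, b, h3, h4⟩
    · exact hA i hi n hn2 (by omega) _ _ _ hc k hk a (by rw [← h3, ha])
    · rw [ha] at h4
      cases h4
      exact hL i hi k hk n hn1 (by omega) _ (Or.inr h3) _ rfl
  have hmax : (p.tTop : Tag P) ≤ maxAck p acks' := by
    refine hle.trans ?_
    have := Finset.le_sup (f := fun k => match acks' k with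
      | none => (⊥ : Tag P)
      | some a => a.tag) hk
    simp only [ha] at this
    exact this
  obtain ⟨j, hj, hd⟩ := h.delivery (e := n + 1) (k := c) (by omega) (by omega) hB hi he
    (t := (nextStamp i (maxAck p acks') : Tag P)) rfl
  rw [htop _ (h.le _) hB j hj, WithBot.coe_le_coe] at hd
  exact absurd (p.tTop_lt_nextStamp i hmax) (not_lt_of_ge hd)

/-- Servers now leave the queries of writers unanswered. After one cycle no old answer is in
transit, so the set of acknowledging servers cannot grow during a writer's query. A client that had
a quorum from the start leaves its access on the next returning token, in the second cycle. -/
theorem Calm.quiet_of_lt (h : Calm R w B)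
    (htop : ∀ n, w 0 ≤ n → n ≤ B → ∀ j ∈ p.servers, (p.tTop : Tag P) < R.top n j) :
    Quiet R (fun k => w (k + 2)) B := by
  have hL : ∀ i ∈ p.clients, ∀ j ∈ p.servers, _ := fun i hi j hj =>
    h.after_reply (k := 0) (q := .query false) hi hj
      (Φ := fun _ a => a = none) (fun _ _ _ _ => id)
      (by
        rintro n hn hn' a a' hr hm -
        rcases a with _ | a
        · simpa using hm
        · exact absurd (htop n hn hn'.le j hj) (not_lt_of_ge hr.writer_tag.2))
  have hen : ∀ i ∈ p.clients, ∀ n, w 1 ≤ n → n ≤ B → ∀ s sent acks acks',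
      AckStep p (R.state n) i (.wQuery s) sent acks acks' → Enough p acks' → Enough p acks := by
    intro i hi n hn hn' s sent acks acks' hs he
    unfold Enough at he ⊢
    convert he using 1
    refine Finset.filter_congr fun k hk => ?_
    rcases hs k with h3 | ⟨-, b, h3, h4⟩
    · rw [h3]
    · exact absurd (hL i hi k hk n hn hn' _ (Or.inr h3)) (by simp)
  have hent : ∀ (pr : Proc P V) (s : V) sent acks,
      (Client.enter pr : Client P W V) = .busy (.wQuery s) sent acks → ¬ Enough p acks := by
    intro pr s sent acks e he
    obtain ⟨k, hk, a, ha⟩ := he.exists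
    rw [Client.enter_acks e k] at ha
    simp at ha
  have hA : ∀ i ∈ p.clients, After w B 2 fun n => ∀ s sent acks,
      (R.state n).cli i = .busy (.wQuery s) sent acks → ¬ Enough p acks := by
    intro i hi
    refine After.of_cycle (k := 1) (fun n hn hn' hQ s sent acks hc he => ?_) fun hB => ?_
    · rcases h.cli_cases ((h.le 1).trans hn) hn' hc with ⟨s₀, a₀, h1, h2⟩ | ⟨h1, -⟩
      · exact hQ _ _ _ h1 (hen i hi n hn hn'.le _ _ _ _ h2 he)
      · rw [h1] at hc
        exact hent _ _ _ _ hc he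
    · obtain ⟨j, hj⟩ := p.servers_nonempty
      obtain ⟨b₁, b₂, b₃, b₄, h1, h2, h3, h4, h5, e1, e2, e3, e4⟩ := (h.cycle 1).2 i hi j hj
      -- Any returning token, even without a reply, makes the client check for a quorum.
      refine ⟨b₄ + 1, by omega, by omega, ?_⟩
      intro s sent acks hc
      have h10 := h.le 1
      rcases h.cli (n := b₄) (by omega) (by omega) i with
        f | ⟨j', hj', ev, f⟩ | ⟨j', hj', q, a, ev, hl', f⟩ | f
      · exact absurd e4 (f.2.2 j)
      · rw [e4] at ev; simp at ev
      · rcases hc0 : (R.state b₄).cli i with _ | ⟨pr₀, sent₀, acks₀⟩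
        · rw [f, hc0] at hc; simp [onReply] at hc
        · rw [hc0] at f
          rcases onReply_busy (p := p) i j' q a pr₀ sent₀ acks₀ with g | g
          · rw [f, g.2] at hc
            rcases Client.advance_cases p i (newAcks p j' q a pr₀ sent₀ acks₀) pr₀ with e | ⟨pr', e⟩
            · rw [e] at hc; simp at hc
            · rw [e] at hc
              exact hent _ _ _ _ hc
          · rw [f, g.2] at hc
            cases hc
            exact g.1
      · exact absurd e4 (f.2.2.1 j)
  intro n hn hn' i hi s sent acks hc acks' hs he _
  have hn2 : w 2 ≤ n := by simpa using hn
  exact hA i hi n hn2 hn'.le _ _ _ hc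
    (hen i hi n ((h.mono (by omega)).trans hn2) hn'.le _ _ _ _ hs he)

end OverflowLemmas

section QuietLemmas

variable {P W V : Type*} [Fintype P] [LinearOrder P] [Nonempty P] [DecidableEq W]
variable {p : Setup P W V} {R : Execution p} {w : ℕ → ℕ} {B : ℕ}

/-! ### Writers finish -/

/-- The number of quorum accesses that a writer has to end after its query. -/
def Proc.level : Proc P V → ℕ
  | .wPre _ _ => 3
  | .wFin _ => 2
  | .wFIN _ => 1
  | _ => 0

theorem Proc.level_le (pr : Proc P V) : pr.level ≤ 3 := by
  cases pr <;> simp [Proc.level]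

theorem Client.level_advance {i : P} {acks : P → Option (Ack P W)} {pr pr' : Proc P V}
    (h : Client.advance p i acks pr = .enter pr') (hne : ∀ s, pr ≠ .wQuery s) :
    pr'.level ≤ pr.level - 1 := by
  cases pr with
  | wQuery s => exact absurd rfl (hne s)
  | wPre t s => cases h; simp [Proc.level]
  | wFin t => cases h; simp [Proc.level]
  | wFIN t => cases h
  | rQuery => cases h; simp [Proc.level]
  | rFin t => cases h

/-- Each cycle ends one access of an active writer, and only the end of a writer's query could raise
the level again, which `Quiet` forbids. Queries have level 0 and need no progress. -/
theorem Calm.after_level (h : Calm R w B) (hq : Quiet R w B) {i : P} (hi : i ∈ p.clients) (l : ℕ) :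
    After w B l fun n => ∀ pr sent acks, (R.state n).cli i = .busy pr sent acks →
      pr.level ≤ 3 - l := by
  induction l with
  | zero => exact fun n _ _ pr _ _ _ => pr.level_le
  | succ l ih =>
    refine After.of_advance h hi (fun n hn hn' hQ pr sent acks hc => ?_) ?_ ?_ ?_
    · have hn0 := (h.le l).trans hn
      rcases h.cli_cases hn0 hn' hc with ⟨s₀, a₀, h1, h2⟩ | ⟨h1, ⟨-, h2⟩ | h2⟩
      · exact hQ _ _ _ h1
      · rcases h2 with ⟨s, rfl⟩ | rfl <;> simp [Proc.level]
      · obtain ⟨pr₀, s₀, a₀, a', h3, h4, h5, h6⟩ := h2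
        have := Client.level_advance h6 (by
          rintro s rfl
          exact hq n hn0 hn' i hi s _ _ h3 _ h4 h5 (h1.trans h6.symm))
        have := hQ _ _ _ h3
        omega
    · intro e pr sent acks hc
      rw [e] at hc; simp at hc
    · intro hB s sent acks hc
      left
      intro pr sent' acks' hc'
      rw [hc] at hc'
      cases hc'
      simp [Proc.level]
    · intro pr s₀ a₀ h0 n hn hn' s a a' h3 h4 h5 h6 pr' sent' acks' hc
      have hn0 := (h.le l).trans hn
      rcases Client.advance_cases p i a' pr with e | ⟨pr'', e⟩
      · rw [h6, e] at hc; simp at hc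
      · have e2 := h6.trans e
        rw [e2] at hc
        cases hc
        have := Client.level_advance e (by
          rintro s' rfl
          exact hq n hn0 hn' i hi s' _ _ h3 _ h4 h5 h6)
        have := ih n hn hn'.le _ _ _ h3
        omega

/-- A query, or a request of a reader to finalize. -/
def Req.IsMild : Req P W → Prop
  | .query _ => True
  | .prewrite _ _ => False
  | .finalize reader _ last => reader = true ∧ last = false

theorem Proc.isMild_req {pr : Proc P V} (h : pr.level = 0) (j : P) : (pr.req p j).IsMild := by
  cases pr <;> simp_all [Proc.level, Proc.req, Req.IsMild]

/-- Three cycles bring every client to level 0; the fourth flushes older requests from the links. -/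
theorem Calm.after_mild (h : Calm R w B) (hq : Quiet R w B) {i j : P} (hi : i ∈ p.clients)
    (hj : j ∈ p.servers) : After w B 4 fun n => ∀ r, (R.state n).ping i j = .request (some r) →
      r.IsMild := by
  refine After.of_atClient h hi hj (k := 3) (fun n hn hn' hQ r hl => ?_) ?_
  · rcases h.ping ((h.le 3).trans hn) hn' i j with
      g | g | g | ⟨r, b, b', g⟩ | ⟨q, b, g⟩ | ⟨q, b, g⟩
    · exact hQ r (g.1.symm.trans hl)
    · rw [g.2.2] at hl
      rcases hc : (R.state n).cli i with _ | ⟨pr, sent, acks⟩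
      · rw [hc] at hl; simp [Client.outgoing] at hl
      · rw [hc] at hl
        obtain rfl : pr.req p j = r := by simpa [Client.outgoing] using hl
        exact Proc.isMild_req (Nat.le_zero.1 (h.after_level hq hi 3 n hn hn'.le _ _ _ hc)) j
    all_goals rw [hl] at g; simp at g
  · intro n hn hn' e r hl
    rw [e] at hl; simp at hl

/-! ### Readers only spread tags that are stored as finalized -/

/-- If all finalized tags are good during several cycles, then the tags that the readers send are good
afterwards. -/
theorem Calm.after_reader (h : Calm R w B) {good : ℕ → Tag P → Prop}
    (hm : ∀ n, w 0 ≤ n → n < B → ∀ t, good n t → good (n + 1) t)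
    (hbot : ∀ n, good n ⊥) (hsup : ∀ n s t, good n s → good n t → good n (s ⊔ t))
    (hfin : ∀ n, w 0 ≤ n → n ≤ B → ∀ j ∈ p.servers,
      good n (maxPhase ((R.state n).srv j).store finPhases)) {i j : P} (hi : i ∈ p.clients)
    (hj : j ∈ p.servers) :
    After w B 4 fun n => ∀ t l, (R.state n).ping i j = .request (some (.finalize true t l)) →
      good n t := by
  have hL : ∀ j ∈ p.servers, _ := fun j hj =>
    h.after_reply (k := 0) (q := .query true) hi hj
      (Φ := fun n a => ∀ b, a = some b → good n b.tag)
      (fun n hn hn' a ha b hb => hm n hn hn' _ (ha b hb))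
      (by
        rintro n hn hn' a a' hr hmap - b rfl
        rcases a with _ | a
        · simp at hmap
        · have hm' : b.tag = a.tag := by simpa using hmap
          rw [hm', hr.reader_tag]
          exact hm n hn hn' _ (hfin n hn hn'.le j hj))
  have hA : After w B 2 fun n => ∀ sent acks,
      (R.state n).cli i = .busy .rQuery sent acks → ∀ k ∈ p.servers, ∀ a, acks k = some a →
      good n a.tag := by
    refine After.of_advance h hi (k := 1) (fun n hn hn' hQ sent acks hc k hk a ha => ?_) ?_ ?_ ?_
    · have hn0 := (h.le 1).trans hn
      rcases h.cli_cases hn0 hn' hc with ⟨s₀, a₀, h1, h2⟩ | ⟨h1, -⟩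
      · refine hm n hn0 hn' _ ?_
        rcases h2 k with h3 | ⟨-, b, h3, h4⟩
        · exact hQ _ _ h1 k hk a (by rw [← h3, ha])
        · rw [ha] at h4
          cases h4
          exact hL k hk n hn hn'.le _ (Or.inr h3) _ rfl
      · rw [h1] at hc
        rw [Client.enter_acks hc k] at ha
        simp at ha
    · intro e sent acks hc
      rw [e] at hc; simp at hc
    · intro hB' s sent acks hc
      left
      intro sent' acks' hc'
      rw [hc] at hc'
      cases hc'
    · intro _ _ _ _ n hn hn' s a a' h3 h4 h5 h6 sent' acks' hc k hk b hb
      rcases Client.advance_cases p i a' _ with e | ⟨pr'', e⟩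
      · rw [h6, e] at hc; simp at hc
      · rw [h6, e] at hc
        rw [Client.enter_acks hc k] at hb
        simp at hb
  -- Only a reader's query leads to `rFin`, and its tag is a supremum of acknowledged tags, so
  -- closure under `⊔` is what `good` needs.
  have hadv : ∀ n, w 2 ≤ n → n < B → ∀ pr₀ s₀ a₀ a', (R.state n).cli i = .busy pr₀ s₀ a₀ →
      AckStep p (R.state n) i pr₀ s₀ a₀ a' → ∀ t, Client.advance p i a' pr₀ = .enter (.rFin t) →
      good (n + 1) t := by
    intro n hn hn' pr₀ s₀ a₀ a' hc hs t ht
    have hn0 := (h.le 2).trans hn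
    cases pr₀ with
    | rQuery =>
      cases ht
      refine hm n hn0 hn' _ ?_
      unfold maxAck
      refine Finset.sup_induction (hbot n) (fun s hs t ht => hsup n s t hs ht) fun k hk => ?_
      rcases ha : a' k with _ | a
      · exact hbot n
      · rcases hs k with h3 | ⟨-, b, h3, h4⟩
        · exact hA n hn hn'.le _ _ hc k hk a (by rw [← h3, ha])
        · rw [ha] at h4
          cases h4
          exact hL k hk n ((h.mono (by omega)).trans hn) hn'.le _ (Or.inr h3) _ rfl
    | _ => cases ht
  have hF : After w B 3 fun n => ∀ t sent acks,
      (R.state n).cli i = .busy (.rFin t) sent acks → good n t := by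
    refine After.of_advance h hi (k := 2) (fun n hn hn' hQ t sent acks hc => ?_) ?_ ?_ ?_
    · have hn0 := (h.le 2).trans hn
      rcases h.cli_cases hn0 hn' hc with ⟨s₀, a₀, h1, h2⟩ | ⟨h1, ⟨-, h2⟩ | h2⟩
      · exact hm n hn0 hn' _ (hQ _ _ _ h1)
      · simp at h2
      · obtain ⟨pr₀, s₀, a₀, a', h3, h4, h5, h6⟩ := h2
        exact hadv n hn hn' _ _ _ _ h3 h4 _ h6
    · intro e t sent acks hc
      rw [e] at hc; simp at hc
    · intro hB' s sent acks hc
      left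
      intro t sent' acks' hc'
      rw [hc] at hc'
      cases hc'
    · intro _ _ _ _ n hn hn' s a a' h3 h4 h5 h6 t sent' acks' hc
      rcases Client.advance_cases p i a' _ with e | ⟨pr'', e⟩
      · rw [h6, e] at hc; simp at hc
      · rw [h6, e] at hc
        cases hc
        exact hadv n hn hn' _ _ _ _ h3 h4 _ e
  refine After.of_atClient h hi hj (k := 3) (fun n hn hn' hQ t l hl => ?_) ?_
  · have hn0 := (h.le 3).trans hn
    rcases h.ping hn0 hn' i j with
      g | g | g | ⟨r, b, b', g⟩ | ⟨q, b, g⟩ | ⟨q, b, g⟩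
    · exact hm n hn0 hn' _ (hQ t l (g.1.symm.trans hl))
    · rw [g.2.2] at hl
      rcases hc : (R.state n).cli i with _ | ⟨pr, sent, acks⟩
      · rw [hc] at hl; simp [Client.outgoing] at hl
      · rw [hc] at hl
        have e : pr.req p j = .finalize true t l := by simpa [Client.outgoing] using hl
        cases pr with
        | rFin t' =>
          cases e
          exact hm n hn0 hn' _ (hF n hn hn'.le _ _ _ hc)
        | _ => cases e
    all_goals rw [hl] at g; simp at g
  · intro n hn hn' e t l hl
    rw [e] at hl; simp at hl

/-! ### The largest stored tag stabilizes -/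

/-- The largest tag stored by a server. -/
def Execution.maxTop (R : Execution p) (n : ℕ) : Tag P := p.servers.sup (R.top n)

theorem Execution.top_le_maxTop {n : ℕ} {j : P} (hj : j ∈ p.servers) :
    R.top n j ≤ R.maxTop n :=
  Finset.le_sup (f := R.top n) hj

theorem Calm.maxTop_mono (h : Calm R w B) {n m : ℕ} (hn : w 0 ≤ n) (hnm : n ≤ m) (hB : m ≤ B) :
    R.maxTop n ≤ R.maxTop m :=
  Finset.sup_le fun _ hj => (h.top_mono hn hnm hB hj).trans (Execution.top_le_maxTop hj)

/-- With the writers gone, a server learns tags only from its own buffers, from gossip in transit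
and from readers. After four cycles all of these carry only tags bounded by the stored maxima, so
the overall maximum cannot grow. -/
theorem Calm.maxTop_eq (h : Calm R w B) (hq : Quiet R w B) :
    After w B 4 fun n => R.maxTop n = R.maxTop (w 4) := by
  refine After.persist (fun n hn hn' hQ => ?_) rfl
  have hn0 := (h.le 4).trans hn
  rw [← hQ]
  refine le_antisymm (Finset.sup_le fun j hj => ?_) (h.maxTop_mono hn0 (by omega) hn')
  have hset := h.settled n ((h.mono (by omega)).trans hn) hn'.le
  rcases h.srv hn0 hn' hj with e | ⟨i, m, hi, hij, hm, e⟩ | ⟨i, r, hi, hl, e⟩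
  · rw [Execution.top, e]
    exact Execution.top_le_maxTop hj
  · rw [Execution.top, e.top_eq]
    refine e.pre_le _ (fun k hk => ?_) (Execution.top_le_maxTop hj)
    by_cases hki : k = i
    · subst hki
      rw [Function.update_self]
      refine h.after_gossip (k := 1) hi hj hij
        (Φ := fun n m => m.pre ≤ R.maxTop n ∧ m.fin ≤ R.maxTop n ∧ m.FIN ≤ R.maxTop n)
        (fun n hn hn' m hm => ?_) (fun n hn hn' => ?_) n ((h.mono (by omega)).trans hn) hn'.le m hm
      · have := h.maxTop_mono ((h.le 1).trans hn) (Nat.le_succ n) hn'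
        exact ⟨hm.1.trans this, hm.2.1.trans this, hm.2.2.trans this⟩
      · have hs := h.settled n hn hn' k hi
        have ht : (R.rx n k k).pre ≤ R.maxTop n := hs.pre_le.trans (Execution.top_le_maxTop hi)
        exact ⟨hs.tx_pre.trans_le ht, (hs.tx_fin.trans_le hs.fin_le_pre).trans ht,
          (hs.tx_FIN.trans hs.fin_le_pre).trans ht⟩
    · rw [Function.update_of_ne hki]
      have ht := (hset j hj).pre_le.trans (Execution.top_le_maxTop hj)
      have := (hset j hj).le_pre k hk
      exact ⟨this.1.trans ht, this.2.1.trans ht, this.2.2.trans ht⟩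
  · rw [Execution.top, e]
    refine storeAfter_le (Execution.top_le_maxTop hj) fun t ht => ?_
    have hmild := h.after_mild hq hi hj n hn hn'.le r hl
    rcases r with b | ⟨s, x⟩ | ⟨b, s, l⟩
    · exact ht.elim
    · exact hmild.elim
    · obtain rfl : t = s := ht
      obtain ⟨rfl, rfl⟩ := hmild
      refine h.after_reader (good := fun n t => t ≤ R.maxTop n)
        (fun n hn hn' t ht => ht.trans (h.maxTop_mono hn (Nat.le_succ n) hn'))
        (fun n => bot_le) (fun n s t => sup_le) (fun n hn hn' j hj => ?_) hi hj n hn hn'.le t _ hl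
      exact (maxPhase_mono finPhases_subset).trans (Execution.top_le_maxTop hj)

/-- All servers have the same largest tag `M`, and writers are not active beyond their queries. -/
structure Stable (R : Execution p) (w : ℕ → ℕ) (B : ℕ) (M : Tag P) : Prop where
  calm : Calm R w B
  top : ∀ n, w 0 ≤ n → n ≤ B → ∀ j ∈ p.servers, R.top n j = M
  settled : ∀ n, w 0 ≤ n → n ≤ B → ∀ j ∈ p.servers, Settled p j ((R.state n).srv j)
  mild : ∀ n, w 0 ≤ n → n ≤ B → ∀ i ∈ p.clients, ∀ j ∈ p.servers, ∀ r,
    (R.state n).ping i j = .request (some r) → r.IsMild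

/-- Four cycles make the overall maximum constant; four more carry it from a server that stores it
to all others. -/
theorem Calm.stable (h : Calm R w B) (hq : Quiet R w B) :
    Stable R (fun k => w (k + 8)) B (R.maxTop (w 4)) where
  calm := h.drop 8
  top n hn hn' j hj := by
    have hn8 : w 8 ≤ n := by simpa using hn
    obtain ⟨i, hi, e⟩ := Finset.exists_mem_eq_sup p.servers p.servers_nonempty (R.top (w 4))
    apply le_antisymm
    · rw [← h.maxTop_eq hq n ((h.mono (by omega)).trans hn8) hn']
      exact Execution.top_le_maxTop hj
    · exact h.spread_top (k := 4) hi e.le n hn8 hn' j hj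
  settled n hn hn' := h.settled n ((h.mono (by omega)).trans hn) hn'
  mild n hn hn' i hi j hj := h.after_mild hq hi hj n ((h.mono (by omega)).trans hn) hn'

theorem Stable.drop {M : Tag P} (h : Stable R w B M) (c : ℕ) :
    Stable R (fun k => w (k + c)) B M where
  calm := h.calm.drop c
  top n hn := h.top n ((h.calm.le _).trans hn)
  settled n hn := h.settled n ((h.calm.le _).trans hn)
  mild n hn := h.mild n ((h.calm.le _).trans hn)

theorem Stable.restrict {M : Tag P} (h : Stable R w B M) {B' : ℕ} (hB : B' ≤ B) :
    Stable R w B' M where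
  calm := h.calm.restrict hB
  top n hn hn' := h.top n hn (hn'.trans hB)
  settled n hn hn' := h.settled n hn (hn'.trans hB)
  mild n hn hn' := h.mild n hn (hn'.trans hB)

/-! ### The largest finalized tag stabilizes -/

/-- The largest finalized tag that the server of `j` does not forget. -/
def Execution.fins (R : Execution p) (M : Tag P) (n : ℕ) (j : P) : Tag P :=
  (R.rx n j j).fin ⊔ maxFinNe ((R.state n).srv j).store M

/-- The largest finalized tag that the servers do not forget. -/
def Execution.maxFins (R : Execution p) (M : Tag P) (n : ℕ) : Tag P := p.servers.sup (R.fins M n)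

theorem Execution.fins_le_maxFins {M : Tag P} {n : ℕ} {j : P} (hj : j ∈ p.servers) :
    R.fins M n j ≤ R.maxFins M n :=
  Finset.le_sup (f := R.fins M n) hj

theorem maxFinNe_le_maxPhase (S : Finset (Record P W)) (M : Tag P) :
    maxFinNe S M ≤ maxPhase S finPhases :=
  maxFinNe_le_iff.2 fun _ ht _ => ht.le_maxPhase

variable {M : Tag P}

/-- Right after gossip the own entry equals the largest stored finalized tag, so the stored part of
`fins` adds nothing. -/
theorem GossipEffect.fins_eq {n i j : _} {m : Triple P} {s : Server P W} {c : Option (Tag P)}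
    (e : GossipEffect p j s i m ((R.state n).srv j) c) : R.fins M n j = (R.rx n j j).fin :=
  sup_eq_left.2 ((maxFinNe_le_maxPhase _ _).trans e.fin_eq.le)

theorem Stable.pre_eq (h : Stable R w B M) {n : ℕ} (hn : w 0 ≤ n) (hn' : n < B) {i j : P}
    (hj : j ∈ p.servers) {m : Triple P} {s : Server P W} {c : Option (Tag P)}
    (e : GossipEffect p j s i m ((R.state (n + 1)).srv j) c) : (R.rx (n + 1) j j).pre = M := by
  rw [← h.top (n + 1) (by omega) hn' j hj]
  exact e.top_eq.symm

/-- The 'pre' update on gossip is always at `M`, so it can only destroy a finalized record of `M`,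
which `maxFinNe` does not count. The own entry covers whatever was gossiped before, and a reader's
request never lowers a phase. -/
theorem Stable.fins_mono (h : Stable R w B M) {n m : ℕ} (hn : w 0 ≤ n) (hnm : n ≤ m) (hB : m ≤ B)
    {j : P} (hj : j ∈ p.servers) : R.fins M n j ≤ R.fins M m j := by
  induction m, hnm using Nat.le_induction with
  | base => exact le_rfl
  | succ m hnm ih =>
    refine (ih (by omega)).trans ?_
    have hm0 := hn.trans hnm
    rcases h.calm.srv hm0 hB hj with e | ⟨i, a, hi, hij, hl, e⟩ | ⟨i, r, hi, hl, e⟩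
    · unfold Execution.fins Execution.rx
      rw [e]
    · rw [e.fins_eq]
      refine sup_le ?_ (maxFinNe_le_iff.2 fun t ht hne => ?_)
      · have := (e.le_fin j hj).1
        rwa [Function.update_of_ne hij.symm] at this
      · exact e.tag_le_fin t ht (by rwa [h.pre_eq hm0 hB hj e])
    · unfold Execution.fins Execution.rx
      rw [e]
      refine sup_le_sup le_rfl (maxFinNe_le_iff.2 fun t ht hne => ?_)
      have hmild := h.mild m hm0 (by omega) i hi j hj r hl
      rcases r with b | ⟨s, x⟩ | ⟨b, s, l⟩
      · exact maxFinNe_le_iff.1 le_rfl t ht hne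
      · exact hmild.elim
      · obtain ⟨rfl, rfl⟩ := hmild
        exact maxFinNe_le_iff.1 le_rfl t (ht.updatePhase (Or.inr (by simp))) hne

theorem Stable.maxFins_mono (h : Stable R w B M) {n m : ℕ} (hn : w 0 ≤ n) (hnm : n ≤ m)
    (hB : m ≤ B) : R.maxFins M n ≤ R.maxFins M m :=
  Finset.sup_le fun _ hj => (h.fins_mono hn hnm hB hj).trans (Execution.fins_le_maxFins hj)

theorem Stable.maxFins_le (h : Stable R w B M) {n : ℕ} (hn : w 0 ≤ n) (hB : n ≤ B) :
    R.maxFins M n ≤ M := by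
  refine Finset.sup_le fun j hj => ?_
  have ht := h.top n hn hB j hj
  have hs := h.settled n hn hB j hj
  exact sup_le ((hs.fin_le_pre.trans hs.pre_le).trans ht.le)
    (((maxFinNe_le_maxPhase _ _).trans (maxPhase_mono finPhases_subset)).trans ht.le)

/-- Gossip carries only tags that are already counted. The one uncounted source is a stored
finalized record of `M`: it may vanish, or enter the own entry at the next gossip and lift the
maximum to `M`. Readers spread counted tags or `M`. -/
theorem Stable.maxFins_step (h : Stable R w B M) :
    After w B 4 fun n => n < B → R.maxFins M (n + 1) = R.maxFins M n ∨ R.maxFins M (n + 1) = M := by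
  intro n hn _ hn'
  have hn0 := (h.calm.le 4).trans hn
  have hle := h.maxFins_le (n := n + 1) (by omega) hn'
  have key : ∀ j ∈ p.servers, R.fins M (n + 1) j ≤ R.maxFins M n ∨ R.fins M (n + 1) j = M := by
    intro j hj
    have hjn := Execution.fins_le_maxFins (R := R) (M := M) (n := n) hj
    have hset := h.settled n hn0 hn'.le
    rcases h.calm.srv hn0 hn' hj with e | ⟨i, m, hi, hij, hl, e⟩ | ⟨i, r, hi, hl, e⟩
    · left
      refine le_trans (le_of_eq ?_) hjn
      unfold Execution.fins Execution.rx
      rw [e]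
    · rw [e.fins_eq]
      refine e.fin_le _ M (fun k hk => ?_) (le_sup_right.trans hjn)
      by_cases hki : k = i
      · subst hki
        rw [Function.update_self]
        refine h.calm.after_gossip (k := 0) hi hj hij
          (Φ := fun n m => m.fin ≤ R.maxFins M n ∧ m.FIN ≤ R.maxFins M n)
          (fun n hn hn' m hm => ?_) (fun n hn hn' => ?_) n ((h.calm.mono (by omega)).trans hn)
          hn'.le m hl
        · have := h.maxFins_mono hn (Nat.le_succ n) hn'
          exact ⟨hm.1.trans this, hm.2.trans this⟩
        · have hs := h.settled n hn hn' k hi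
          have ht : (R.rx n k k).fin ≤ R.maxFins M n :=
            le_sup_left.trans (Execution.fins_le_maxFins hi)
          exact ⟨hs.tx_fin.trans_le ht, hs.tx_FIN.trans ht⟩
      · rw [Function.update_of_ne hki]
        have ht := le_sup_left.trans hjn
        have := (hset j hj).le_fin k hk
        exact ⟨this.1.trans ht, this.2.trans ht⟩
    · left
      unfold Execution.fins Execution.rx
      rw [e]
      refine sup_le (le_sup_left.trans hjn) (maxFinNe_le_iff.2 fun t ht hne => ?_)
      have hold : ∀ t, HasTag ((R.state n).srv j).store finPhases t → t ≠ M →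
          t ≤ R.maxFins M n := fun t ht hne =>
        (maxFinNe_le_iff.1 le_rfl t ht hne).trans (le_sup_right.trans hjn)
      have hmild := h.mild n hn0 hn'.le i hi j hj r hl
      rcases r with b | ⟨s, x⟩ | ⟨b, s, l⟩
      · exact hold t ht hne
      · exact hmild.elim
      · obtain ⟨rfl, rfl⟩ := hmild
        rcases HasTag.of_updatePhase ht with ht | ⟨rfl, -⟩
        · exact hold t ht hne
        -- This predicate is closed under `⊔` because the order is total: a supremum of two tags is
        -- one of them.
        · refine (h.calm.after_reader (good := fun n t => t ≤ R.maxFins M n ∨ t = M)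
            (fun n hn hn' t ht => ht.imp_left fun ht => ht.trans
              (h.maxFins_mono hn (Nat.le_succ n) hn'))
            (fun n => Or.inl bot_le) (fun n s t hs ht => ?_) (fun n hn hn' j hj => ?_) hi hj n hn
            hn'.le t _ hl).resolve_right hne
          · rcases le_total s t with hst | hst
            · rwa [sup_eq_right.2 hst]
            · rwa [sup_eq_left.2 hst]
          · exact (maxPhase_finPhases_le_or _ M).imp_left fun ht =>
              ht.trans (le_sup_right.trans (Execution.fins_le_maxFins hj))
  by_cases hM : ∃ j ∈ p.servers, R.fins M (n + 1) j = M
  · obtain ⟨j, hj, e⟩ := hM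
    exact Or.inr (le_antisymm hle (e.ge.trans (Execution.fins_le_maxFins hj)))
  · push Not at hM
    exact Or.inl (le_antisymm (Finset.sup_le fun j hj => (key j hj).resolve_right (hM j hj))
      (h.maxFins_mono hn0 (Nat.le_succ n) hn'))

/-! ### Agreement leads to a call -/

theorem Triple.eq_mk {m : Triple P} {a b c : Tag P} (h1 : m.pre = a) (h2 : m.fin = b)
    (h3 : m.FIN = c) : m = ⟨a, b, c⟩ := by
  subst h1 h2 h3; rfl

/-- A constant value `H` spreads to every `fin` entry in three cycles. Two cycles later every buffer
shows it, so the next arrival finds a quorum and sets `FIN` to `H`. Two further cycles put `(M, H,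
H)` into all buffers, and an arrival in the ninth cycle passes the test for a call. -/
theorem Stable.call_of_const (h : Stable R w B M) (hM : (p.tTop : Tag P) ≤ M) (hB : w 9 ≤ B)
    (hK : ∀ n, w 0 ≤ n → n ≤ B → R.maxFins M n = R.maxFins M (w 0)) : False := by
  set H := R.maxFins M (w 0) with hH
  have hw : ∀ {k n : ℕ}, w k ≤ n → w 0 ≤ n := fun {k n} hn => (h.calm.le k).trans hn
  have hle : ∀ n, w 0 ≤ n → n ≤ B → ∀ j ∈ p.servers, (R.rx n j j).fin ≤ H := fun n hn hn' j hj =>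
    (le_sup_left.trans (Execution.fins_le_maxFins hj)).trans (hK n hn hn').le
  -- A server that attains `H`; its next gossip moves `H` into its own entry, from where it spreads.
  obtain ⟨i, hi, hiH⟩ := Finset.exists_mem_eq_sup p.servers p.servers_nonempty (R.fins M (w 0))
  have h1 : After w B 1 fun n => H ≤ (R.rx n i i).fin := by
    refine h.calm.after_receive (k := 0) hi ?_ ?_
    · rintro n hn hB hQ (e | ⟨i, r, -, -, e⟩)
      · rwa [Execution.rx, e]
      · rwa [Execution.rx, e]
    · intro n hn hn' j hj hji m hm e
      rw [← e.fins_eq (M := M)]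
      exact hiH.le.trans (h.fins_mono le_rfl (by omega) hn' hi)
  have h3 : ∀ j ∈ p.servers, After w B 3 fun n => (R.rx n j j).fin = H ∧ (R.tx n j).fin = H := by
    intro j hj n hn hn'
    have hs := h.settled n (hw hn) hn' j hj
    have : H ≤ (R.rx n j j).fin := by
      by_cases hij : i = j
      · subst hij
        exact h1 n ((h.calm.mono (by omega)).trans hn) hn'
      · refine le_trans ?_ (hs.le_fin i hi).1
        refine h.calm.after_rx (k := 1) hi hj hij (Φ := fun _ m => H ≤ m.fin) (fun _ _ _ _ => id)
          (fun n hn hn' => ?_) n hn hn'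
        exact (h1 n hn hn').trans (h.settled n (hw hn) hn' i hi).tx_fin.ge
    have e := le_antisymm (hle n (hw hn) hn' j hj) this
    exact ⟨e, hs.tx_fin.trans e⟩
  have h5 : ∀ j ∈ p.servers, After w B 6 fun n =>
      R.rx n j j = ⟨M, H, H⟩ ∧ R.tx n j = ⟨M, H, H⟩ := by
    intro j hj
    refine h.calm.after_receive (k := 5) hj ?_ ?_
    · rintro n hn hB hQ (e | ⟨i, r, -, -, e⟩)
      · unfold Execution.rx Execution.tx; rwa [e]
      · unfold Execution.rx Execution.tx; rwa [e]
    · intro n hn hn' l hl hlj m hm e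
      have hs := e.settled
      have hpre : (R.rx (n + 1) j j).pre = M := h.pre_eq (hw hn) hn' hj e
      have hfin : (R.rx (n + 1) j j).fin = H :=
        (h3 j hj (n + 1) ((h.calm.mono (by omega)).trans (hn.trans (Nat.le_succ n))) hn').1
      have hFIN : (R.rx (n + 1) j j).FIN = (R.rx (n + 1) j j).fin := by
        refine e.FIN_eq fun k hk hkj => ?_
        rw [hfin]
        by_cases hkl : k = l
        · subst hkl
          rw [Function.update_self]
          exact h.calm.after_gossip (k := 3) hk hj hkj (Φ := fun _ m => m.fin = H)
            (fun _ _ _ _ => id) (fun n hn hn' => (h3 k hk n hn hn').2) n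
            ((h.calm.mono (by omega)).trans hn) hn'.le m hm
        · rw [Function.update_of_ne hkl]
          exact h.calm.after_rx (k := 3) hk hj hkj (Φ := fun _ m => m.fin = H)
            (fun _ _ _ _ => id) (fun n hn hn' => (h3 k hk n hn hn').2) n hn hn'.le
      constructor
      · exact Triple.eq_mk hpre hfin (hFIN.trans hfin)
      · exact Triple.eq_mk (hs.tx_pre.trans hpre) (hs.tx_fin.trans hfin)
          ((e.tx_FIN hFIN).trans hfin)
  obtain ⟨j, hj⟩ := p.servers_nonempty
  obtain ⟨i, hi, hij⟩ := p.exists_ne j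
  obtain ⟨b₁, b₂, c1, c2, c3, e1, e2⟩ := (h.calm.cycle 8).gossip hi hj hij
  have hb : w 8 ≤ b₂ := c1.trans c2.le
  have hbB : b₂ < B := c3.trans_le hB
  obtain ⟨m, -, -, -, hm, e⟩ := h.calm.receive (hw hb) hbB e2
  have hself := (h5 j hj (b₂ + 1) ((h.calm.mono (by omega)).trans (hb.trans (Nat.le_succ _))) hbB).1
  refine e.call ?_ (fun k hk => ?_) ?_ rfl
  · exact hM.trans (h.pre_eq (hw hb) hbB hj e).ge
  · by_cases hkj : k = j
    · rw [hkj]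
    · have h6 := (fun n hn hn' => (h5 k hk n hn hn').2 : After w B 6 fun n => R.tx n k = ⟨M, H, H⟩)
      refine Eq.trans ?_ hself.symm
      exact h.calm.after_rx (k := 6) hk hj hkj (Φ := fun _ m => m = ⟨M, H, H⟩)
        (fun _ _ _ _ => id) h6 (b₂ + 1) (hb.trans (Nat.le_succ _)) hbB
  · change (R.rx (b₂ + 1) j j).FIN = (R.rx (b₂ + 1) j j).fin
    rw [hself]

/-- After `w 4`, `maxFins` takes at most two values, the second being its upper bound `M`. By
monotonicity it is constant on one of two windows of nine cycles: up to `w 13` if it has not changed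
by then, and from `w 13` on otherwise. -/
theorem Stable.call (h : Stable R w B M) (hM : (p.tTop : Tag P) ≤ M) (hB : w 22 ≤ B) : False := by
  have hcB : w 13 ≤ B := (h.calm.mono (by omega)).trans hB
  have h413 : w 4 ≤ w 13 := h.calm.mono (by omega)
  have hor : After w B 4 fun n => R.maxFins M n = R.maxFins M (w 4) ∨ R.maxFins M n = M := by
    refine After.persist (fun n hn hn' hQ => ?_) (Or.inl rfl)
    rcases h.maxFins_step n hn hn'.le hn' with e | e
    · rwa [e]
    · exact Or.inr e
  by_cases he : R.maxFins M (w 13) = R.maxFins M (w 4)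
  · refine ((h.drop 4).restrict hcB).call_of_const hM le_rfl fun n hn hn' => ?_
    have hn4 : w 4 ≤ n := by simpa using hn
    simp only [Nat.zero_add]
    refine le_antisymm ?_ (h.maxFins_mono (h.calm.le 4) hn4 (hn'.trans hcB))
    rw [← he]
    exact h.maxFins_mono ((h.calm.le 4).trans hn4) hn' hcB
  · have he' : R.maxFins M (w 13) = M := (hor (w 13) h413 hcB).resolve_left he
    refine (h.drop 13).call_of_const hM hB fun n hn hn' => ?_
    have hn4 : w 13 ≤ n := by simpa using hn
    simp only [Nat.zero_add]
    refine le_antisymm ?_ (h.maxFins_mono (h.calm.le 13) hn4 hn')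
    rw [he']
    exact h.maxFins_le ((h.calm.le 13).trans hn4) hn'

/-- The 30 cycles are 8 for `Calm.stable` and 22 for `Stable.call`. -/
theorem Calm.call_of_quiet (h : Calm R w B) (hq : Quiet R w B) (hB : w 30 ≤ B)
    (htop : ∀ j ∈ p.servers, (p.tTop : Tag P) ≤ R.top (w 0) j) : False := by
  have h8 : w 8 ≤ B := (h.mono (by omega)).trans hB
  refine (h.stable hq).call ?_ hB
  obtain ⟨j, hj⟩ := p.servers_nonempty
  exact ((htop j hj).trans (h.top_mono le_rfl (h.le 4) ((h.mono (by omega)).trans h8) hj)).trans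
    (Execution.top_le_maxTop hj)

/-- In a long calm segment, the large tags vanish. -/
theorem Calm.exists_overflowFree (h : Calm R w B) (hB : w 80 ≤ B) :
    ∃ n, w 0 ≤ n ∧ n ≤ B ∧ (R.state n).OverflowFree p := by
  by_contra hno
  have hwB : ∀ k ≤ 80, w k ≤ B := fun k hk => (h.mono hk).trans hB
  -- Since the stored maxima are monotone, smallness at `w 5` alone gives smallness on the whole
  -- stretch before it.
  have h1 : ∃ j ∈ p.servers, (p.tTop : Tag P) ≤ R.top (w 5) j := by
    by_contra hlt
    push Not at hlt
    refine hno ⟨w 4, h.le 4, hwB 4 (by omega),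
      (h.restrict (hwB 5 (by omega))).overflowFree le_rfl fun n hn hn' j hj => ?_⟩
    exact (h.top_mono hn hn' (hwB 5 (by omega)) hj).trans_lt (hlt j hj)
  obtain ⟨j, hj, hj1⟩ := h1
  have h2 : After w B 9 fun n => ∀ j ∈ p.servers, (p.tTop : Tag P) ≤ R.top n j :=
    h.spread_top (k := 5) hj hj1
  -- In the first case all maxima equal `t_top` from `w 9` to `w 42`, which is quiet from `w 11` to
  -- `w 41`: exactly the 30 cycles required. In the second case a larger tag reaches all servers by
  -- `w 46`, and quiet begins at `w 48`.
  by_cases h3 : ∀ j ∈ p.servers, R.top (w 42) j ≤ (p.tTop : Tag P)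
  · have hc : Calm R (fun k => w (k + 9)) (w 42) := (h.drop 9).restrict (hwB 42 (by omega))
    have hq : Quiet R (fun k => w (k + 11)) (w 41) :=
      hc.quiet_of_eq (c := 32) le_rfl fun n hn hn' j hj => by
        have hn9 : w 9 ≤ n := by simpa using hn
        exact le_antisymm ((h.top_mono ((h.le 9).trans hn9) hn' (hwB 42 (by omega)) hj).trans
          (h3 j hj)) (h2 n hn9 (hn'.trans (hwB 42 (by omega))) j hj)
    refine ((h.drop 11).restrict (hwB 41 (by omega))).call_of_quiet hq le_rfl fun j hj => ?_
    exact h2 _ (h.mono (by omega)) (hwB _ (by omega)) j hj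
  · push Not at h3
    obtain ⟨i, hi, hi3⟩ := h3
    have h4 := h.spread_top (k := 42) hi le_rfl
    have hq : Quiet R (fun k => w (k + 48)) B := (h.drop 46).quiet_of_lt fun n hn hn' j hj =>
      hi3.trans_le (h4 n (by simpa using hn) hn' j hj)
    refine (h.drop 48).call_of_quiet hq (hwB 78 (by omega)) fun j hj => ?_
    exact h2 _ (h.mono (by omega)) (hwB _ (by omega)) j hj

end QuietLemmas

section FairLemmas

variable {P W V : Type*} [Fintype P] [LinearOrder P] [Nonempty P] [DecidableEq W]
variable {p : Setup P W V} {c c' : State P W V} {ev : Event P V} {R : Execution p}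

/-! ### Fairness keeps the tokens moving -/

/-- In contrast to `Step.gossip`, no machine has to be enabled: a foreign step can at most empty the
payload, never move the token. Fairness therefore applies during resets as well. -/
theorem Step.gossip_token (hs : Step p c ev c') (i j : P) :
    c'.gossip i j = c.gossip i j ∨ c'.gossip i j = (c.gossip i j).clear ∨
      ev = .gossipSend i j ∨ ev = .gossipReceive i j := by
  cases ev with
  | gossipSend a b =>
    obtain ⟨-, -, -, -, rfl⟩ := hs
    by_cases e : i = a ∧ j = b
    · obtain ⟨rfl, rfl⟩ := e; simp
    · left; dsimp only; rw [set₂_apply, if_neg e]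
  | gossipReceive a b =>
    obtain ⟨-, -, -, m, -, rfl⟩ := hs
    by_cases e : i = a ∧ j = b
    · obtain ⟨rfl, rfl⟩ := e; simp
    · left; dsimp only; rw [set₂_apply, if_neg e]
  | pingSend a b => obtain ⟨-, -, -, rfl⟩ := hs; exact Or.inl rfl
  | pingReceive a b =>
    obtain ⟨-, -, q, hq, hs⟩ := hs
    split at hs
    · obtain ⟨x, x', -, -, rfl⟩ := hs; exact Or.inl rfl
    · subst hs; exact Or.inl rfl
  | pongSend a b => obtain ⟨-, -, q, x, -, rfl⟩ := hs; exact Or.inl rfl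
  | pongReceive a b => obtain ⟨-, -, q, x, -, rfl⟩ := hs; exact Or.inl rfl
  | startWrite a s => obtain ⟨-, -, -, rfl⟩ := hs; exact Or.inl rfl
  | startRead a => obtain ⟨-, -, -, rfl⟩ := hs; exact Or.inl rfl
  | resetSend a b => simp only [Step] at hs; subst hs; exact Or.inl rfl
  | resetReceive a b => simp only [Step] at hs; subst hs; exact Or.inl rfl
  | disable a => simp only [Step] at hs; subst hs; exact Or.inl rfl
  | localReset a t => obtain ⟨-, -, rfl⟩ := hs; exact Or.inl rfl
  | clean a =>
    obtain ⟨-, -, rfl⟩ := hs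
    dsimp only
    split_ifs
    · exact Or.inr (Or.inl rfl)
    · exact Or.inl rfl
  | enable A => simp only [Step] at hs; subst hs; exact Or.inl rfl

theorem Step.ping_token (hs : Step p c ev c') (i j : P) :
    c'.ping i j = c.ping i j ∨ c'.ping i j = (c.ping i j).clear ∨
      ev = .pingSend i j ∨ ev = .pingReceive i j ∨ ev = .pongSend i j ∨ ev = .pongReceive i j := by
  cases ev with
  | gossipSend a b => obtain ⟨-, -, -, -, rfl⟩ := hs; exact Or.inl rfl
  | gossipReceive a b => obtain ⟨-, -, -, m, -, rfl⟩ := hs; exact Or.inl rfl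
  | pingSend a b =>
    obtain ⟨-, -, -, rfl⟩ := hs
    by_cases e : i = a ∧ j = b
    · obtain ⟨rfl, rfl⟩ := e; simp
    · left; dsimp only; rw [set₂_apply, if_neg e]
  | pingReceive a b =>
    obtain ⟨-, -, q, hq, hs⟩ := hs
    by_cases e : i = a ∧ j = b
    · obtain ⟨rfl, rfl⟩ := e; simp
    · left
      split at hs
      · obtain ⟨x, x', -, -, rfl⟩ := hs
        dsimp only; rw [set₂_apply, if_neg e]
      · subst hs
        dsimp only; rw [set₂_apply, if_neg e]
  | pongSend a b =>
    obtain ⟨-, -, q, x, -, rfl⟩ := hs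
    by_cases e : i = a ∧ j = b
    · obtain ⟨rfl, rfl⟩ := e; simp
    · left; dsimp only; rw [set₂_apply, if_neg e]
  | pongReceive a b =>
    obtain ⟨-, -, q, x, -, rfl⟩ := hs
    by_cases e : i = a ∧ j = b
    · obtain ⟨rfl, rfl⟩ := e; simp
    · left; dsimp only; rw [set₂_apply, if_neg e]
  | startWrite a s => obtain ⟨-, -, -, rfl⟩ := hs; exact Or.inl rfl
  | startRead a => obtain ⟨-, -, -, rfl⟩ := hs; exact Or.inl rfl
  | resetSend a b => simp only [Step] at hs; subst hs; exact Or.inl rfl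
  | resetReceive a b => simp only [Step] at hs; subst hs; exact Or.inl rfl
  | disable a => simp only [Step] at hs; subst hs; exact Or.inl rfl
  | localReset a t => obtain ⟨-, -, rfl⟩ := hs; exact Or.inl rfl
  | clean a =>
    obtain ⟨-, -, rfl⟩ := hs
    dsimp only
    split_ifs
    · exact Or.inr (Or.inl rfl)
    · exact Or.inl rfl
  | enable A => simp only [Step] at hs; subst hs; exact Or.inl rfl

/-- A step that stays applicable until it is taken is taken. -/
theorem Execution.Fair.eventually (hF : R.Fair) {ev : Event P V} (hev : ev.IsComm)
    {I : State P W V → Prop} (hI : ∀ c, I c → ∃ c', Step p c ev c')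
    (hp : ∀ n, I (R.state n) → R.event n ≠ ev → I (R.state (n + 1))) {n : ℕ}
    (hn : I (R.state n)) : ∃ m, n ≤ m ∧ R.event m = ev := by
  by_contra! hno
  have hall : ∀ m, n ≤ m → I (R.state m) := by
    intro m hm
    induction m, hm using Nat.le_induction with
    | base => exact hn
    | succ m hm ih => exact hp m ih (hno m hm)
  obtain ⟨m, hm, e⟩ := hF ev hev
    (fun l => ⟨max l n, le_max_left _ _, hI _ (hall _ (le_max_right _ _))⟩) n
  exact hno m hm e

theorem Execution.Fair.gossipReceive (hF : R.Fair) {i j : P} (hi : i ∈ p.servers)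
    (hj : j ∈ p.servers) (hij : i ≠ j) {n : ℕ} {m : Option (Triple P)}
    (hn : (R.state n).gossip i j = .inTransit m) :
    ∃ l, n ≤ l ∧ R.event l = .gossipReceive i j := by
  refine hF.eventually (ev := .gossipReceive i j) (I := fun c => ∃ m, c.gossip i j = .inTransit m) trivial ?_ ?_ ⟨m, hn⟩
  · rintro c ⟨m, hm⟩
    exact ⟨_, hi, hj, hij, m, hm, rfl⟩
  · rintro n ⟨m, hm⟩ hne
    have hs := R.step n
    rcases hs.gossip_token i j with e | e | e | e
    · exact ⟨m, e.trans hm⟩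
    · rw [hm] at e; exact ⟨_, e⟩
    · rw [e] at hs
      have := hs.2.2.2.1
      rw [hm] at this; simp at this
    · exact absurd e hne

theorem Execution.Fair.gossipSend (hF : R.Fair) {i j : P} (hi : i ∈ p.servers)
    (hj : j ∈ p.servers) (hij : i ≠ j) (n : ℕ) :
    ∃ l, n ≤ l ∧ R.event l = .gossipSend i j := by
  have key : ∀ n, (R.state n).gossip i j = .atSender → ∃ l, n ≤ l ∧ R.event l = .gossipSend i j := by
    intro n hn
    refine hF.eventually (ev := .gossipSend i j) (I := fun c => c.gossip i j = .atSender) trivial ?_ ?_ hn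
    · exact fun c hc => ⟨_, hi, hj, hij, hc, rfl⟩
    · intro n hn hne
      have hs := R.step n
      rcases hs.gossip_token i j with e | e | e | e
      · exact e.trans hn
      · rw [hn] at e; exact e
      · exact absurd e hne
      · rw [e] at hs
        obtain ⟨-, -, -, m, hm, -⟩ := hs
        rw [hn] at hm; simp at hm
  rcases hc : (R.state n).gossip i j with _ | m
  · exact key n hc
  · obtain ⟨l, hl, e⟩ := hF.gossipReceive hi hj hij hc
    obtain ⟨l', hl', e'⟩ := key (l + 1) (by
      have hs := R.step l
      rw [e] at hs
      obtain ⟨-, -, -, m, -, hs⟩ := hs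
      rw [hs]
      dsimp only
      rw [set₂_apply, if_pos ⟨rfl, rfl⟩])
    exact ⟨l', by omega, e'⟩

theorem Execution.Fair.gossip_pair (hF : R.Fair) {i j : P} (hi : i ∈ p.servers)
    (hj : j ∈ p.servers) (hij : i ≠ j) (n : ℕ) :
    ∃ b₁ b₂, n ≤ b₁ ∧ b₁ < b₂ ∧ R.event b₁ = .gossipSend i j ∧ R.event b₂ = .gossipReceive i j := by
  obtain ⟨l, hl, e⟩ := hF.gossipSend hi hj hij n
  have hs := R.step l
  rw [e] at hs
  obtain ⟨-, -, -, -, hs⟩ := hs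
  obtain ⟨l', hl', e'⟩ := hF.gossipReceive (n := l + 1) hi hj hij
    (m := if (R.state l).srvOn i then some ((R.state l).srv i).tx else none) (by
      rw [hs]
      dsimp only
      rw [set₂_apply, if_pos ⟨rfl, rfl⟩])
  exact ⟨l, l', hl, by omega, e, e'⟩

theorem Execution.Fair.pingReceive (hF : R.Fair) {i j : P} (hi : i ∈ p.clients)
    (hj : j ∈ p.servers) {n : ℕ} {q : Option (Req P W)}
    (hn : (R.state n).ping i j = .request q) :
    ∃ l, n ≤ l ∧ R.event l = .pingReceive i j ∧ ∃ q a, (R.state (l + 1)).ping i j = .atServer q a := by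
  have key : ∃ l, n ≤ l ∧ R.event l = .pingReceive i j := by
    refine hF.eventually (ev := .pingReceive i j) (I := fun c => ∃ q, c.ping i j = .request q) trivial ?_ ?_ ⟨q, hn⟩
    · rintro c ⟨q, hq⟩
      rcases q with _ | r
      · exact ⟨_, hi, hj, none, hq, rfl⟩
      · rcases hon : c.srvOn j with _ | _
        · refine ⟨{ c with ping := set₂ c.ping i j (.atServer none none) }, hi, hj, some r, hq, ?_⟩
          rw [hon]
        · obtain ⟨a, ha⟩ := exists_replies p (storeAfter (c.srv j).store r) r
          refine ⟨{ c with
            ping := set₂ c.ping i j (.atServer (some r) a)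
            srv := Function.update c.srv j
              { c.srv j with store := storeAfter (c.srv j).store r } },
            hi, hj, some r, hq, ?_⟩
          rw [hon]
          refine ⟨a, a, ha, ?_, rfl⟩
          split_ifs <;> rfl
    · rintro n ⟨m, hm⟩ hne
      have hs := R.step n
      rcases hs.ping_token i j with e | e | e | e | e | e
      · exact ⟨m, e.trans hm⟩
      · rw [hm] at e; exact ⟨_, e⟩
      · rw [e] at hs
        have := hs.2.2.1
        rw [hm] at this; simp at this
      · exact absurd e hne
      · rw [e] at hs
        obtain ⟨-, -, q, a, hs, -⟩ := hs
        rw [hm] at hs; simp at hs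
      · rw [e] at hs
        obtain ⟨-, -, q, a, hs, -⟩ := hs
        rw [hm] at hs; simp at hs
  obtain ⟨l, hl, e⟩ := key
  refine ⟨l, hl, e, ?_⟩
  have hs := R.step l
  rw [e] at hs
  obtain ⟨-, -, q, hq, hs⟩ := hs
  split at hs
  · obtain ⟨x, x', -, -, hs⟩ := hs
    rw [hs]
    dsimp only
    rw [set₂_apply, if_pos ⟨rfl, rfl⟩]
    exact ⟨_, _, rfl⟩
  · rw [hs]
    dsimp only
    rw [set₂_apply, if_pos ⟨rfl, rfl⟩]
    exact ⟨_, _, rfl⟩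

theorem Execution.Fair.pongSend (hF : R.Fair) {i j : P} (hi : i ∈ p.clients)
    (hj : j ∈ p.servers) {n : ℕ} {q : Option (Req P W)} {a : Option (Ack P W)}
    (hn : (R.state n).ping i j = .atServer q a) :
    ∃ l, n ≤ l ∧ R.event l = .pongSend i j ∧ ∃ q a, (R.state (l + 1)).ping i j = .response q a := by
  have key : ∃ l, n ≤ l ∧ R.event l = .pongSend i j := by
    refine hF.eventually (ev := .pongSend i j) (I := fun c => ∃ q a, c.ping i j = .atServer q a) trivial ?_ ?_ ⟨q, a, hn⟩
    · rintro c ⟨q, a, hq⟩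
      exact ⟨_, hi, hj, q, a, hq, rfl⟩
    · rintro n ⟨q, a, hm⟩ hne
      have hs := R.step n
      rcases hs.ping_token i j with e | e | e | e | e | e
      · exact ⟨q, a, e.trans hm⟩
      · rw [hm] at e; exact ⟨_, _, e⟩
      · rw [e] at hs
        have := hs.2.2.1
        rw [hm] at this; simp at this
      · rw [e] at hs
        obtain ⟨-, -, q, hs, -⟩ := hs
        rw [hm] at hs; simp at hs
      · exact absurd e hne
      · rw [e] at hs
        obtain ⟨-, -, q, a, hs, -⟩ := hs
        rw [hm] at hs; simp at hs
  obtain ⟨l, hl, e⟩ := key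
  refine ⟨l, hl, e, ?_⟩
  have hs := R.step l
  rw [e] at hs
  obtain ⟨-, -, q, a, hq, hs⟩ := hs
  rw [hs]
  dsimp only
  rw [set₂_apply, if_pos ⟨rfl, rfl⟩]
  split_ifs
  exacts [⟨_, _, rfl⟩, ⟨_, _, rfl⟩]

theorem Execution.Fair.pongReceive (hF : R.Fair) {i j : P} (hi : i ∈ p.clients)
    (hj : j ∈ p.servers) {n : ℕ} {q : Option (Req P W)} {a : Option (Ack P W)}
    (hn : (R.state n).ping i j = .response q a) :
    ∃ l, n ≤ l ∧ R.event l = .pongReceive i j ∧ (R.state (l + 1)).ping i j = .atClient := by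
  have key : ∃ l, n ≤ l ∧ R.event l = .pongReceive i j := by
    refine hF.eventually (ev := .pongReceive i j) (I := fun c => ∃ q a, c.ping i j = .response q a) trivial ?_ ?_ ⟨q, a, hn⟩
    · rintro c ⟨q, a, hq⟩
      exact ⟨_, hi, hj, q, a, hq, rfl⟩
    · rintro n ⟨q, a, hm⟩ hne
      have hs := R.step n
      rcases hs.ping_token i j with e | e | e | e | e | e
      · exact ⟨q, a, e.trans hm⟩
      · rw [hm] at e; exact ⟨_, _, e⟩
      · rw [e] at hs
        have := hs.2.2.1
        rw [hm] at this; simp at this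
      · rw [e] at hs
        obtain ⟨-, -, q, hs, -⟩ := hs
        rw [hm] at hs; simp at hs
      · rw [e] at hs
        obtain ⟨-, -, q, a, hs, -⟩ := hs
        rw [hm] at hs; simp at hs
      · exact absurd e hne
  obtain ⟨l, hl, e⟩ := key
  refine ⟨l, hl, e, ?_⟩
  have hs := R.step l
  rw [e] at hs
  obtain ⟨-, -, q, a, hq, hs⟩ := hs
  rw [hs]
  dsimp only
  rw [set₂_apply, if_pos ⟨rfl, rfl⟩]

theorem Execution.Fair.pingSend (hF : R.Fair) {i j : P} (hi : i ∈ p.clients)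
    (hj : j ∈ p.servers) {n : ℕ} (hn : (R.state n).ping i j = .atClient) :
    ∃ l, n ≤ l ∧ R.event l = .pingSend i j ∧ ∃ q, (R.state (l + 1)).ping i j = .request q := by
  have key : ∃ l, n ≤ l ∧ R.event l = .pingSend i j := by
    refine hF.eventually (ev := .pingSend i j) (I := fun c => c.ping i j = .atClient) trivial ?_ ?_ hn
    · exact fun c hc => ⟨_, hi, hj, hc, rfl⟩
    · intro n hm hne
      have hs := R.step n
      rcases hs.ping_token i j with e | e | e | e | e | e
      · exact e.trans hm
      · rw [hm] at e; exact e
      · exact absurd e hne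
      · rw [e] at hs
        obtain ⟨-, -, q, hs, -⟩ := hs
        rw [hm] at hs; simp at hs
      · rw [e] at hs
        obtain ⟨-, -, q, a, hs, -⟩ := hs
        rw [hm] at hs; simp at hs
      · rw [e] at hs
        obtain ⟨-, -, q, a, hs, -⟩ := hs
        rw [hm] at hs; simp at hs
  obtain ⟨l, hl, e⟩ := key
  refine ⟨l, hl, e, ?_⟩
  have hs := R.step l
  rw [e] at hs
  obtain ⟨-, -, hq, hs⟩ := hs
  rw [hs]
  dsimp only
  rw [set₂_apply, if_pos ⟨rfl, rfl⟩]
  exact ⟨_, rfl⟩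

theorem Execution.Fair.atClient (hF : R.Fair) {i j : P} (hi : i ∈ p.clients)
    (hj : j ∈ p.servers) (n : ℕ) : ∃ l, n ≤ l ∧ (R.state l).ping i j = .atClient := by
  have h3 : ∀ n q a, (R.state n).ping i j = .response q a →
      ∃ l, n ≤ l ∧ (R.state l).ping i j = .atClient := by
    intro n q a hn
    obtain ⟨l, hl, -, e⟩ := hF.pongReceive hi hj hn
    exact ⟨l + 1, by omega, e⟩
  have h2 : ∀ n q a, (R.state n).ping i j = .atServer q a →
      ∃ l, n ≤ l ∧ (R.state l).ping i j = .atClient := by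
    intro n q a hn
    obtain ⟨l, hl, -, q, a, e⟩ := hF.pongSend hi hj hn
    obtain ⟨l', hl', e⟩ := h3 _ _ _ e
    exact ⟨l', by omega, e⟩
  rcases hc : (R.state n).ping i j with _ | q | ⟨q, a⟩ | ⟨q, a⟩
  · exact ⟨n, le_rfl, hc⟩
  · obtain ⟨l, hl, -, q, a, e⟩ := hF.pingReceive hi hj hc
    obtain ⟨l', hl', e⟩ := h2 _ _ _ e
    exact ⟨l', by omega, e⟩
  · exact h2 _ _ _ hc
  · exact h3 _ _ _ hc

theorem Execution.Fair.roundTrip (hF : R.Fair) {i j : P} (hi : i ∈ p.clients)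
    (hj : j ∈ p.servers) (x : ℕ) : ∃ y, R.RoundTrip x y i j := by
  obtain ⟨l, hl, e⟩ := hF.atClient hi hj x
  obtain ⟨b₁, h1, e1, q, e⟩ := hF.pingSend hi hj e
  obtain ⟨b₂, h2, e2, q, a, e⟩ := hF.pingReceive hi hj e
  obtain ⟨b₃, h3, e3, q, a, e⟩ := hF.pongSend hi hj e
  obtain ⟨b₄, h4, e4, e⟩ := hF.pongReceive hi hj e
  exact ⟨b₄ + 1, b₁, b₂, b₃, b₄, by omega, by omega, by omega, by omega, by omega, e1, e2, e3, e4⟩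

theorem exists_forall_of_mono {α : Type*} (s : Finset α) {Q : α → ℕ → Prop}
    (hm : ∀ a y y', y ≤ y' → Q a y → Q a y') (h : ∀ a ∈ s, ∃ y, Q a y) :
    ∃ y, ∀ a ∈ s, Q a y := by
  choose! f hf using h
  exact ⟨s.sup f, fun a ha => hm a _ _ (Finset.le_sup ha) (hf a ha)⟩

theorem Execution.ServerIteration.mono {x x' y y' : ℕ} {i : P} (h : R.ServerIteration x y i)
    (hx : x' ≤ x) (hy : y ≤ y') : R.ServerIteration x' y' i := by
  obtain ⟨a, k, ha, e, h⟩ := h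
  refine ⟨a, k, hx.trans ha, e, fun j hj hij => ?_⟩
  obtain ⟨b₁, b₂, b₃, b₄, h1, h2, h3, h4, h5, h6⟩ := h j hj hij
  exact ⟨b₁, b₂, b₃, b₄, h1, h2, h3, h4, h5.trans_le hy, h6⟩

theorem Execution.RoundTrip.mono {x x' y y' : ℕ} {i j : P} (h : R.RoundTrip x y i j)
    (hx : x' ≤ x) (hy : y ≤ y') : R.RoundTrip x' y' i j := by
  obtain ⟨b₁, b₂, b₃, b₄, h1, h2, h3, h4, h5, h6⟩ := h
  exact ⟨b₁, b₂, b₃, b₄, hx.trans h1, h2, h3, h4, h5.trans_le hy, h6⟩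

theorem Execution.LinkCycle.mono {x x' y y' : ℕ} (h : R.LinkCycle x y)
    (hx : x' ≤ x) (hy : y ≤ y') : R.LinkCycle x' y' :=
  ⟨fun i hi => (h.1 i hi).mono hx hy, fun i hi j hj => (h.2 i hi j hj).mono hx hy⟩

theorem Execution.Fair.serverIteration (hF : R.Fair) {i : P} (hi : i ∈ p.servers) (x : ℕ) :
    ∃ y, R.ServerIteration x y i := by
  obtain ⟨k, hk, hki⟩ := p.exists_ne i
  obtain ⟨b₁, a, h1, h2, -, e⟩ := hF.gossip_pair hk hi hki x
  obtain ⟨y, hy⟩ := exists_forall_of_mono p.servers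
    (Q := fun j y => j ≠ i → ∃ b₁ b₂ b₃ b₄, a < b₁ ∧ b₁ < b₂ ∧ b₂ < b₃ ∧ b₃ < b₄ ∧ b₄ < y ∧
      R.event b₁ = .gossipSend i j ∧ R.event b₂ = .gossipReceive i j ∧
      R.event b₃ = .gossipSend j i ∧ R.event b₄ = .gossipReceive j i)
    (by
      intro j y y' hy h hj
      obtain ⟨b₁, b₂, b₃, b₄, h1, h2, h3, h4, h5, h6⟩ := h hj
      exact ⟨b₁, b₂, b₃, b₄, h1, h2, h3, h4, h5.trans_le hy, h6⟩)
    (by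
      intro j hj
      by_cases hij : j = i
      · exact ⟨0, fun h => absurd hij h⟩
      obtain ⟨b₁, b₂, h1, h2, e1, e2⟩ := hF.gossip_pair hi hj (Ne.symm hij) (a + 1)
      obtain ⟨b₃, b₄, h3, h4, e3, e4⟩ := hF.gossip_pair hj hi hij (b₂ + 1)
      exact ⟨b₄ + 1, fun _ => ⟨b₁, b₂, b₃, b₄, by omega, by omega, by omega, by omega, by omega,
        e1, e2, e3, e4⟩⟩)
  exact ⟨y, a, k, by omega, e, hy⟩

theorem Execution.Fair.linkCycle (hF : R.Fair) (x : ℕ) : ∃ y, R.LinkCycle x y := by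
  obtain ⟨y₁, h1⟩ := exists_forall_of_mono p.servers (Q := fun i y => R.ServerIteration x y i)
    (fun i y y' hy h => h.mono le_rfl hy) (fun i hi => hF.serverIteration hi x)
  obtain ⟨y₂, h2⟩ := exists_forall_of_mono p.clients
    (Q := fun i y => ∀ j ∈ p.servers, R.RoundTrip x y i j)
    (fun i y y' hy h j hj => (h j hj).mono le_rfl hy)
    (fun i hi => exists_forall_of_mono p.servers (Q := fun j y => R.RoundTrip x y i j)
      (fun j y y' hy h => h.mono le_rfl hy) (fun j hj => hF.roundTrip hi hj x))
  exact ⟨max y₁ y₂, fun i hi => (h1 i hi).mono le_rfl (le_max_left _ _),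
    fun i hi j hj => (h2 i hi j hj).mono le_rfl (le_max_right _ _)⟩

/-! ### Counting cycles -/

theorem Execution.CycleDone.linkCycle {x y : ℕ} (h : R.CycleDone x y) : R.LinkCycle x y :=
  ⟨h.1, h.2.1⟩

/-- Only the client rounds need care, since a longer segment may contain more active clients. A
client active before `x` but not from `x` on has become inactive in between, and this itself ends a
round. -/
theorem Execution.CycleDone.extend {x x' y : ℕ} (h : R.CycleDone x y) (hx : x' ≤ x) :
    R.CycleDone x' y := by
  refine ⟨(h.linkCycle.mono hx le_rfl).1, (h.linkCycle.mono hx le_rfl).2, fun i hi hn => ?_⟩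
  obtain ⟨n, hn, hny, hp⟩ := hn
  have hxy := h.linkCycle.lt
  by_cases hc : ∃ n, x ≤ n ∧ n < y ∧ ((R.state n).cli i).proc ≠ none
  · obtain ⟨m, h1, h2, h3⟩ := h.2.2 i hi hc
    exact ⟨m, hx.trans h1, h2, h3⟩
  · push Not at hc
    have hnx : n < x := by
      by_contra hge
      exact hp (hc n (by omega) hny)
    by_contra hno
    push Not at hno
    have : ∀ m, n ≤ m → m ≤ x → ((R.state m).cli i).proc ≠ none := by
      intro m hm
      induction m, hm using Nat.le_induction with
      | base => exact fun _ => hp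
      | succ m hm ih =>
        intro hmx e
        have hm' := ih (by omega)
        exact hno m (by omega) (by omega) ⟨hm', fun e' => hm' (e'.symm.trans e)⟩
    exact this x hnx.le le_rfl (hc x le_rfl hxy)

theorem Execution.CyclesEnd.le {x n z : ℕ} (h : R.CyclesEnd x n z) : x ≤ z := by
  induction h with
  | zero => exact le_rfl
  | succ _ hc ih => exact ih.trans hc.1.linkCycle.lt.le

/-- Cycles counted from `x` start no later than the corresponding ones from 0, shifted by `a`, and
by `CycleDone.extend` they end no later. If the execution has fewer than `a + m` cycles, the claim
is vacuous. -/
theorem Execution.Within.trans {a m x u : ℕ} (h : R.Within 0 a x) (h' : R.Within x m u) :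
    R.Within 0 (a + m) u := by
  refine ⟨Nat.zero_le _, fun z hz => ?_⟩
  have key : ∀ m z, R.CyclesEnd 0 (a + m) z → ∃ y, R.CyclesEnd x m y ∧ y ≤ z := by
    classical
    intro m
    induction m with
    | zero => exact fun z hz => ⟨x, .zero, h.2 z hz⟩
    | succ m ih =>
      intro z hz
      cases hz with
      | succ hp hc =>
        obtain ⟨y', h1, h2⟩ := ih _ hp
        have hd : ∃ y, R.CycleDone y' y := ⟨z, hc.1.extend h2⟩
        exact ⟨Nat.find hd, .succ h1 ⟨Nat.find_spec hd, fun _ hy => Nat.find_min hd hy⟩,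
          Nat.find_min' hd (hc.1.extend h2)⟩
  obtain ⟨y, h1, h2⟩ := key m z hz
  exact (h'.2 y h1).trans h2

theorem Execution.Within.mono {a b x : ℕ} (h : R.Within 0 a x) (hab : a ≤ b) :
    R.Within 0 b x := by
  obtain ⟨m, rfl⟩ := Nat.exists_eq_add_of_le hab
  exact h.trans ⟨le_rfl, fun z hz => hz.le⟩

/-- Link cycles from a state that is reached early: they end early, too. -/
theorem Execution.Fair.exists_linkCycles (hF : R.Fair) {a y : ℕ} (hy : R.Within 0 a y) :
    ∃ w : ℕ → ℕ, w 0 = y ∧ (∀ k, R.LinkCycle (w k) (w (k + 1))) ∧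
      ∀ k n, n ≤ w k → R.Within 0 (a + k) n := by
  classical
  have hex : ∀ x, ∃ y, R.LinkCycle x y ∧ ∀ y', R.LinkCycle x y' → y ≤ y' := fun x =>
    ⟨Nat.find (hF.linkCycle x), Nat.find_spec (hF.linkCycle x), fun y' h => Nat.find_min' _ h⟩
  choose f hf hmin using hex
  refine ⟨fun k => f^[k] y, rfl, fun k => ?_, fun k n hn => ⟨Nat.zero_le _, fun z hz => ?_⟩⟩
  · simp only [Function.iterate_succ_apply']
    exact hf _
  · refine hn.trans ?_
    clear hn
    induction k generalizing z with
    | zero => exact hy.2 z hz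
    | succ k ih =>
      simp only [Function.iterate_succ_apply']
      cases hz with
      -- The greedily chosen link cycle starts no later than the asynchronous cycle and hence ends
      -- no later, because the latter contains a link cycle.
      | succ hp hc => exact hmin _ _ (hc.1.linkCycle.mono (ih _ hp) le_rfl)

/-! ### The effect of a global reset -/

/-- The state of a node after a local reset. -/
def WasReset (c : State P W V) (i : P) : Prop :=
  (∀ r ∈ (c.srv i).store, (ofLex r.tag).1 = 1) ∧ (∀ k, (c.srv i).rx k = ⟨⊥, ⊥, ⊥⟩) ∧
    (c.srv i).tx = ⟨⊥, ⊥, ⊥⟩ ∧ c.cli i = .idle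

theorem WasReset.congr {i : P} (h : WasReset c i) (h1 : c'.srv i = c.srv i)
    (h2 : c'.cli i = c.cli i) : WasReset c' i := by
  unfold WasReset
  rw [h1, h2]
  exact h

theorem wasReset_of_localReset {i : P} {t : Tag P} (hs : Step p c (.localReset i t) c') :
    WasReset c' i := by
  obtain ⟨-, -, rfl⟩ := hs
  refine ⟨fun r hr => ?_, fun k => ?_, ?_, ?_⟩
  · simp only [Function.update_self, localResetServer] at hr
    induction t using WithBot.recBotCoe with
    | bot => simp [localResetStore] at hr
    | coe t =>
      obtain ⟨r', -, rfl⟩ := Finset.mem_image.1 hr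
      rfl
  all_goals simp [localResetServer]

theorem Step.wasReset (hs : Step p c ev c') {i : P} (hd : c.Disabled i) (h : WasReset c i) :
    WasReset c' i := by
  cases ev with
  | gossipSend a b => obtain ⟨-, -, -, -, rfl⟩ := hs; exact h
  | gossipReceive a b =>
    obtain ⟨-, -, -, m, -, rfl⟩ := hs
    refine h.congr ?_ rfl
    dsimp only
    by_cases e : i = b
    · subst e
      rcases m with _ | m
      · rfl
      · rw [hd.1]
    · rcases m with _ | m
      · rfl
      · cases c.srvOn b
        · rfl
        · simp [Function.update_of_ne e]
  | pingSend a b =>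
    obtain ⟨-, -, -, rfl⟩ := hs
    refine h.congr rfl ?_
    dsimp only
    split_ifs with hon
    · rw [Function.update_of_ne]
      rintro rfl
      rw [hd.2] at hon
      simp at hon
    · rfl
  | pingReceive a b =>
    obtain ⟨-, -, q, hq, hs⟩ := hs
    split at hs
    · rename_i hon
      obtain ⟨x, x', -, -, rfl⟩ := hs
      refine h.congr ?_ rfl
      dsimp only
      rw [Function.update_of_ne]
      rintro rfl
      rw [hd.1] at hon
      simp at hon
    · subst hs; exact h
  | pongSend a b => obtain ⟨-, -, q, x, -, rfl⟩ := hs; exact h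
  | pongReceive a b =>
    obtain ⟨-, -, q, x, -, rfl⟩ := hs
    refine h.congr rfl ?_
    dsimp only
    split_ifs with hon
    · rw [Function.update_of_ne]
      rintro rfl
      rw [hd.2] at hon
      simp at hon
    · rfl
  | startWrite a s =>
    obtain ⟨-, hon, -, rfl⟩ := hs
    refine h.congr rfl ?_
    dsimp only
    rw [Function.update_of_ne]
    rintro rfl
    rw [hd.2] at hon
    simp at hon
  | startRead a =>
    obtain ⟨-, hon, -, rfl⟩ := hs
    refine h.congr rfl ?_
    dsimp only
    rw [Function.update_of_ne]
    rintro rfl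
    rw [hd.2] at hon
    simp at hon
  | resetSend a b => simp only [Step] at hs; subst hs; exact h
  | resetReceive a b => simp only [Step] at hs; subst hs; exact h
  | disable a => simp only [Step] at hs; subst hs; exact h
  | localReset a t =>
    by_cases e : i = a
    · subst e
      exact wasReset_of_localReset hs
    · obtain ⟨-, -, rfl⟩ := hs
      exact h.congr (Function.update_of_ne e _ _) (Function.update_of_ne e _ _)
  | clean a => obtain ⟨-, -, rfl⟩ := hs; exact h
  | enable A => simp only [Step] at hs; subst hs; exact h

theorem GossipLink.clear_clear (l : GossipLink P) : l.clear.clear = l.clear := by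
  cases l <;> rfl

theorem PingLink.clear_clear (l : PingLink P W) : l.clear.clear = l.clear := by
  cases l <;> rfl

/-- Disabled machines put only empty payloads on the links. The lemma carries cleanness over the
step into the reset-free state without identifying that step. -/
theorem Step.cleaned (hs : Step p c ev c') (hd : ∀ i, c.Disabled i) (h : c.Cleaned) :
    c'.Cleaned := by
  cases ev with
  | gossipSend a b =>
    obtain ⟨-, -, -, -, rfl⟩ := hs
    refine ⟨fun i j => ?_, h.2⟩
    dsimp only
    rw [set₂_apply, (hd a).1, if_neg Bool.false_ne_true]
    split_ifs
    · rfl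
    · exact h.1 i j
  | gossipReceive a b =>
    obtain ⟨-, -, -, m, -, rfl⟩ := hs
    refine ⟨fun i j => ?_, h.2⟩
    dsimp only
    rw [set₂_apply]
    split_ifs
    · rfl
    · exact h.1 i j
  | pingSend a b =>
    obtain ⟨-, -, -, rfl⟩ := hs
    refine ⟨h.1, fun i j => ?_⟩
    dsimp only
    rw [set₂_apply, (hd a).2, if_neg Bool.false_ne_true]
    split_ifs
    · rfl
    · exact h.2 i j
  | pingReceive a b =>
    obtain ⟨-, -, q, hq, hs⟩ := hs
    split at hs
    · rename_i hon
      rw [(hd b).1] at hon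
      simp at hon
    · subst hs
      refine ⟨h.1, fun i j => ?_⟩
      dsimp only
      rw [set₂_apply]
      split_ifs
      · rfl
      · exact h.2 i j
  | pongSend a b =>
    obtain ⟨-, -, q, x, -, rfl⟩ := hs
    refine ⟨h.1, fun i j => ?_⟩
    dsimp only
    rw [set₂_apply, (hd b).1, if_neg Bool.false_ne_true]
    split_ifs
    · rfl
    · exact h.2 i j
  | pongReceive a b =>
    obtain ⟨-, -, q, x, -, rfl⟩ := hs
    refine ⟨h.1, fun i j => ?_⟩
    dsimp only
    rw [set₂_apply]
    split_ifs
    · rfl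
    · exact h.2 i j
  | startWrite a s => obtain ⟨-, -, -, rfl⟩ := hs; exact h
  | startRead a => obtain ⟨-, -, -, rfl⟩ := hs; exact h
  | resetSend a b => simp only [Step] at hs; subst hs; exact h
  | resetReceive a b => simp only [Step] at hs; subst hs; exact h
  | disable a => simp only [Step] at hs; subst hs; exact h
  | localReset a t => obtain ⟨-, -, rfl⟩ := hs; exact h
  | clean a =>
    obtain ⟨-, -, rfl⟩ := hs
    refine ⟨fun i j => ?_, fun i j => ?_⟩
    · dsimp only
      split_ifs
      · rw [GossipLink.clear_clear]
      · exact h.1 i j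
    · dsimp only
      split_ifs
      · rw [PingLink.clear_clear]
      · exact h.2 i j
  | enable A => simp only [Step] at hs; subst hs; exact h

theorem overflowFree_of_wasReset (h : ∀ i, WasReset c i) (hc : c.Cleaned) : c.OverflowFree p := by
  have hbot : (⊥ : Tag P) < (p.tTop : Tag P) := WithBot.bot_lt_coe _
  rintro t (⟨i, hi, (⟨r, hr, rfl⟩ | ⟨k, hk, ht⟩) | ht⟩ | ⟨i, hi, ht⟩ | ⟨i, hi, j, hj, hij, ht⟩ |
    ⟨i, hi, j, hj, ht⟩)
  · rw [WithBot.coe_lt_coe]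
    refine Prod.Lex.lt_iff.2 (Or.inl ?_)
    rw [(h i).1 r hr]
    exact p.maxInt_gt
  · rw [(h i).2.1 k] at ht
    rcases ht with rfl | rfl | rfl <;> exact hbot
  · rw [(h i).2.2.1] at ht
    rcases ht with rfl | rfl | rfl <;> exact hbot
  · rw [(h i).2.2.2] at ht
    exact ht.elim
  · rw [hc.1 i j] at ht
    rcases hl : c.gossip i j with _ | m
    · rw [hl] at ht; exact ht.elim
    · rw [hl] at ht
      obtain ⟨m', hm, -⟩ := ht
      simp at hm
  · rw [hc.2 i j] at ht
    rcases hl : c.ping i j with _ | q | ⟨q, a⟩ | ⟨q, a⟩ <;> rw [hl] at ht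
    · exact ht.elim
    all_goals
      rcases ht with ⟨r, hr, -⟩ | ⟨r, hr, -⟩ <;> simp at hr

theorem Execution.overflowFree_after_reset {x u : ℕ} (hxu : ∀ i, ∃ v t, x < v ∧ v < u ∧
      R.event v = .localReset i t ∧ ∀ w, v < w → w ≤ u → (R.state w).Disabled i)
    (hc : (R.state u).Cleaned) : (R.state (u + 1)).OverflowFree p := by
  have hd : ∀ i, (R.state u).Disabled i := fun i => by
    obtain ⟨v, t, h1, h2, -, h3⟩ := hxu i
    exact h3 u h2 le_rfl
  refine overflowFree_of_wasReset (fun i => ?_) ((R.step u).cleaned hd hc)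
  obtain ⟨v, t, h1, h2, e, h3⟩ := hxu i
  have hv := R.step v
  rw [e] at hv
  have : ∀ n, v + 1 ≤ n → n ≤ u + 1 → WasReset (R.state n) i := by
    intro n hn
    induction n, hn using Nat.le_induction with
    | base => exact fun _ => wasReset_of_localReset hv
    | succ n hn ih =>
      exact fun hn' => (R.step n).wasReset (h3 n (by omega) (by omega)) (ih (by omega))
  exact this (u + 1) (by omega) le_rfl

/-! ### Recovery -/

theorem Execution.recovery {Ψ : ℕ} (hΨ : 1 ≤ Ψ) (hF : R.Fair) (hR : R.ResetLegal Ψ) :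
    ∃ n, R.Within 0 (83 * Ψ) n ∧ (R.state n).ResetFree p ∧ (R.state n).OverflowFree p := by
  classical
  obtain ⟨y, hy, hfree⟩ := hR.spontaneous
  obtain ⟨w, hw0, hw, hwithin⟩ := hF.exists_linkCycles hy
  -- The bound covers one preparatory link cycle and the 80 cycles of `Calm.exists_overflowFree`.
  -- Calls before `w 0` are included, since `hfree` presupposes that there is none.
  by_cases hcall : ∃ x, x < w 81 ∧ ∃ i t, R.CallsReset x i t
  · have hx := Nat.find_spec hcall
    obtain ⟨u, hxu, hu, hreset, hclean, hfree'⟩ := hR.explicit (Nat.find hcall) hx.2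
      (fun n hn i t hc => Nat.find_min hcall hn ⟨hn.trans hx.1, i, t, hc⟩)
    refine ⟨u + 1, ((hwithin 81 _ hx.1.le).trans hu).mono (by omega), hfree', ?_⟩
    refine R.overflowFree_after_reset (x := Nat.find hcall) (fun i => ?_) hclean
    obtain ⟨v, t, h1, h2, h3, -, h4⟩ := hreset i
    exact ⟨v, t, h1, h2, h3, h4⟩
  · have hno : ∀ n, n < w 81 → ∀ i t, ¬ R.CallsReset n i t := fun n hn i t hc =>
      hcall ⟨n, hn, i, t, hc⟩
    have hrf : ∀ n, w 0 ≤ n → n ≤ w 81 → (R.state n).ResetFree p := fun n hn hn' =>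
      hfree n (hw0 ▸ hn) fun m hm => hno m (hm.trans_le hn')
    have hmono : Monotone w := monotone_nat_of_le_succ fun k => (hw k).lt.le
    -- The first link cycle flushes gossip without payload: each link is empty when its sender next
    -- sends, and enabled senders always attach a payload.
    have hcalm : Calm R (fun k => w (k + 1)) (w 81) := by
      refine ⟨fun k => hw (k + 1), fun n hn => hrf n ((hmono (by omega)).trans hn),
        fun n _ hn => hno n hn, fun n hn hn' i hi j hj hij => ?_⟩
      obtain ⟨b₁, b₂, h1, h2, h3, e1, -⟩ := (hw 0).gossip hi hj hij
      have hb : b₁ ≤ n := h2.le.trans (h3.le.trans hn)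
      clear hn
      induction n, hb using Nat.le_induction with
      | base =>
        have hs := R.step b₁
        rw [e1] at hs
        rw [hs.2.2.2.1]
        simp
      | succ n hn ih =>
        have h0 : w 0 ≤ n := h1.trans hn
        rcases (R.step n).gossip (hrf n h0 (by omega)) (hrf (n + 1) (by omega) hn')
          (i := i) (j := j) with e | e | e
        · rw [e.1]; exact ih (by omega)
        · rw [e.2.2]; simp
        · rw [e.2.2]; simp
    obtain ⟨n, hn, hn', hof⟩ := hcalm.exists_overflowFree le_rfl
    exact ⟨n, (hwithin 81 n hn').mono (by omega), hrf n ((hmono (by omega)).trans hn) hn', hof⟩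

end FairLemmas

end BoundedCAS

theorem mainTheorem10 :
    ∃ C : ℕ, ∀ (P W V : Type*) [Fintype P] [LinearOrder P] [Nonempty P] [DecidableEq W]
      (p : BoundedCAS.Setup P W V) (Ψ : ℕ) (R : BoundedCAS.Execution p),
      1 ≤ Ψ → R.Fair → R.ResetLegal Ψ →
      (∃ i ∈ p.servers, ∃ r ∈ ((R.state 0).srv i).store, p.tTop ≤ r.tag) →
      ∃ n, R.Within 0 (C * Ψ) n ∧
        (R.state n).ResetFree p ∧ (R.state n).OverflowFree p := by
  refine ⟨83, fun P W V _ _ _ _ p Ψ R hΨ hF hR _ => ?_⟩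
  exact R.recovery hΨ hF hR
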